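/- Let $N\ge 4$ and $L,K\in\mathbb C^\times$. Let $$\mathcal B_L=\mathcal B_L(D_N^{(1)})=\{l=(l_1,\dots,l_N,\bar l_{N-1},\dots,\bar l_1)\in(\mathbb C^\times)^{2N-1}\mid l_1\cdots l_N\bar l_{N-1}\cdots\bar l_1=L\}$$ be the variety underlying the $D_N^{(1)}$-geometric crystal of level $L$. For $l\in\mathcal B_L$ let $M_L(l,z)=A(l)+zB(l)+z^2C(l)$ be the $2N\times 2N$ M-matrix, where $C(l)=L\,E_{1,2N}$, $B(l)_{i,j}=A(l)_{i,1}A(l)_{2N,j}-L\,A(l)_{i,j}-\delta_{i,1}\delta_{j,2N}$, and $A(l)$ is the lower triangular matrix with diagonal entries $A_{i,i}=l_i/\bar l_i$ and $A_{2N+1-i,2N+1-i}=\bar l_i/l_i$ $(1\le i\le N-1)$, $A_{N,N}=l_N$, $A_{N+1,N+1}=1/l_N$; with $A_{i,j}=l_j\cdots l_{i-1}(1+l_i/\bar l_i)$ and $A_{2N+1-j,2N+1-i}=\bar l_j\cdots\bar l_{i-1}(1+\bar l_i/l_i)$ for $1\le j<i\le N-1$; with $A_{N,j}=l_j\cdots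 l_N$, $A_{N+1,j}=l_j\cdots l_{N-1}$, $A_{2N+1-j,N}=\bar l_j\cdots\bar l_{N-1}l_N$, $A_{2N+1-j,N+1}=\bar l_j\cdots\bar l_{N-1}$ for $1\le j\le N-1$; with $A_{2N+1-i,j}=(l_j\cdots l_N)(\bar l_i\cdots\bar l_{N-1})$ for $1\le i,j\le N-1$; and with all other entries $0$. Consider the following involutions $l\mapsto l'$ of $\mathcal B_L(D_N^{(1)})$; coordinates not mentioned are unchanged. * $\Sigma_0^{(n)}$ ($N=n+1$): $l_1'=\bar l_1$, $\bar l_1'=l_1$. * $\Sigma_1^{(n)}$ ($N=n+1$): $l_n'=l_nl_{n+1}$, $l_{n+1}'=1/l_{n+1}$, $\bar l_n'=l_{n+1}\bar l_n$. * $\Sigma_2^{(n)}$ ($N=2n$; a rational map, defined where $l_i+\bar l_i\neq0$ for $2\le i\le 2n-1$): $l_1'=\frac{l_{2n-1}\bar l_{2n-1}}{l_{2n-1}+\bar l_{2n-1}}$, $\bar l_1'=l_{2n}l_1'$, $l_{2n}'=\bar l_1/l_1$, $l_{2n-1}'=\frac{l_1\bar l_2}{l_2}\left(\frac{l_2}{\bar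 l_2}+1\right)$, $\bar l_{2n-1}'=l_1\left(\frac{l_2}{\bar l_2}+1\right)$, and, for $2\le i\le 2n-2$, $l_{2n-i}'=\frac{l_i\bar l_i}{l_{i+1}}\cdot\frac{l_{i+1}+\bar l_{i+1}}{l_i+\bar l_i}$, $\bar l_{2n-i}'=\frac{l_i\bar l_i}{\bar l_{i+1}}\cdot\frac{l_{i+1}+\bar l_{i+1}}{l_i+\bar l_i}$. * $\Sigma_3^{(n)}=\Sigma_0^{(n+1)}\Sigma_1^{(n+1)}$ ($N=n+2$). * $\Sigma_4^{(n)}=\Sigma_2^{(n+1)}\Sigma_1^{(2n+1)}\Sigma_0^{(2n+1)}$ ($N=2n+2$). Let $X_i^{(n,L)}=\{l\in\mathcal B_L(D_N^{(1)})\mid\Sigma_i^{(n)}\text{ is defined at }l,\ \Sigma_i^{(n)}(l)=l\}$ $(0\le i\le 4)$, with $N$ as listed. For $N=2n+2$ let also $\widetilde X_4^{(n,L)}$ be the set of points of $\mathcal B_L(D_{2n+2}^{(1)})$ fixed by each of $\Sigma_0^{(2n+1)}$, $\Sigma_1^{(2n+1)}$, $\Sigma_2^{(n+1)}$, that is, the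 fixed points of $\Sigma_2^{(n+1)}$ with $l_1=\bar l_1$ and $l_{2n+2}=1$. **Theorem.** 1. There is one and only one rational map $\mathcal R_{LK}:\mathcal B_L\times\mathcal B_K\dashrightarrow\mathcal B_K\times\mathcal B_L$, $(l,m)\mapsto(l',m')$, such that $(l',m')$ satisfies $M_L(l,z)M_K(m,z)=M_K(l',z)M_L(m',z)$ (identically in $z$) wherever the map is defined, and is the only solution of this equation in $\mathcal B_K\times\mathcal B_L$ for all $(l,m)$ in a dense Zariski-open subset. The map $\mathcal R_{LK}$ is birational. 2. For all $i\in\{0,1,2,3,4\}$ and all $n$ for which the rank belonging to $\Sigma_i^{(n)}$ is $N$, the restriction of $\mathcal R_{LK}$ is a well-defined birational map $X_i^{(n,L)}\times X_i^{(n,K)}\dashrightarrow X_i^{(n,K)}\times X_i^{(n,L)}$. The same holds, when $N=2n+2$, with $\widetilde X_4$ in place of $X_4$. Here a rational map is considered on its maximal domain of definition. The restriction of $\mathcal R_{LK}$ to $X$ with target $Y$ is a well-defined birational map if the domain of definition of $\mathcal R_{LK}$ meets $X$ in a Zariski-dense subset of $X$, on which the values lie in $Y$, and the resulting map restricts to an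 isomorphism from a dense open subset of $X$ onto a dense open subset of $Y$ ($X$ and $Y$ may be reducible). -/

import Mathlib

noncomputable section

namespace FoldedR

open scoped Polynomial

/-! ### Rational maps between quasi-affine subsets of complex affine spaces -/

section RationalMaps

variable {ι κ : Type*}

/-- `U` is a Zariski-open subset of `X` (for the topology induced on `X`). -/
def IsZariskiOpenIn (X U : Set (ι → ℂ)) : Prop :=
  U ⊆ X ∧ ∀ x ∈ U, ∃ q : MvPolynomial ι ℂ, MvPolynomial.eval x q ≠ 0 ∧
    ∀ y ∈ X, MvPolynomial.eval y q ≠ 0 → y ∈ U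

/-- The Zariski closure of `U` contains `X`. -/
def IsZariskiDenseIn (X U : Set (ι → ℂ)) : Prop :=
  ∀ q : MvPolynomial ι ℂ, (∀ x ∈ U, MvPolynomial.eval x q = 0) →
    ∀ x ∈ X, MvPolynomial.eval x q = 0

/-- `f` is a regular map on `U`: each coordinate is locally a quotient of two polynomials. -/
def IsRegularOn (U : Set (ι → ℂ)) (f : (ι → ℂ) → (κ → ℂ)) : Prop :=
  ∀ x ∈ U, ∀ k : κ, ∃ p q : MvPolynomial ι ℂ, MvPolynomial.eval x q ≠ 0 ∧
    ∀ y ∈ U, MvPolynomial.eval y q ≠ 0 →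
      f y k = MvPolynomial.eval y p / MvPolynomial.eval y q

/-- A rational map `X ⇢ Y`, given on its domain of definition: a regular map to `Y` on a dense
open subset of `X` that cannot be extended to a larger open subset of `X`.  The values of `toFun`
outside `dom` carry no meaning. -/
structure RationalMap (X : Set (ι → ℂ)) (Y : Set (κ → ℂ)) where
  dom : Set (ι → ℂ)
  toFun : (ι → ℂ) → (κ → ℂ)
  isOpen : IsZariskiOpenIn X dom
  isDense : IsZariskiDenseIn X dom
  isRegular : IsRegularOn dom toFun
  mapsTo : Set.MapsTo toFun dom Y
  maximal : ∀ (U : Set (ι → ℂ)) (g : (ι → ℂ) → (κ → ℂ)),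
    IsZariskiOpenIn X U → IsZariskiDenseIn X U → IsRegularOn U g → Set.MapsTo g U Y →
    Set.EqOn g toFun (dom ∩ U) → U ⊆ dom

/-- The map `f`, defined on `D ⊆ X`, is birational from `X` to `Y`: it restricts to an
isomorphism from a dense open subset of `X` to a dense open subset of `Y`.  (`X` and `Y` may be
reducible.) -/
def IsBirationalOn (X : Set (ι → ℂ)) (Y : Set (κ → ℂ)) (D : Set (ι → ℂ))
    (f : (ι → ℂ) → (κ → ℂ)) : Prop :=
  ∃ (U : Set (ι → ℂ)) (V : Set (κ → ℂ)) (g : (κ → ℂ) → (ι → ℂ)),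
    U ⊆ D ∧ IsZariskiOpenIn X U ∧ IsZariskiDenseIn X U ∧
    IsZariskiOpenIn Y V ∧ IsZariskiDenseIn Y V ∧
    IsRegularOn U f ∧ IsRegularOn V g ∧
    Set.MapsTo f U V ∧ Set.MapsTo g V U ∧ Set.InvOn g f U V

/-- The rational map `R` is birational. -/
def RationalMap.IsBirational {X : Set (ι → ℂ)} {Y : Set (κ → ℂ)} (R : RationalMap X Y) : Prop :=
  IsBirationalOn X Y R.dom R.toFun

/-- The restriction of `R` to `X'` is a well-defined birational map `X' ⇢ Y'`: the domain of
definition of `R` meets `X'` in a dense subset of `X'`, on which `R` takes values in `Y'`, and the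
rational map obtained in this way is birational. -/
def RationalMap.RestrictsBirationally {X : Set (ι → ℂ)} {Y : Set (κ → ℂ)} (R : RationalMap X Y)
    (X' : Set (ι → ℂ)) (Y' : Set (κ → ℂ)) : Prop :=
  IsZariskiDenseIn X' (R.dom ∩ X') ∧ Set.MapsTo R.toFun (R.dom ∩ X') Y' ∧
    IsBirationalOn X' Y' (R.dom ∩ X') R.toFun

/-- The product of `X` and `Y` inside the product of the two affine spaces. -/
def prodSet (X : Set (ι → ℂ)) (Y : Set (κ → ℂ)) : Set (ι ⊕ κ → ℂ) :=
  {p | p ∘ Sum.inl ∈ X ∧ p ∘ Sum.inr ∈ Y}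

end RationalMaps

/-! ### The variety underlying the geometric crystal of type `D_N^(1)` -/

/-- Indices of the coordinates `(l₁, …, l_N, l̄_{N-1}, …, l̄₁)`: the element `k` of the first
(second) summand stands for `l_{k+1}` (for `l̄_{k+1}`). -/
abbrev Idx (N : ℕ) : Type := Fin N ⊕ Fin (N - 1)

variable {N : ℕ}

/-- The coordinate `l_i`, `1 ≤ i ≤ N`. -/
def co (l : Idx N → ℂ) (i : ℕ) : ℂ :=
  if h : 1 ≤ i ∧ i ≤ N then l (Sum.inl ⟨i - 1, by omega⟩) else 1

/-- The coordinate `l̄_i`, `1 ≤ i ≤ N - 1`. -/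
def cobar (l : Idx N → ℂ) (i : ℕ) : ℂ :=
  if h : 1 ≤ i ∧ i ≤ N - 1 then l (Sum.inr ⟨i - 1, by omega⟩) else 1

/-- The point with `l_i = f i` and `l̄_i = g i`. -/
def mkPoint (N : ℕ) (f g : ℕ → ℂ) : Idx N → ℂ :=
  Sum.elim (fun k => f (k.val + 1)) (fun k => g (k.val + 1))

/-- The variety `𝓑_L(D_N^(1))`: all coordinates are nonzero and their product is `L`. -/
def crystalB (N : ℕ) (L : ℂ) : Set (Idx N → ℂ) :=
  {l | (∀ k, l k ≠ 0) ∧ ∏ k, l k = L}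

/-! ### The M-matrix -/

/-- The entry in row `i` and column `j` of the matrix `A(l)`, where `1 ≤ i, j ≤ 2 N`. -/
def entryA (l : Idx N → ℂ) (i j : ℕ) : ℂ :=
  if i = j then
    if i ≤ N - 1 then co l i / cobar l i
    else if i = N then co l N
    else if i = N + 1 then 1 / co l N
    else cobar l (2 * N + 1 - i) / co l (2 * N + 1 - i)
  else if j < i ∧ i ≤ N - 1 then
    (∏ k ∈ Finset.Icc j (i - 1), co l k) * (1 + co l i / cobar l i)
  else if N + 2 ≤ j ∧ j < i then
    (∏ k ∈ Finset.Icc (2 * N + 1 - i) (2 * N - j), cobar l k) *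
      (1 + cobar l (2 * N + 1 - j) / co l (2 * N + 1 - j))
  else if i = N ∧ j ≤ N - 1 then ∏ k ∈ Finset.Icc j N, co l k
  else if i = N + 1 ∧ j ≤ N - 1 then ∏ k ∈ Finset.Icc j (N - 1), co l k
  else if N + 2 ≤ i ∧ j = N then
    (∏ k ∈ Finset.Icc (2 * N + 1 - i) (N - 1), cobar l k) * co l N
  else if N + 2 ≤ i ∧ j = N + 1 then ∏ k ∈ Finset.Icc (2 * N + 1 - i) (N - 1), cobar l k
  else if N + 2 ≤ i ∧ j ≤ N - 1 then
    (∏ k ∈ Finset.Icc j N, co l k) * ∏ k ∈ Finset.Icc (2 * N + 1 - i) (N - 1), cobar l k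
  else 0

/-- `δ_{i,1} δ_{j,2N}`. -/
def cornerDelta (N i j : ℕ) : ℂ := if i = 1 ∧ j = 2 * N then 1 else 0

/-- The entry in row `i` and column `j` of `B(l)`, where `1 ≤ i, j ≤ 2 N`. -/
def entryB (L : ℂ) (l : Idx N → ℂ) (i j : ℕ) : ℂ :=
  entryA l i 1 * entryA l (2 * N) j - L * entryA l i j - cornerDelta N i j

/-- The entry in row `i` and column `j` of `C(l) = L E_{1,2N}`, where `1 ≤ i, j ≤ 2 N`. -/
def entryC (N : ℕ) (L : ℂ) (i j : ℕ) : ℂ := L * cornerDelta N i j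

/-- The M-matrix `M_L(l, z) = A(l) + z B(l) + z² C(l)`; the indeterminate `z` is `Polynomial.X`. -/
def matM (L : ℂ) (l : Idx N → ℂ) : Matrix (Fin (2 * N)) (Fin (2 * N)) ℂ[X] :=
  Matrix.of fun r s =>
    Polynomial.C (entryA l (r.val + 1) (s.val + 1)) +
      Polynomial.X * Polynomial.C (entryB L l (r.val + 1) (s.val + 1)) +
      Polynomial.X ^ 2 * Polynomial.C (entryC N L (r.val + 1) (s.val + 1))

/-- For `p = (l, m)` and `q = (l', m')` this is the equation
`M_L(l, z) M_K(m, z) = M_K(l', z) M_L(m', z)`. -/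
def MEquation (L K : ℂ) (p q : Idx N ⊕ Idx N → ℂ) : Prop :=
  matM L (p ∘ Sum.inl) * matM K (p ∘ Sum.inr) = matM K (q ∘ Sum.inl) * matM L (q ∘ Sum.inr)

/-- `R` is the rational map `(l, m) ↦ (l', m')` defined by the M-matrix equation: `(l', m')` is a
solution in `𝓑_K × 𝓑_L` wherever `R` is defined, and it is the only one for all `(l, m)` in
a dense open set. -/
def IsDefinedByMEquation {L K : ℂ}
    (R : RationalMap (prodSet (crystalB N L) (crystalB N K))
      (prodSet (crystalB N K) (crystalB N L))) : Prop :=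
  (∀ p ∈ R.dom, MEquation L K p (R.toFun p)) ∧
  ∃ U ⊆ R.dom, IsZariskiOpenIn (prodSet (crystalB N L) (crystalB N K)) U ∧
    IsZariskiDenseIn (prodSet (crystalB N L) (crystalB N K)) U ∧
    ∀ p ∈ U, ∀ q ∈ prodSet (crystalB N K) (crystalB N L), MEquation L K p q → q = R.toFun p

/-! ### The folding involutions and their fixed-point varieties -/

/-- `Σ₀`: exchanges `l₁` and `l̄₁`. -/
def sigma0 (l : Idx N → ℂ) : Idx N → ℂ :=
  mkPoint N (fun i => if i = 1 then cobar l 1 else co l i)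
    (fun i => if i = 1 then co l 1 else cobar l i)

/-- `Σ₁`. -/
def sigma1 (l : Idx N → ℂ) : Idx N → ℂ :=
  mkPoint N
    (fun i => if i = N - 1 then co l (N - 1) * co l N else if i = N then 1 / co l N else co l i)
    (fun i => if i = N - 1 then co l N * cobar l (N - 1) else cobar l i)

/-- `Σ₂`; it is defined where the denominators `l_i + l̄_i`, `2 ≤ i ≤ N - 1`, do not vanish. -/
def sigma2 (l : Idx N → ℂ) : Idx N → ℂ :=
  mkPoint N
    (fun j =>
      if j = 1 then
        co l (N - 1) * cobar l (N - 1) / (co l (N - 1) + cobar l (N - 1))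
      else if j = N - 1 then co l 1 * cobar l 2 / co l 2 * (co l 2 / cobar l 2 + 1)
      else if j = N then cobar l 1 / co l 1
      else
        co l (N - j) * cobar l (N - j) / co l (N - j + 1) *
          ((co l (N - j + 1) + cobar l (N - j + 1)) / (co l (N - j) + cobar l (N - j))))
    (fun j =>
      if j = 1 then
        co l N * co l (N - 1) * cobar l (N - 1) / (co l (N - 1) + cobar l (N - 1))
      else if j = N - 1 then co l 1 * (co l 2 / cobar l 2 + 1)
      else
        co l (N - j) * cobar l (N - j) / cobar l (N - j + 1) *
          ((co l (N - j + 1) + cobar l (N - j + 1)) / (co l (N - j) + cobar l (N - j))))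

/-- The denominators of `Σ₂` do not vanish at `l`.  (They are the same for `Σ₂ ∘ Σ₁ ∘ Σ₀`.) -/
def Sigma2DefinedAt (l : Idx N → ℂ) : Prop :=
  ∀ i, 2 ≤ i → i ≤ N - 1 → co l i + cobar l i ≠ 0

/-- The rank `N` of the type `D_N^(1)` on which `Σ_i^(n)` acts. -/
def foldRank : Fin 5 → ℕ → ℕ
  | 0, n => n + 1
  | 1, n => n + 1
  | 2, n => 2 * n
  | 3, n => n + 2
  | 4, n => 2 * n + 2

/-- The involution `Σ_i^(n)` on type `D_N^(1)`, where `N = foldRank i n`. -/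
def sigma : Fin 5 → (Idx N → ℂ) → (Idx N → ℂ)
  | 0, l => sigma0 l
  | 1, l => sigma1 l
  | 2, l => sigma2 l
  | 3, l => sigma0 (sigma1 l)
  | 4, l => sigma2 (sigma1 (sigma0 l))

/-- `Σ_i` is defined at `l`. -/
def SigmaDefinedAt : Fin 5 → (Idx N → ℂ) → Prop
  | 0, _ => True
  | 1, _ => True
  | 2, l => Sigma2DefinedAt l
  | 3, _ => True
  | 4, l => Sigma2DefinedAt l

/-- The fixed-point variety `X_i^(n,L)` of `Σ_i^(n)` in `𝓑_L(D_N^(1))`, where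
`N = foldRank i n`. -/
def fixedVariety (i : Fin 5) (N : ℕ) (L : ℂ) : Set (Idx N → ℂ) :=
  {l | l ∈ crystalB N L ∧ SigmaDefinedAt i l ∧ sigma i l = l}

/-- The points of `𝓑_L(D_N^(1))` fixed by each of `Σ₀`, `Σ₁` and `Σ₂`, i.e. the fixed points of
`Σ₂` with `l₁ = l̄₁` and `l_N = 1`. -/
def commonFixedVariety (N : ℕ) (L : ℂ) : Set (Idx N → ℂ) :=
  {l | l ∈ crystalB N L ∧ Sigma2DefinedAt l ∧ sigma0 l = l ∧ sigma1 l = l ∧ sigma2 l = l}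

end FoldedR

end

/-! Let u be the first column and v the last row of A(l). Up to a sparse correction, mostly carrying
a factor 1 - Lz, M_L(l, z) is the rank one matrix u vᵀ / L with the entries above the diagonal
multiplied by Lz; at z = 1/L it is exactly u vᵀ / L (`entryM_eq`, `evalM_inv_level`). Moreover
M_L(l, z) S M_L(l, z)ᵀ = (1 - Lz)² S for an antidiagonal sign matrix S
(`evalM_mul_signMat_mul_transpose`), and v is isotropic for the form S. The partial sums of this
form at v are ± L l̄₁⋯l̄_k / (l₁⋯l_k), so l can be read off from the line spanned by v: 𝓑_L is an
open piece of the quadric of isotropic lines (`pointOf_rowV`, `rowV_pointOf`). Transposing M along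
the antidiagonal gives the M-matrix of another point `dag l` and exchanges u and v, so left factors
need no theory of their own.

Uniqueness. At z = 1/L both sides of the M-equation have rank one, which forces v(m') to be
proportional to v(l) M_K(m, 1/L); dually, u(l') is proportional to M_L(l, 1/K) u(m). Where these
vectors are good, that is, come from points of the crystal, (l', m') is determined (`eq_rmap`).

Existence for L ≠ K (`refactorization`). Define l', m' by the two proportionalities. Then M_K(l')⁻¹
M_L(l) M_K(m) M_L(m')⁻¹ has at most double poles, at 1/L and 1/K. Isotropy and the proportionalities
cancel both orders (`sq_dvd_polyForm`). The resulting polynomial matrix is lower triangular at z = 0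
and tends to the identity at infinity in the principal grading, so it is the identity
(`eq_scalar_of_tendsto`). By uniqueness the map with L and K exchanged is the inverse. For L = K the
map is the identity.

Folding. Each of Σ₀, Σ₁, Σ₂ and Σ₂Σ₁Σ₀ acts on v through a monomial operator T whose entries are
powers of the level, and the fixed points are the l with v an eigenvector of T. If m is fixed, then
T, with 1/z in place of the level, commutes with M_K(m, z) (`foldExp_mul_evalM`); at z = 1/L this
makes v(l) M_K(m, 1/L) an eigenvector of T of level L. The fixed varieties are stable under `dag`
(`foldOp_dag`), so both components of the image are fixed.

Density of good pairs. Fix m and choose b with b M_K(m, 1/L) = v(l); it lies in the same eigenspaces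
as v(l). Join v(l) to b inside the isotropic cone of the common eigenspace, by a line if they are
orthogonal and by a conic through a third vector otherwise. The curve is good at b, so by the
identity theorem it is good near v(l), apart from v(l) itself. For Σ₀ and Σ₁ the eigenspace is
nondegenerate and large enough for a conic; for Σ₂ and Σ₂Σ₁Σ₀, with N even, it is totally isotropic
and a line suffices. -/

namespace FoldedR

/-! ### Regular functions -/

section Regular

variable {ι κ : Type*}

/-- The regular functions on `U`: locally quotients of two polynomials. -/
def regularFunctions (U : Set (ι → ℂ)) : Subalgebra ℂ ((ι → ℂ) → ℂ) where
  carrier := {f | ∀ x ∈ U, ∃ p q : MvPolynomial ι ℂ, MvPolynomial.eval x q ≠ 0 ∧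
    ∀ y ∈ U, MvPolynomial.eval y q ≠ 0 → f y = MvPolynomial.eval y p / MvPolynomial.eval y q}
  mul_mem' := by
    intro f g hf hg x hx
    obtain ⟨p, q, hq, h⟩ := hf x hx
    obtain ⟨p', q', hq', h'⟩ := hg x hx
    refine ⟨p * p', q * q', by simp [hq, hq'], fun y hy hne => ?_⟩
    simp only [map_mul, mul_ne_zero_iff] at hne ⊢
    rw [Pi.mul_apply, h y hy hne.1, h' y hy hne.2, div_mul_div_comm]
  add_mem' := by
    intro f g hf hg x hx
    obtain ⟨p, q, hq, h⟩ := hf x hx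
    obtain ⟨p', q', hq', h'⟩ := hg x hx
    refine ⟨p * q' + q * p', q * q', by simp [hq, hq'], fun y hy hne => ?_⟩
    simp only [map_mul, map_add, mul_ne_zero_iff] at hne ⊢
    rw [Pi.add_apply, h y hy hne.1, h' y hy hne.2, div_add_div _ _ hne.1 hne.2]
  algebraMap_mem' := by
    intro c x _
    exact ⟨MvPolynomial.C c, 1, by simp, fun y _ _ => by simp⟩

theorem isRegularOn_iff {U : Set (ι → ℂ)} {f : (ι → ℂ) → (κ → ℂ)} :
    IsRegularOn U f ↔ ∀ k, (fun x => f x k) ∈ regularFunctions U :=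
  ⟨fun h k x hx => h x hx k, fun h x hx k => h k x hx⟩

theorem const_mem_regularFunctions (U : Set (ι → ℂ)) (c : ℂ) :
    (fun _ => c) ∈ regularFunctions U :=
  (regularFunctions U).algebraMap_mem c

theorem coord_mem_regularFunctions (U : Set (ι → ℂ)) (k : ι) :
    (fun x => x k) ∈ regularFunctions U :=
  fun _ _ => ⟨MvPolynomial.X k, 1, by simp, fun y _ _ => by simp⟩

theorem regularFunctions_mono {U V : Set (ι → ℂ)} (h : U ⊆ V) {f : (ι → ℂ) → ℂ}
    (hf : f ∈ regularFunctions V) : f ∈ regularFunctions U := fun x hx => by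
  obtain ⟨p, q, hq, hpq⟩ := hf x (h hx)
  exact ⟨p, q, hq, fun y hy => hpq y (h hy)⟩

theorem inv_mem_regularFunctions {U : Set (ι → ℂ)} {f : (ι → ℂ) → ℂ}
    (hf : f ∈ regularFunctions U) (h0 : ∀ x ∈ U, f x ≠ 0) :
    (fun x => (f x)⁻¹) ∈ regularFunctions U := fun x hx => by
  obtain ⟨p, q, hq, h⟩ := hf x hx
  have hp : MvPolynomial.eval x p ≠ 0 := fun hp => h0 x hx (by rw [h x hx hq, hp, zero_div])
  refine ⟨q * q, p * q, by simp [hp, hq], fun y hy hne => ?_⟩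
  simp only [map_mul, mul_ne_zero_iff] at hne ⊢
  rw [h y hy hne.2, inv_div, mul_div_mul_right _ _ hne.2]

theorem div_mem_regularFunctions {U : Set (ι → ℂ)} {f g : (ι → ℂ) → ℂ}
    (hf : f ∈ regularFunctions U) (hg : g ∈ regularFunctions U) (h0 : ∀ x ∈ U, g x ≠ 0) :
    (fun x => f x / g x) ∈ regularFunctions U := by
  have := (regularFunctions U).mul_mem hf (inv_mem_regularFunctions hg h0)
  simp only [div_eq_mul_inv]
  exact this

theorem regularFunctions_congr {U : Set (ι → ℂ)} {f g : (ι → ℂ) → ℂ}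
    (hf : f ∈ regularFunctions U) (h : ∀ x ∈ U, g x = f x) : g ∈ regularFunctions U :=
  fun x hx => by
    obtain ⟨p, q, hq, hpq⟩ := hf x hx
    exact ⟨p, q, hq, fun y hy hne => (h y hy).trans (hpq y hy hne)⟩

theorem continuousOn_of_mem_regularFunctions [Finite ι] {U : Set (ι → ℂ)} {f : (ι → ℂ) → ℂ}
    (hf : f ∈ regularFunctions U) : ContinuousOn f U := by
  intro x hx
  obtain ⟨p, q, hq, h⟩ := hf x hx
  have hc : ContinuousAt (fun y => MvPolynomial.eval y p / MvPolynomial.eval y q) x :=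
    (MvPolynomial.continuous_eval p).continuousAt.div
      (MvPolynomial.continuous_eval q).continuousAt hq
  refine hc.continuousWithinAt.congr_of_eventuallyEq ?_ (h x hx hq)
  have hne : ∀ᶠ y in nhdsWithin x U, MvPolynomial.eval y q ≠ 0 :=
    ((MvPolynomial.continuous_eval q).continuousAt.eventually_ne hq).filter_mono inf_le_left
  filter_upwards [hne, self_mem_nhdsWithin] with y hy hyU
  exact h y hyU hy

theorem IsRegularOn.continuousOn [Finite ι] {U : Set (ι → ℂ)} {f : (ι → ℂ) → (κ → ℂ)}
    (hf : IsRegularOn U f) : ContinuousOn f U :=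
  continuousOn_pi.2 fun k => continuousOn_of_mem_regularFunctions (isRegularOn_iff.1 hf k)

theorem IsRegularOn.mono {U V : Set (ι → ℂ)} {f : (ι → ℂ) → (κ → ℂ)} (hf : IsRegularOn V f)
    (h : U ⊆ V) : IsRegularOn U f :=
  isRegularOn_iff.2 fun k => regularFunctions_mono h (isRegularOn_iff.1 hf k)

theorem IsRegularOn.congr {U : Set (ι → ℂ)} {f g : (ι → ℂ) → (κ → ℂ)} (hf : IsRegularOn U f)
    (h : Set.EqOn g f U) : IsRegularOn U g :=
  isRegularOn_iff.2 fun k => regularFunctions_congr (isRegularOn_iff.1 hf k)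
    fun _ hx => congrFun (h hx) k

theorem isRegularOn_id (U : Set (ι → ℂ)) : IsRegularOn U id :=
  isRegularOn_iff.2 fun k => coord_mem_regularFunctions U k

/-! ### Open and dense sets -/

theorem isZariskiOpenIn_self (X : Set (ι → ℂ)) : IsZariskiOpenIn X X :=
  ⟨subset_rfl, fun _ _ => ⟨1, by simp, fun _ hy _ => hy⟩⟩

theorem isZariskiDenseIn_self (X : Set (ι → ℂ)) : IsZariskiDenseIn X X := fun _ h => h

theorem isZariskiOpenIn_ne_zero {X : Set (ι → ℂ)} {f : (ι → ℂ) → ℂ}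
    (hf : f ∈ regularFunctions X) : IsZariskiOpenIn X {x | x ∈ X ∧ f x ≠ 0} := by
  refine ⟨fun _ hx => hx.1, fun x hx => ?_⟩
  obtain ⟨p, q, hq, h⟩ := hf x hx.1
  refine ⟨p * q, ?_, fun y hy hne => ⟨hy, ?_⟩⟩
  · rw [map_mul]
    exact mul_ne_zero (fun hp => hx.2 (by rw [h x hx.1 hq, hp, zero_div])) hq
  · rw [map_mul, mul_ne_zero_iff] at hne
    rw [h y hy hne.2]
    exact div_ne_zero hne.1 hne.2

theorem IsZariskiOpenIn.inter {X U V : Set (ι → ℂ)} (hU : IsZariskiOpenIn X U)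
    (hV : IsZariskiOpenIn X V) : IsZariskiOpenIn X (U ∩ V) := by
  refine ⟨fun _ hx => hU.1 hx.1, fun x hx => ?_⟩
  obtain ⟨q, hq, h⟩ := hU.2 x hx.1
  obtain ⟨q', hq', h'⟩ := hV.2 x hx.2
  refine ⟨q * q', by simp [hq, hq'], fun y hy hne => ?_⟩
  rw [map_mul, mul_ne_zero_iff] at hne
  exact ⟨h y hy hne.1, h' y hy hne.2⟩

theorem IsZariskiOpenIn.restrict {X X' U : Set (ι → ℂ)} (hU : IsZariskiOpenIn X U)
    (h : X' ⊆ X) : IsZariskiOpenIn X' (U ∩ X') := by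
  refine ⟨fun _ hx => hx.2, fun x hx => ?_⟩
  obtain ⟨q, hq, hqU⟩ := hU.2 x hx.1
  exact ⟨q, hq, fun y hy hne => ⟨hqU y (h hy) hne, hy⟩⟩

theorem IsZariskiDenseIn.mono {X U V : Set (ι → ℂ)} (hU : IsZariskiDenseIn X U) (h : U ⊆ V) :
    IsZariskiDenseIn X V := fun q hq => hU q fun x hx => hq x (h hx)

/-- A polynomial vanishing on U ∩ D, multiplied by one that is nonzero on X only inside U, vanishes
on all of D. Irreducibility of X plays no role. -/
theorem IsZariskiDenseIn.inter_of_isOpen {X U D : Set (ι → ℂ)} (hD : IsZariskiDenseIn X D)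
    (hDX : D ⊆ X) (hU : IsZariskiOpenIn X U) (hUd : IsZariskiDenseIn X U) :
    IsZariskiDenseIn X (U ∩ D) := by
  intro p hp
  refine hUd p fun x hx => ?_
  obtain ⟨q, hq, h⟩ := hU.2 x hx
  have := hD (p * q) (fun y hy => ?_) x (hU.1 hx)
  · rw [map_mul] at this
    exact (mul_eq_zero.1 this).resolve_right hq
  · rw [map_mul]
    by_cases hne : MvPolynomial.eval y q = 0
    · rw [hne, mul_zero]
    · rw [hp y ⟨h y (hDX hy) hne, hy⟩, zero_mul]

theorem eq_zero_of_isZariskiDenseIn {X U D : Set (ι → ℂ)} (hD : IsZariskiDenseIn X D)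
    (hDX : D ⊆ X) (hU : IsZariskiOpenIn X U) {f : (ι → ℂ) → ℂ} (hf : f ∈ regularFunctions U)
    (h : ∀ x ∈ D, x ∈ U → f x = 0) : ∀ x ∈ U, f x = 0 := by
  intro x hx
  obtain ⟨p, q, hq, hpq⟩ := hf x hx
  obtain ⟨r, hr, hrU⟩ := hU.2 x hx
  have := hD (p * q * r) (fun y hy => ?_) x (hU.1 hx)
  · simp only [map_mul, mul_eq_zero, hq, hr, or_false] at this
    rw [hpq x hx hq, this, zero_div]
  · simp only [map_mul, mul_eq_zero]
    by_contra! hne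
    have hyU := hrU y (hDX hy) hne.2
    have := h y hy hyU
    rw [hpq y hyU hne.1.2] at this
    exact div_ne_zero hne.1.1 hne.1.2 this

theorem eqOn_of_isZariskiDenseIn {X U D : Set (ι → ℂ)} (hD : IsZariskiDenseIn X D)
    (hDX : D ⊆ X) (hU : IsZariskiOpenIn X U) {f g : (ι → ℂ) → (κ → ℂ)} (hf : IsRegularOn U f)
    (hg : IsRegularOn U g) (h : Set.EqOn f g (D ∩ U)) : Set.EqOn f g U := by
  intro x hx
  funext k
  have := eq_zero_of_isZariskiDenseIn hD hDX hU
    ((regularFunctions U).sub_mem (isRegularOn_iff.1 hf k) (isRegularOn_iff.1 hg k))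
    (fun y hy hyU => by simp [h ⟨hy, hyU⟩]) x hx
  exact sub_eq_zero.1 this

/-- All density statements below are proved in the classical topology, by means of curves; zero sets
of polynomials are closed there. -/
theorem isZariskiDenseIn_of_subset_closure [Finite ι] {X D : Set (ι → ℂ)} (h : X ⊆ closure D) :
    IsZariskiDenseIn X D := by
  intro q hq x hx
  have hcl : IsClosed {y | MvPolynomial.eval y q = 0} :=
    isClosed_eq (MvPolynomial.continuous_eval q) continuous_const
  exact closure_minimal (fun y hy => hq y hy) hcl (h hx)

theorem IsZariskiOpenIn.exists_isOpen [Finite ι] {X U : Set (ι → ℂ)} (hU : IsZariskiOpenIn X U)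
    {x : ι → ℂ} (hx : x ∈ U) : ∃ O : Set (ι → ℂ), IsOpen O ∧ x ∈ O ∧ O ∩ X ⊆ U := by
  obtain ⟨q, hq, h⟩ := hU.2 x hx
  exact ⟨{y | MvPolynomial.eval y q ≠ 0},
    isOpen_ne_fun (MvPolynomial.continuous_eval q) continuous_const, hq,
    fun y hy => h y hy.2 hy.1⟩

theorem subset_closure_inter [Finite ι] {X U V : Set (ι → ℂ)} (hU : IsZariskiOpenIn X U)
    (hUd : X ⊆ closure U) (hVX : V ⊆ X) (hVd : X ⊆ closure V) : X ⊆ closure (U ∩ V) := by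
  intro x hx
  rw [mem_closure_iff]
  intro O hO hxO
  obtain ⟨y, hyO, hyU⟩ := mem_closure_iff.1 (hUd hx) O hO hxO
  obtain ⟨O', hO', hyO', h⟩ := hU.exists_isOpen hyU
  obtain ⟨w, hw, hwV⟩ := mem_closure_iff.1 (hVd (hU.1 hyU)) _ (hO.inter hO') ⟨hyO, hyO'⟩
  exact ⟨w, hw.1, h ⟨hw.2, hVX hwV⟩, hwV⟩

/-! ### Maximal domains of definition -/

/-- The maximal domain is the union of the domains of all extensions of f. Any two extensions agree
on their common domain because they agree on the dense set U, so they glue. -/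
theorem exists_rationalMap_extending {X : Set (ι → ℂ)} {Y : Set (κ → ℂ)} {U : Set (ι → ℂ)}
    {f : (ι → ℂ) → (κ → ℂ)} (hU : IsZariskiOpenIn X U) (hd : IsZariskiDenseIn X U)
    (hf : IsRegularOn U f) (hm : Set.MapsTo f U Y) :
    ∃ R : RationalMap X Y, U ⊆ R.dom ∧ Set.EqOn R.toFun f U := by
  classical
  let P : Set (ι → ℂ) → ((ι → ℂ) → (κ → ℂ)) → Prop := fun V g =>
    IsZariskiOpenIn X V ∧ IsZariskiDenseIn X V ∧ IsRegularOn V g ∧ Set.MapsTo g V Y ∧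
      Set.EqOn g f (U ∩ V)
  let dom : Set (ι → ℂ) := {x | ∃ V g, P V g ∧ x ∈ V}
  let F : (ι → ℂ) → (κ → ℂ) := fun x =>
    if h : ∃ V g, P V g ∧ x ∈ V then h.choose_spec.choose x else f x
  have hPU : P U f := ⟨hU, hd, hf, hm, fun _ _ => rfl⟩
  have compat : ∀ V g W k, P V g → P W k → Set.EqOn g k (V ∩ W) := by
    intro V g W k hV hW
    refine eqOn_of_isZariskiDenseIn hd hU.1 (hV.1.inter hW.1)
      (hV.2.2.1.mono Set.inter_subset_left) (hW.2.2.1.mono Set.inter_subset_right) ?_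
    intro x hx
    rw [hV.2.2.2.2 ⟨hx.1, hx.2.1⟩, hW.2.2.2.2 ⟨hx.1, hx.2.2⟩]
  have hF : ∀ V g, P V g → Set.EqOn F g V := by
    intro V g hV x hx
    have h : ∃ V g, P V g ∧ x ∈ V := ⟨V, g, hV, hx⟩
    have hFx : F x = h.choose_spec.choose x := dif_pos h
    rw [hFx]
    exact compat _ _ _ _ h.choose_spec.choose_spec.1 hV ⟨h.choose_spec.choose_spec.2, hx⟩
  have hsub : ∀ V g, P V g → V ⊆ dom := fun V g hV x hx => ⟨V, g, hV, hx⟩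
  have hopen : IsZariskiOpenIn X dom := by
    refine ⟨?_, ?_⟩
    · rintro x ⟨V, g, hV, hx⟩
      exact hV.1.1 hx
    · rintro x ⟨V, g, hV, hx⟩
      obtain ⟨q, hq, h⟩ := hV.1.2 x hx
      exact ⟨q, hq, fun y hy hne => hsub V g hV (h y hy hne)⟩
  refine ⟨⟨dom, F, hopen, hd.mono (hsub U f hPU), ?_, ?_, ?_⟩, hsub U f hPU, hF U f hPU⟩
  · rintro x ⟨V, g, hV, hx⟩ k
    obtain ⟨p, q, hq, h⟩ := hV.2.2.1 x hx k
    obtain ⟨r, hr, hrV⟩ := hV.1.2 x hx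
    refine ⟨p * r, q * r, by simp [hq, hr], fun y hy hne => ?_⟩
    simp only [map_mul, mul_ne_zero_iff] at hne ⊢
    have hyV : y ∈ V := hrV y (hopen.1 hy) hne.2
    rw [hF V g hV hyV, h y hyV hne.1, mul_div_mul_right _ _ hne.2]
  · rintro x ⟨V, g, hV, hx⟩
    rw [hF V g hV hx]
    exact hV.2.2.2.1 hx
  · intro V g h1 h2 h3 h4 h5
    refine hsub V g ⟨h1, h2, h3, h4, fun x hx => ?_⟩
    rw [h5 ⟨hsub U f hPU hx.1, hx.2⟩, hF U f hPU hx.1]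

/-- The two maps agree on the intersection of their domains, so each is an admissible competitor in
the maximality of the other. -/
theorem RationalMap.eq_of_eqOn_dense {X : Set (ι → ℂ)} {Y : Set (κ → ℂ)} (R R' : RationalMap X Y)
    {D : Set (ι → ℂ)} (hD : IsZariskiDenseIn X D) (hDX : D ⊆ X)
    (h : Set.EqOn R'.toFun R.toFun D) :
    R'.dom = R.dom ∧ Set.EqOn R'.toFun R.toFun R.dom := by
  have key : Set.EqOn R'.toFun R.toFun (R'.dom ∩ R.dom) :=
    eqOn_of_isZariskiDenseIn hD hDX (R'.isOpen.inter R.isOpen)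
      (R'.isRegular.mono Set.inter_subset_left) (R.isRegular.mono Set.inter_subset_right)
      fun x hx => h hx.1
  have h1 : R'.dom ⊆ R.dom := R.maximal _ _ R'.isOpen R'.isDense R'.isRegular R'.mapsTo
    fun x hx => key ⟨hx.2, hx.1⟩
  have h2 : R.dom ⊆ R'.dom := R'.maximal _ _ R.isOpen R.isDense R.isRegular R.mapsTo
    fun x hx => (key ⟨hx.1, hx.2⟩).symm
  exact ⟨h1.antisymm h2, fun x hx => key ⟨h2 hx, hx⟩⟩

end Regular

end FoldedR

noncomputable section

namespace FoldedR

/-! ### Entries of the M-matrix -/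

section Entries

variable {N : ℕ} {L : ℂ} {l : Idx N → ℂ}

theorem co_ne_zero (hl : l ∈ crystalB N L) (i : ℕ) : co l i ≠ 0 := by
  unfold co
  split_ifs
  exacts [hl.1 _, one_ne_zero]

theorem cobar_ne_zero (hl : l ∈ crystalB N L) (i : ℕ) : cobar l i ≠ 0 := by
  unfold cobar
  split_ifs
  exacts [hl.1 _, one_ne_zero]

/-- `l₁ ⋯ l_k`. -/
def coProd (l : Idx N → ℂ) (k : ℕ) : ℂ := ∏ i ∈ Finset.range k, co l (i + 1)

/-- `l̄₁ ⋯ l̄_k`. -/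
def cobarProd (l : Idx N → ℂ) (k : ℕ) : ℂ := ∏ i ∈ Finset.range k, cobar l (i + 1)

theorem coProd_succ (l : Idx N → ℂ) (k : ℕ) : coProd l (k + 1) = coProd l k * co l (k + 1) :=
  Finset.prod_range_succ _ _

theorem cobarProd_succ (l : Idx N → ℂ) (k : ℕ) :
    cobarProd l (k + 1) = cobarProd l k * cobar l (k + 1) :=
  Finset.prod_range_succ _ _

@[simp] theorem coProd_zero (l : Idx N → ℂ) : coProd l 0 = 1 := Finset.prod_range_zero _

@[simp] theorem cobarProd_zero (l : Idx N → ℂ) : cobarProd l 0 = 1 := Finset.prod_range_zero _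

theorem coProd_ne_zero (hl : l ∈ crystalB N L) (k : ℕ) : coProd l k ≠ 0 :=
  Finset.prod_ne_zero_iff.2 fun _ _ => co_ne_zero hl _

theorem cobarProd_ne_zero (hl : l ∈ crystalB N L) (k : ℕ) : cobarProd l k ≠ 0 :=
  Finset.prod_ne_zero_iff.2 fun _ _ => cobar_ne_zero hl _

theorem prod_co_Icc (hl : l ∈ crystalB N L) {a b : ℕ} (h : a ≤ b) :
    ∏ k ∈ Finset.Icc (a + 1) b, co l k = coProd l b / coProd l a := by
  induction b, h using Nat.le_induction with
  | base => rw [Finset.Icc_eq_empty (by omega), Finset.prod_empty, div_self (coProd_ne_zero hl _)]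
  | succ b h ih =>
    rw [← Finset.insert_Icc_right_eq_Icc_add_one (by omega), Finset.prod_insert (by simp), ih,
      coProd_succ]
    ring

theorem prod_cobar_Icc (hl : l ∈ crystalB N L) {a b : ℕ} (h : a ≤ b) :
    ∏ k ∈ Finset.Icc (a + 1) b, cobar l k = cobarProd l b / cobarProd l a := by
  induction b, h using Nat.le_induction with
  | base =>
    rw [Finset.Icc_eq_empty (by omega), Finset.prod_empty, div_self (cobarProd_ne_zero hl _)]
  | succ b h ih =>
    rw [← Finset.insert_Icc_right_eq_Icc_add_one (by omega), Finset.prod_insert (by simp), ih,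
      cobarProd_succ]
    ring

theorem prod_eq_coProd_mul_cobarProd (l : Idx N → ℂ) :
    ∏ k, l k = coProd l N * cobarProd l (N - 1) := by
  rw [Fintype.prod_sum_type]
  unfold coProd cobarProd
  rw [Finset.prod_range, Finset.prod_range]
  congr 1
  · refine Finset.prod_congr rfl fun i _ => ?_
    rw [co, dif_pos ⟨by omega, by omega⟩]
    simp
  · refine Finset.prod_congr rfl fun i _ => ?_
    rw [cobar, dif_pos ⟨by omega, by omega⟩]
    simp

theorem coProd_mul_cobarProd (hl : l ∈ crystalB N L) : coProd l N * cobarProd l (N - 1) = L := by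
  rw [← prod_eq_coProd_mul_cobarProd, hl.2]

theorem level_ne_zero (hl : l ∈ crystalB N L) : L ≠ 0 := by
  rw [← coProd_mul_cobarProd hl]
  exact mul_ne_zero (coProd_ne_zero hl _) (cobarProd_ne_zero hl _)

/-- The last row of `A(l)`. -/
def rowVec (l : Idx N → ℂ) (j : ℕ) : ℂ := entryA l (2 * N) (j + 1)

/-- The first column of `A(l)`. -/
def colVec (l : Idx N → ℂ) (i : ℕ) : ℂ := entryA l (i + 1) 1

theorem coProd_pred (l : Idx N → ℂ) (hN : 4 ≤ N) : coProd l (N - 1) * co l N = coProd l N := by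
  obtain ⟨n, rfl⟩ : ∃ n, N = n + 1 := ⟨N - 1, by omega⟩
  exact (coProd_succ l n).symm

/-! ### Entries of A(l) with rows and columns numbered from 0; the index 2N - 1 - k mirrors k -/

theorem entryA_top (hl : l ∈ crystalB N L) {i j : ℕ} (hj : j < i) (hi : i + 2 ≤ N) :
    entryA l (i + 1) (j + 1) = coProd l i / coProd l j * (1 + co l (i + 1) / cobar l (i + 1)) := by
  unfold entryA
  rw [if_neg (by omega), if_pos (by omega), Nat.add_sub_cancel, prod_co_Icc hl (by omega)]

theorem entryA_pred (hl : l ∈ crystalB N L) {j : ℕ} (hj : j + 2 ≤ N) :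
    entryA l (N - 1 + 1) (j + 1) = coProd l N / coProd l j := by
  unfold entryA
  rw [if_neg (by omega), if_neg (by omega), if_neg (by omega), if_pos (by omega),
    prod_co_Icc hl (by omega)]

theorem entryA_mid (hl : l ∈ crystalB N L) {j : ℕ} (hj : j + 2 ≤ N) :
    entryA l (N + 1) (j + 1) = coProd l (N - 1) / coProd l j := by
  unfold entryA
  rw [if_neg (by omega), if_neg (by omega), if_neg (by omega), if_neg (by omega),
    if_pos (by omega), prod_co_Icc hl (by omega)]

theorem entryA_mid_pred (l : Idx N → ℂ) (hN : 4 ≤ N) : entryA l (N + 1) (N - 1 + 1) = 0 := by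
  unfold entryA
  rw [if_neg (by omega), if_neg (by omega), if_neg (by omega), if_neg (by omega),
    if_neg (by omega), if_neg (by omega), if_neg (by omega), if_neg (by omega)]

theorem entryA_bot (hl : l ∈ crystalB N L) {k j : ℕ} (hk : k + 2 ≤ N) (hj : j + 2 ≤ N) :
    entryA l (2 * N - 1 - k + 1) (j + 1)
      = coProd l N / coProd l j * (cobarProd l (N - 1) / cobarProd l k) := by
  unfold entryA
  rw [if_neg (by omega), if_neg (by omega), if_neg (by omega), if_neg (by omega),
    if_neg (by omega), if_neg (by omega), if_neg (by omega), if_pos (by omega),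
    prod_co_Icc hl (by omega), show 2 * N + 1 - (2 * N - 1 - k + 1) = k + 1 by omega,
    prod_cobar_Icc hl (by omega)]

theorem entryA_bot_pred (hl : l ∈ crystalB N L) {k : ℕ} (hk : k + 2 ≤ N) :
    entryA l (2 * N - 1 - k + 1) (N - 1 + 1)
      = cobarProd l (N - 1) / cobarProd l k * co l N := by
  unfold entryA
  rw [if_neg (by omega), if_neg (by omega), if_neg (by omega), if_neg (by omega),
    if_neg (by omega), if_pos (by omega),
    show 2 * N + 1 - (2 * N - 1 - k + 1) = k + 1 by omega, prod_cobar_Icc hl (by omega)]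

theorem entryA_bot_mid (hl : l ∈ crystalB N L) {k : ℕ} (hk : k + 2 ≤ N) :
    entryA l (2 * N - 1 - k + 1) (N + 1) = cobarProd l (N - 1) / cobarProd l k := by
  unfold entryA
  rw [if_neg (by omega), if_neg (by omega), if_neg (by omega), if_neg (by omega),
    if_neg (by omega), if_neg (by omega), if_pos (by omega),
    show 2 * N + 1 - (2 * N - 1 - k + 1) = k + 1 by omega, prod_cobar_Icc hl (by omega)]

theorem entryA_bot_right (hl : l ∈ crystalB N L) {k m : ℕ} (hk : k < m) (hm : m + 2 ≤ N) :
    entryA l (2 * N - 1 - k + 1) (2 * N - 1 - m + 1)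
      = cobarProd l m / cobarProd l k * (1 + cobar l (m + 1) / co l (m + 1)) := by
  unfold entryA
  rw [if_neg (by omega), if_neg (by omega), if_pos (by omega),
    show 2 * N + 1 - (2 * N - 1 - k + 1) = k + 1 by omega,
    show 2 * N - (2 * N - 1 - m + 1) = m by omega,
    show 2 * N + 1 - (2 * N - 1 - m + 1) = m + 1 by omega, prod_cobar_Icc hl (by omega)]

theorem entryA_diag_top (l : Idx N → ℂ) {i : ℕ} (hi : i + 2 ≤ N) :
    entryA l (i + 1) (i + 1) = co l (i + 1) / cobar l (i + 1) := by
  unfold entryA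
  rw [if_pos rfl, if_pos (by omega)]

theorem entryA_diag_pred (l : Idx N → ℂ) (hN : 4 ≤ N) :
    entryA l (N - 1 + 1) (N - 1 + 1) = co l N := by
  unfold entryA
  rw [if_pos rfl, if_neg (by omega), if_pos (by omega)]

theorem entryA_diag_mid (l : Idx N → ℂ) (hN : 4 ≤ N) :
    entryA l (N + 1) (N + 1) = 1 / co l N := by
  unfold entryA
  rw [if_pos rfl, if_neg (by omega), if_neg (by omega), if_pos rfl]

theorem entryA_diag_bot (l : Idx N → ℂ) {k : ℕ} (hk : k + 2 ≤ N) :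
    entryA l (2 * N - 1 - k + 1) (2 * N - 1 - k + 1) = cobar l (k + 1) / co l (k + 1) := by
  unfold entryA
  rw [if_pos rfl, if_neg (by omega), if_neg (by omega), if_neg (by omega),
    show 2 * N + 1 - (2 * N - 1 - k + 1) = k + 1 by omega]

/-! ### The last row v and the first column u of A(l) in closed form -/

theorem rowVec_eq (l : Idx N → ℂ) (hN : 4 ≤ N) (j : ℕ) :
    rowVec l j = entryA l (2 * N - 1 - 0 + 1) (j + 1) := by
  rw [rowVec, show 2 * N - 1 - 0 + 1 = 2 * N by omega]

theorem rowVec_pred (hl : l ∈ crystalB N L) (hN : 4 ≤ N) :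
    rowVec l (N - 1) = cobarProd l (N - 1) * co l N := by
  rw [rowVec_eq l hN, entryA_bot_pred hl (by omega), cobarProd_zero, div_one]

theorem rowVec_of_lt (hl : l ∈ crystalB N L) (hN : 4 ≤ N) {j : ℕ} (hj : j < N) :
    rowVec l j = L / coProd l j := by
  have hP := coProd_ne_zero hl j
  rcases eq_or_ne j (N - 1) with rfl | h
  · rw [rowVec_pred hl hN, ← coProd_mul_cobarProd hl, ← coProd_pred l hN]
    field_simp
  · rw [rowVec_eq l hN, entryA_bot hl (by omega) (by omega), cobarProd_zero,
      ← coProd_mul_cobarProd hl]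
    field_simp

theorem rowVec_mid (hl : l ∈ crystalB N L) (hN : 4 ≤ N) : rowVec l N = cobarProd l (N - 1) := by
  rw [rowVec_eq l hN, entryA_bot_mid hl (by omega), cobarProd_zero, div_one]

theorem rowVec_of_gt (hl : l ∈ crystalB N L) (hN : 4 ≤ N) {k : ℕ} (hk : 1 ≤ k) (hk' : k + 2 ≤ N) :
    rowVec l (2 * N - 1 - k) = cobarProd l k + cobarProd l (k + 1) / co l (k + 1) := by
  rw [rowVec_eq l hN, entryA_bot_right hl (by omega) (by omega), cobarProd_zero, cobarProd_succ]
  ring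

theorem rowVec_last (l : Idx N → ℂ) (hN : 4 ≤ N) : rowVec l (2 * N - 1) = cobar l 1 / co l 1 := by
  rw [rowVec_eq l hN]
  exact entryA_diag_bot l (k := 0) (by omega)

theorem colVec_zero (l : Idx N → ℂ) (hN : 4 ≤ N) : colVec l 0 = co l 1 / cobar l 1 :=
  entryA_diag_top l (i := 0) (by omega)

theorem colVec_of_lt (hl : l ∈ crystalB N L) {i : ℕ} (hi : 1 ≤ i) (hi' : i + 2 ≤ N) :
    colVec l i = coProd l i + coProd l (i + 1) / cobar l (i + 1) := by
  rw [colVec, entryA_top hl (j := 0) (by omega) (by omega), coProd_zero, coProd_succ]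
  ring

theorem colVec_pred (hl : l ∈ crystalB N L) (hN : 4 ≤ N) : colVec l (N - 1) = coProd l N := by
  rw [colVec, entryA_pred hl (j := 0) (by omega), coProd_zero, div_one]

theorem colVec_mid (hl : l ∈ crystalB N L) (hN : 4 ≤ N) : colVec l N = coProd l (N - 1) := by
  rw [colVec, entryA_mid hl (j := 0) (by omega), coProd_zero, div_one]

theorem colVec_of_gt (hl : l ∈ crystalB N L) {k : ℕ} (hk : k + 2 ≤ N) :
    colVec l (2 * N - 1 - k) = L / cobarProd l k := by
  rw [colVec, entryA_bot hl (j := 0) hk (by omega), coProd_zero, ← coProd_mul_cobarProd hl]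
  ring

theorem rowVec_zero (hl : l ∈ crystalB N L) (hN : 4 ≤ N) : rowVec l 0 = L := by
  rw [rowVec_of_lt hl hN (by omega), coProd_zero, div_one]

theorem colVec_last (hl : l ∈ crystalB N L) (hN : 4 ≤ N) : colVec l (2 * N - 1) = L := by
  have := colVec_of_gt hl (k := 0) (by omega)
  rwa [cobarProd_zero, div_one] at this

/-- The matrix subtracted from the triangular part of the rank one matrix in `evalM_apply`. -/
def corr (N : ℕ) (z : ℂ) (i j : ℕ) : ℂ :=
  if i = j then (if i = 0 ∨ i = N - 1 ∨ i = N ∨ i = 2 * N - 1 then 0 else 1)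
  else if i = N ∧ j = N - 1 then 1 else if i = 0 ∧ j = 2 * N - 1 then z else 0

theorem entryA_eq_zero {i j : ℕ} (hij : i < j) : entryA l (i + 1) (j + 1) = 0 := by
  unfold entryA
  split_ifs <;> first | omega | rfl

/-- Below the diagonal A(l) has the rank one form u_i v_j / L, except that the entry in row N and
column N - 1 is 0 where the rank one form gives 1; this is the off-diagonal correction. -/
theorem entryA_of_gt (hl : l ∈ crystalB N L) (hN : 4 ≤ N) {i j : ℕ} (hij : j < i)
    (hi : i < 2 * N) : entryA l (i + 1) (j + 1) = colVec l i * rowVec l j / L - corr N 0 i j := by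
  have hL := level_ne_zero hl
  have hPj := coProd_ne_zero hl j
  rcases lt_trichotomy i (N - 1) with h | h | h
  · have := cobar_ne_zero hl (i + 1)
    rw [entryA_top hl hij (by omega), colVec_of_lt hl (by omega) (by omega),
      rowVec_of_lt hl hN (by omega), corr, if_neg (by omega), if_neg (by omega),
      if_neg (by omega), coProd_succ]
    field_simp
    ring
  · subst h
    rw [entryA_pred hl (by omega), colVec_pred hl hN, rowVec_of_lt hl hN (by omega), corr,
      if_neg (by omega), if_neg (by omega), if_neg (by omega)]
    field_simp
    ring
  rcases eq_or_lt_of_le (show N ≤ i by omega) with h' | h'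
  · subst h'
    rw [colVec_mid hl hN, rowVec_of_lt hl hN (by omega), corr, if_neg (by omega)]
    by_cases hj : j = N - 1
    · subst hj
      rw [if_pos ⟨rfl, rfl⟩, entryA_mid_pred l hN]
      field_simp
      ring
    · rw [if_neg (by omega), if_neg (by omega), entryA_mid hl (by omega)]
      field_simp
      ring
  obtain ⟨k, hk, rfl⟩ : ∃ k, k + 2 ≤ N ∧ i = 2 * N - 1 - k := ⟨2 * N - 1 - i, by omega, by omega⟩
  have hQk := cobarProd_ne_zero hl k
  rw [colVec_of_gt hl hk, corr, if_neg (by omega), if_neg (by omega), if_neg (by omega), sub_zero]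
  rcases lt_trichotomy j (N - 1) with hj | hj | hj
  · rw [rowVec_of_lt hl hN (by omega), entryA_bot hl hk (by omega), div_mul_div_comm,
      coProd_mul_cobarProd hl]
    field_simp
  · subst hj
    rw [rowVec_pred hl hN, entryA_bot_pred hl hk]
    field_simp
  rcases eq_or_lt_of_le (show N ≤ j by omega) with h'' | h''
  · subst h''
    rw [rowVec_mid hl hN, entryA_bot_mid hl hk]
    field_simp
  obtain ⟨m, hm, hm', rfl⟩ : ∃ m, 1 ≤ m ∧ m + 2 ≤ N ∧ j = 2 * N - 1 - m :=
    ⟨2 * N - 1 - j, by omega, by omega, by omega⟩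
  have hc := co_ne_zero hl (m + 1)
  rw [rowVec_of_gt hl hN hm hm', entryA_bot_right hl (by omega) hm', cobarProd_succ]
  field_simp

/-- On the diagonal u_i v_i / L is A_ii at the four indices 0, N - 1, N, 2N - 1, and A_ii + 1 at all
others. -/
theorem entryA_self (hl : l ∈ crystalB N L) (hN : 4 ≤ N) {i : ℕ} (hi : i < 2 * N) :
    entryA l (i + 1) (i + 1) = colVec l i * rowVec l i / L - corr N 0 i i := by
  have hL := level_ne_zero hl
  rw [corr, if_pos rfl]
  rcases lt_trichotomy i (N - 1) with h | h | h
  · rcases Nat.eq_zero_or_pos i with rfl | h0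
    · rw [rowVec_zero hl hN, if_pos (by omega), ← colVec, mul_div_cancel_right₀ _ hL, sub_zero]
    have hP := coProd_ne_zero hl i
    have hb := cobar_ne_zero hl (i + 1)
    rw [colVec_of_lt hl (by omega) (by omega), rowVec_of_lt hl hN (by omega), if_neg (by omega),
      entryA_diag_top l (by omega), coProd_succ]
    field_simp
    ring
  · subst h
    have hP := coProd_ne_zero hl (N - 1)
    rw [colVec_pred hl hN, rowVec_of_lt hl hN (by omega), if_pos (by omega), ← coProd_pred l hN,
      entryA_diag_pred l hN]
    field_simp
    ring
  rcases eq_or_lt_of_le (show N ≤ i by omega) with h' | h'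
  · subst h'
    have hP := coProd_ne_zero hl (N - 1)
    have hQ := cobarProd_ne_zero hl (N - 1)
    rw [colVec_mid hl hN, rowVec_mid hl hN, if_pos (by omega), ← coProd_mul_cobarProd hl,
      ← coProd_pred l hN, entryA_diag_mid l hN]
    field_simp
    ring
  obtain ⟨k, hk, rfl⟩ : ∃ k, k + 2 ≤ N ∧ i = 2 * N - 1 - k := ⟨2 * N - 1 - i, by omega, by omega⟩
  rcases Nat.eq_zero_or_pos k with rfl | h0
  · rw [if_pos (by omega), Nat.sub_zero, colVec_last hl hN, mul_div_cancel_left₀ _ hL, rowVec,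
      show 2 * N - 1 + 1 = 2 * N by omega, sub_zero]
  have hQ := cobarProd_ne_zero hl k
  have hc := co_ne_zero hl (k + 1)
  rw [colVec_of_gt hl hk, rowVec_of_gt hl hN h0 hk, if_neg (by omega), cobarProd_succ,
    entryA_diag_bot l hk]
  field_simp
  ring

theorem colVec_zero_mul_rowVec_last (hl : l ∈ crystalB N L) (hN : 4 ≤ N) :
    colVec l 0 * rowVec l (2 * N - 1) = 1 := by
  rw [colVec_zero l hN, rowVec_last l hN]
  field_simp [co_ne_zero hl 1, cobar_ne_zero hl 1]

/-- Apart from the corner term, M = (1 - Lz) A + z u vᵀ. Above the diagonal this leaves z u_i v_j,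
and elsewhere the multiple z of u_i v_j completes (1 - Lz) u_i v_j / L to u_i v_j / L. The entry z
of `corr` in the corner absorbs the delta in B together with C. -/
theorem entryM_eq (hl : l ∈ crystalB N L) (hN : 4 ≤ N) {i j : ℕ} (hi : i < 2 * N)
    (hj : j < 2 * N) (z : ℂ) :
    entryA l (i + 1) (j + 1) + z * entryB L l (i + 1) (j + 1) + z ^ 2 * entryC N L (i + 1) (j + 1)
      = (if i < j then L * z else 1) * (colVec l i * rowVec l j / L) - (1 - L * z) * corr N z i j := by
  have hL := level_ne_zero hl
  have hB : entryB L l (i + 1) (j + 1) = colVec l i * rowVec l j - L * entryA l (i + 1) (j + 1)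
      - cornerDelta N (i + 1) (j + 1) := rfl
  rw [hB, entryC]
  rcases lt_trichotomy i j with h | rfl | h
  · rw [entryA_eq_zero h, if_pos h]
    by_cases h0 : i = 0 ∧ j = 2 * N - 1
    · obtain ⟨rfl, rfl⟩ := h0
      have hc : corr N z 0 (2 * N - 1) = z := by
        rw [corr, if_neg (by omega), if_neg (by omega), if_pos ⟨rfl, rfl⟩]
      rw [hc, cornerDelta, if_pos (by omega), colVec_zero_mul_rowVec_last hl hN]
      field_simp
      ring
    · have hc : corr N z i j = 0 := by
        rw [corr, if_neg (by omega), if_neg (by omega), if_neg h0]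
      rw [hc, cornerDelta, if_neg (by omega)]
      field_simp
      ring
  · rw [entryA_self hl hN hi, if_neg (lt_irrefl _), cornerDelta, if_neg (by omega)]
    have : corr N z i i = corr N 0 i i := by simp [corr]
    rw [this]
    field_simp
    ring
  · rw [entryA_of_gt hl hN h hi, if_neg (by omega), cornerDelta, if_neg (by omega)]
    have : corr N z i j = corr N 0 i j := by
      have h0 : ¬(i = 0 ∧ j = 2 * N - 1) := by omega
      simp only [corr, if_neg h0]
    rw [this]
    field_simp
    ring

end Entries

end FoldedR

namespace FoldedR

/-! ### Orthogonality of the M-matrix -/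

section Orthogonality

variable {N : ℕ} {L : ℂ} {l : Idx N → ℂ}

/-- The signs of the quadratic form preserved by the M-matrices. -/
def sgn (N i : ℕ) : ℂ := (-1) ^ min i (2 * N - 1 - i)

theorem sgn_rev {i : ℕ} (hi : i < 2 * N) : sgn N (2 * N - 1 - i) = sgn N i := by
  unfold sgn
  congr 1
  omega

theorem sgn_mul_self (N i : ℕ) : sgn N i * sgn N i = 1 := by
  unfold sgn
  rw [← mul_pow]
  simp

theorem sgn_of_lt {i : ℕ} (hi : i < N) : sgn N i = (-1) ^ i := by
  unfold sgn
  congr 1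
  omega

/-- Partial sums of the quadratic form. -/
def partialForm (N : ℕ) (w : ℕ → ℂ) (k : ℕ) : ℂ :=
  ∑ j ∈ Finset.range k, sgn N j * (w j * w (2 * N - 1 - j))

theorem partialForm_succ (w : ℕ → ℂ) (k : ℕ) :
    partialForm N w (k + 1) = partialForm N w k + sgn N k * (w k * w (2 * N - 1 - k)) :=
  Finset.sum_range_succ _ _

@[simp] theorem partialForm_zero (w : ℕ → ℂ) : partialForm N w 0 = 0 := Finset.sum_range_zero _

theorem partialForm_reflect (w : ℕ → ℂ) {k : ℕ} (hk : k ≤ 2 * N) :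
    partialForm N w (2 * N - k) = partialForm N w (2 * N) - partialForm N w k := by
  induction k with
  | zero => simp
  | succ k ih =>
    have h := ih (by omega)
    rw [show 2 * N - k = 2 * N - (k + 1) + 1 by omega, partialForm_succ,
      show 2 * N - (k + 1) = 2 * N - 1 - k by omega, sgn_rev (by omega),
      show 2 * N - 1 - (2 * N - 1 - k) = k by omega] at h
    rw [show 2 * N - (k + 1) = 2 * N - 1 - k by omega, partialForm_succ]
    linear_combination h

theorem partialForm_two_mul (w : ℕ → ℂ) : partialForm N w (2 * N) = 2 * partialForm N w N := by
  have := partialForm_reflect (N := N) w (k := N) (by omega)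
  rw [show 2 * N - N = N by omega] at this
  linear_combination -this

/-- With P_k = l₁⋯l_k and Q_k = l̄₁⋯l̄_k the pair product v_k v_{2N-1-k} is L Q_k / P_k + L Q_{k+1}
/ P_{k+1}, so the alternating sum telescopes. These sums recover the barred coordinates from v. -/
theorem partialForm_rowVec (hl : l ∈ crystalB N L) (hN : 4 ≤ N) {k : ℕ} (hk : 1 ≤ k)
    (hk' : k + 1 ≤ N) :
    partialForm N (rowVec l) k = (-1) ^ (k - 1) * (L * cobarProd l k / coProd l k) := by
  induction k, hk using Nat.le_induction with
  | base =>
    rw [partialForm_succ, partialForm_zero, sgn_of_lt (by omega), rowVec_zero hl hN, Nat.sub_zero,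
      rowVec_last l hN, cobarProd_succ, coProd_succ]
    simp
    ring
  | succ k hk ih =>
    have := coProd_ne_zero hl k
    have := co_ne_zero hl (k + 1)
    rw [partialForm_succ, ih (by omega), sgn_of_lt (by omega), rowVec_of_lt hl hN (by omega),
      rowVec_of_gt hl hN hk (by omega), cobarProd_succ, coProd_succ]
    obtain ⟨m, rfl⟩ : ∃ m, k = m + 1 := ⟨k - 1, by omega⟩
    simp only [Nat.add_sub_cancel, pow_succ]
    field_simp
    ring

/-- The middle pair contributes the single term L Q_{N-1} / P_{N-1}, which closes the telescope.
Half of the form vanishes, hence v is isotropic. -/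
theorem partialForm_rowVec_mid (hl : l ∈ crystalB N L) (hN : 4 ≤ N) :
    partialForm N (rowVec l) N = 0 := by
  obtain ⟨m, rfl⟩ : ∃ m, N = m + 2 := ⟨N - 2, by omega⟩
  have hP := coProd_ne_zero hl (m + 1)
  have hv := rowVec_mid hl hN
  rw [show partialForm (m + 2) (rowVec l) (m + 2) = _ from partialForm_succ _ (m + 1),
    partialForm_rowVec hl hN (by omega) (by omega), sgn_of_lt (by omega),
    rowVec_of_lt hl hN (by omega), show 2 * (m + 2) - 1 - (m + 1) = m + 2 by omega, hv,
    show m + 2 - 1 = m + 1 by omega, Nat.add_sub_cancel, pow_succ]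
  field_simp
  ring

theorem partialForm_rowVec_reflect (hl : l ∈ crystalB N L) (hN : 4 ≤ N) {k : ℕ}
    (hk : k ≤ 2 * N) :
    partialForm N (rowVec l) (2 * N - k) = -partialForm N (rowVec l) k := by
  rw [partialForm_reflect _ hk, partialForm_two_mul, partialForm_rowVec_mid hl hN]
  ring

/-- The only column in which row `i` of `corr N 0` may be nonzero. -/
def corrCol (N i : ℕ) : ℕ := if i = N then N - 1 else i

/-- The entry of `corr N 0` in row `i` and column `corrCol N i`. -/
def corrVal (N i : ℕ) : ℂ := if i = 0 ∨ i = N - 1 ∨ i = 2 * N - 1 then 0 else 1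

theorem corr_zero_eq (hN : 4 ≤ N) (i j : ℕ) :
    corr N 0 i j = if j = corrCol N i then corrVal N i else 0 := by
  unfold corr corrCol corrVal
  split_ifs <;> first | rfl | omega

/-- Pairing the correction of row i with v gives a partial sum of the form. This is what cancels the
cross terms when two rows of A(l) are paired. -/
theorem corrVal_mul_rowVec (hl : l ∈ crystalB N L) (hN : 4 ≤ N) {i : ℕ} (hi : 1 ≤ i)
    (hi' : i < 2 * N) :
    corrVal N i * (sgn N (corrCol N i) * rowVec l (2 * N - 1 - corrCol N i))
      = colVec l i / L * partialForm N (rowVec l) (i + 1) := by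
  have hL := level_ne_zero hl
  rcases lt_trichotomy i (N - 1) with h | h | h
  · have := coProd_ne_zero hl i
    have := co_ne_zero hl (i + 1)
    have := cobar_ne_zero hl (i + 1)
    rw [corrVal, corrCol, if_neg (by omega), if_neg (by omega), sgn_of_lt (by omega),
      rowVec_of_gt hl hN hi (by omega), colVec_of_lt hl hi (by omega),
      partialForm_rowVec hl hN (by omega) (by omega), coProd_succ, cobarProd_succ,
      Nat.add_sub_cancel]
    field_simp
    ring
  · rw [corrVal, if_pos (by omega), show i + 1 = N by omega, partialForm_rowVec_mid hl hN]
    ring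
  rcases eq_or_lt_of_le (show N ≤ i by omega) with h' | h'
  · subst h'
    rw [corrVal, corrCol, if_neg (by omega), if_pos rfl, show 2 * N - 1 - (N - 1) = N by omega,
      sgn_of_lt (by omega), rowVec_mid hl hN, colVec_mid hl hN,
      show N + 1 = 2 * N - (N - 1) by omega, partialForm_rowVec_reflect hl hN (by omega),
      partialForm_rowVec hl hN (by omega) (by omega)]
    obtain ⟨m, rfl⟩ : ∃ m, N = m + 2 := ⟨N - 2, by omega⟩
    have := coProd_ne_zero hl (m + 1)
    simp only [show m + 2 - 1 = m + 1 by omega, Nat.add_sub_cancel, pow_succ]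
    field_simp
  obtain ⟨k, hk, rfl⟩ : ∃ k, k + 2 ≤ N ∧ i = 2 * N - 1 - k := ⟨2 * N - 1 - i, by omega, by omega⟩
  rcases Nat.eq_zero_or_pos k with rfl | h0
  · rw [corrVal, if_pos (by omega), show 2 * N - 1 - 0 + 1 = 2 * N - 0 by omega,
      partialForm_rowVec_reflect hl hN (by omega), partialForm_zero]
    ring
  have := coProd_ne_zero hl k
  have := cobarProd_ne_zero hl k
  rw [corrVal, corrCol, if_neg (by omega), if_neg (by omega),
    show 2 * N - 1 - (2 * N - 1 - k) = k by omega, sgn_rev (by omega), sgn_of_lt (by omega),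
    rowVec_of_lt hl hN (by omega), colVec_of_gt hl hk,
    show 2 * N - 1 - k + 1 = 2 * N - k by omega, partialForm_rowVec_reflect hl hN (by omega),
    partialForm_rowVec hl hN (by omega) (by omega)]
  obtain ⟨m, rfl⟩ : ∃ m, k = m + 1 := ⟨k - 1, by omega⟩
  simp only [Nat.add_sub_cancel, pow_succ]
  field_simp

theorem entryA_eq (hl : l ∈ crystalB N L) (hN : 4 ≤ N) {i j : ℕ} (hi : i < 2 * N) :
    entryA l (i + 1) (j + 1) = (if j ≤ i then colVec l i / L * rowVec l j else 0) -
      (if j = corrCol N i then corrVal N i else 0) := by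
  rw [← corr_zero_eq hN]
  rcases lt_trichotomy j i with h | rfl | h
  · rw [entryA_of_gt hl hN h hi, if_pos h.le]
    ring
  · rw [entryA_self hl hN hi, if_pos le_rfl]
    ring
  · rw [entryA_eq_zero h, if_neg (by omega), corr, if_neg h.ne, if_neg (by omega)]
    simp

/-- The pairing of two rows of `A(l)`. -/
def rowPairing (l : Idx N → ℂ) (i k : ℕ) : ℂ :=
  ∑ j ∈ Finset.range (2 * N),
    sgn N j * (entryA l (i + 1) (j + 1) * entryA l (k + 1) (2 * N - 1 - j + 1))

theorem rowPairing_comm (l : Idx N → ℂ) (i k : ℕ) : rowPairing l i k = rowPairing l k i := by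
  unfold rowPairing
  rw [← Finset.sum_range_reflect]
  refine Finset.sum_congr rfl fun j hj => ?_
  rw [Finset.mem_range] at hj
  rw [sgn_rev hj, show 2 * N - 1 - (2 * N - 1 - j) = j by omega]
  ring

theorem rowPairing_zero (hl : l ∈ crystalB N L) (hN : 4 ≤ N) {k : ℕ} (hk : k < 2 * N) :
    rowPairing l 0 k = if k = 2 * N - 1 then 1 else 0 := by
  unfold rowPairing
  rw [Finset.sum_eq_single 0]
  · rw [sgn_of_lt (by omega), pow_zero, one_mul, Nat.sub_zero]
    split_ifs with h
    · subst h
      rw [← colVec_zero_mul_rowVec_last hl hN, rowVec, colVec,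
        show 2 * N - 1 + 1 = 2 * N by omega]
    · rw [entryA_eq_zero (i := k) (j := 2 * N - 1) (by omega), mul_zero]
  · intro j _ hj
    rw [entryA_eq_zero (by omega), zero_mul, mul_zero]
  · intro h
    exact absurd (Finset.mem_range.2 (by omega)) h

theorem sum_range_triangle (t : ℕ → ℂ) {i k : ℕ} (hi : i < 2 * N) (hk : k < 2 * N) :
    (∑ j ∈ Finset.range (2 * N), if j ≤ i ∧ 2 * N - 1 - j ≤ k then t j else 0)
      = if 2 * N - 1 ≤ i + k then
          ∑ j ∈ Finset.range (i + 1), t j - ∑ j ∈ Finset.range (2 * N - 1 - k), t j else 0 := by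
  split_ifs with h
  · rw [← Finset.sum_Ico_eq_sub _ (by omega), ← Finset.sum_filter]
    refine Finset.sum_congr ?_ fun _ _ => rfl
    ext j
    simp only [Finset.mem_filter, Finset.mem_range, Finset.mem_Ico]
    omega
  · refine Finset.sum_eq_zero fun j _ => if_neg (by omega)

/-- Row i is (u_i / L) v cut off after position i, minus a single correction entry. The four terms
are the product of the truncated vectors, the two cross terms and the product of the corrections. -/
theorem rowPairing_eq_of_pos (hl : l ∈ crystalB N L) (hN : 4 ≤ N) {i k : ℕ} (hi : i < 2 * N)
    (hk : k < 2 * N) :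
    rowPairing l i k =
      colVec l i / L * (colVec l k / L) * (if 2 * N - 1 ≤ i + k then
          partialForm N (rowVec l) (i + 1) - partialForm N (rowVec l) (2 * N - 1 - k) else 0)
      - (if 2 * N - 1 - corrCol N k ≤ i then colVec l i / L *
          (corrVal N k * (sgn N (corrCol N k) * rowVec l (2 * N - 1 - corrCol N k))) else 0)
      - (if 2 * N - 1 - corrCol N i ≤ k then colVec l k / L *
          (corrVal N i * (sgn N (corrCol N i) * rowVec l (2 * N - 1 - corrCol N i))) else 0)
      + (if 2 * N - 1 - corrCol N i = corrCol N k then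
          sgn N (corrCol N i) * (corrVal N i * corrVal N k) else 0) := by
  have hc : ∀ {i}, i < 2 * N → corrCol N i < 2 * N := fun h => by
    unfold corrCol
    split_ifs <;> omega
  have hexp : rowPairing l i k = ∑ j ∈ Finset.range (2 * N),
      (colVec l i / L * (colVec l k / L) * (if j ≤ i ∧ 2 * N - 1 - j ≤ k then
        sgn N j * (rowVec l j * rowVec l (2 * N - 1 - j)) else 0)
      - (if j = 2 * N - 1 - corrCol N k then (if j ≤ i then colVec l i / L * (corrVal N k *
          (sgn N j * rowVec l j)) else 0) else 0)
      - (if j = corrCol N i then (if 2 * N - 1 - j ≤ k then colVec l k / L * (corrVal N i *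
          (sgn N j * rowVec l (2 * N - 1 - j))) else 0) else 0)
      + (if j = corrCol N i then (if 2 * N - 1 - j = corrCol N k then
          sgn N j * (corrVal N i * corrVal N k) else 0) else 0)) := by
    refine Finset.sum_congr rfl fun j hj => ?_
    rw [Finset.mem_range] at hj
    have := hc hk
    have e : (j = 2 * N - 1 - corrCol N k) ↔ (2 * N - 1 - j = corrCol N k) := by omega
    rw [entryA_eq hl hN hi, entryA_eq hl hN hk]
    simp only [e, ite_and]
    split_ifs <;> ring
  rw [hexp, Finset.sum_add_distrib, Finset.sum_sub_distrib, Finset.sum_sub_distrib,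
    ← Finset.mul_sum, sum_range_triangle _ hi hk, Finset.sum_ite_eq', Finset.sum_ite_eq',
    Finset.sum_ite_eq', if_pos (Finset.mem_range.2 (by have := hc hk; omega)),
    if_pos (Finset.mem_range.2 (hc hi)), if_pos (Finset.mem_range.2 (hc hi)), sgn_rev (hc hk)]
  rfl

/-- The correction of row N sits in column N - 1, whose mirror N lies to the right of the diagonal
in row N - 1. So the cross term is absent and the truncated product alone gives the sign. -/
theorem rowPairing_mid (hl : l ∈ crystalB N L) (hN : 4 ≤ N) :
    rowPairing l (N - 1) N = sgn N (N - 1) := by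
  have hL := level_ne_zero hl
  rw [rowPairing_eq_of_pos hl hN (by omega) (by omega), if_pos (by omega), if_neg]
  · have h0 : corrVal N (N - 1) = 0 := if_pos (by omega)
    have hs := partialForm_succ (N := N) (rowVec l) (N - 1)
    rw [show 2 * N - 1 - (N - 1) = N by omega] at hs
    rw [show 2 * N - 1 - N = N - 1 by omega, hs, h0]
    simp only [zero_mul, mul_zero, ite_self]
    rw [colVec_pred hl hN, colVec_mid hl hN, rowVec_of_lt hl hN (by omega), rowVec_mid hl hN]
    have := coProd_ne_zero hl (N - 1)
    have e := coProd_mul_cobarProd hl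
    field_simp
    linear_combination L * sgn N (N - 1) * e
  · unfold corrCol
    split_ifs <;> omega

theorem rowPairing_eq (hl : l ∈ crystalB N L) (hN : 4 ≤ N) {i k : ℕ} (hi : i < 2 * N)
    (hk : k < 2 * N) : rowPairing l i k = if k = 2 * N - 1 - i then sgn N i else 0 := by
  rcases Nat.eq_zero_or_pos i with rfl | hi0
  · rw [rowPairing_zero hl hN hk, sgn_of_lt (by omega), pow_zero, Nat.sub_zero]
  rcases Nat.eq_zero_or_pos k with rfl | hk0
  · rw [rowPairing_comm, rowPairing_zero hl hN hi]
    by_cases h : i = 2 * N - 1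
    · rw [if_pos h, if_pos (by omega), h, show 2 * N - 1 = 2 * N - 1 - 0 by omega,
        sgn_rev (by omega), sgn_of_lt (by omega), pow_zero]
    · rw [if_neg h, if_neg (by omega)]
  by_cases h1 : i = N - 1 ∧ k = N
  · obtain ⟨rfl, rfl⟩ := h1
    rw [rowPairing_mid hl hN, if_pos (by omega)]
  by_cases h2 : i = N ∧ k = N - 1
  · obtain ⟨rfl, rfl⟩ := h2
    rw [rowPairing_comm, rowPairing_mid hl hN, if_pos (by omega), ← sgn_rev (by omega)]
    congr 1
    omega
  -- Away from the exceptional pairs the three truncation conditions coincide. The antisymmetry of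
  -- the partial sums under k ↦ 2N - k then turns the first term into the sum of the two cross
  -- terms, leaving the product of the corrections.
  have e1 : (2 * N - 1 - corrCol N k ≤ i) ↔ (2 * N - 1 ≤ i + k) := by
    unfold corrCol
    split_ifs <;> omega
  have e2 : (2 * N - 1 - corrCol N i ≤ k) ↔ (2 * N - 1 ≤ i + k) := by
    unfold corrCol
    split_ifs <;> omega
  have e3 : (if 2 * N - 1 - corrCol N i = corrCol N k then
      sgn N (corrCol N i) * (corrVal N i * corrVal N k) else 0)
      = if k = 2 * N - 1 - i then sgn N i else 0 := by
    by_cases h : k = 2 * N - 1 - i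
    · subst h
      unfold corrCol corrVal
      by_cases hx : i = 2 * N - 1
      · omega
      rw [if_neg (show i ≠ N by omega), if_neg (show 2 * N - 1 - i ≠ N by omega), if_pos rfl,
        if_neg (by omega), if_neg (by omega), if_pos rfl]
      ring
    · rw [if_neg h, if_neg]
      unfold corrCol
      split_ifs <;> omega
  rw [rowPairing_eq_of_pos hl hN hi hk, e3, corrVal_mul_rowVec hl hN hi0 hi,
    corrVal_mul_rowVec hl hN hk0 hk]
  simp only [e1, e2]
  rw [show 2 * N - 1 - k = 2 * N - (k + 1) by omega, partialForm_rowVec_reflect hl hN (by omega)]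
  by_cases h : 2 * N - 1 ≤ i + k
  · simp only [if_pos h]
    ring
  · simp only [if_neg h]
    ring

end Orthogonality

end FoldedR

namespace FoldedR

/-! ### The anti-automorphism -/

section Dagger

variable {N : ℕ} {L : ℂ} {l : Idx N → ℂ}

theorem co_mkPoint {i : ℕ} (f g : ℕ → ℂ) (h : 1 ≤ i ∧ i ≤ N) : co (mkPoint N f g) i = f i := by
  rw [co, dif_pos h, mkPoint, Sum.elim_inl]
  exact congrArg f (by simp only; omega)

theorem cobar_mkPoint {i : ℕ} (f g : ℕ → ℂ) (h : 1 ≤ i ∧ i ≤ N - 1) :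
    cobar (mkPoint N f g) i = g i := by
  rw [cobar, dif_pos h, mkPoint, Sum.elim_inr]
  exact congrArg g (by simp only; omega)

theorem ext_co {l m : Idx N → ℂ} (h : ∀ i, 1 ≤ i → i ≤ N → co l i = co m i)
    (h' : ∀ i, 1 ≤ i → i ≤ N - 1 → cobar l i = cobar m i) : l = m := by
  funext k
  rcases k with k | k
  · have := h (k + 1) (by omega) (by omega)
    rw [co, co, dif_pos (by omega), dif_pos (by omega)] at this
    exact this
  · have := h' (k + 1) (by omega) (by omega)
    rw [cobar, cobar, dif_pos (by omega), dif_pos (by omega)] at this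
    exact this

theorem mem_crystalB_iff : l ∈ crystalB N L ↔ (∀ i, 1 ≤ i → i ≤ N → co l i ≠ 0) ∧
    (∀ i, 1 ≤ i → i ≤ N - 1 → cobar l i ≠ 0) ∧ coProd l N * cobarProd l (N - 1) = L := by
  refine ⟨fun hl => ⟨fun i _ _ => co_ne_zero hl i, fun i _ _ => cobar_ne_zero hl i,
    coProd_mul_cobarProd hl⟩, fun h => ⟨?_, ?_⟩⟩
  · rintro (k | k)
    · have := h.1 (k + 1) (by omega) (by omega)
      rwa [co, dif_pos (by omega)] at this
    · have := h.2.1 (k + 1) (by omega) (by omega)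
      rwa [cobar, dif_pos (by omega)] at this
  · rw [prod_eq_coProd_mul_cobarProd, h.2.2]

/-- The involution of the crystal which transposes the M-matrix along the antidiagonal. -/
def dag (l : Idx N → ℂ) : Idx N → ℂ :=
  mkPoint N
    (fun i => if i = N - 1 then cobar l (N - 1) * co l N
      else if i = N then 1 / co l N else cobar l i)
    (fun i => if i = N - 1 then co l (N - 1) * co l N else co l i)

theorem co_dag_of_lt (l : Idx N → ℂ) {i : ℕ} (h : 1 ≤ i) (h' : i + 2 ≤ N) :
    co (dag l) i = cobar l i := by
  rw [dag, co_mkPoint _ _ (by omega), if_neg (by omega), if_neg (by omega)]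

theorem co_dag_pred (l : Idx N → ℂ) (hN : 4 ≤ N) :
    co (dag l) (N - 1) = cobar l (N - 1) * co l N := by
  rw [dag, co_mkPoint _ _ (by omega), if_pos rfl]

theorem co_dag_self (l : Idx N → ℂ) (hN : 4 ≤ N) : co (dag l) N = 1 / co l N := by
  rw [dag, co_mkPoint _ _ (by omega), if_neg (by omega), if_pos rfl]

theorem cobar_dag_of_lt (l : Idx N → ℂ) {i : ℕ} (h : 1 ≤ i) (h' : i + 2 ≤ N) :
    cobar (dag l) i = co l i := by
  rw [dag, cobar_mkPoint _ _ (by omega), if_neg (by omega)]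

theorem cobar_dag_pred (l : Idx N → ℂ) (hN : 4 ≤ N) :
    cobar (dag l) (N - 1) = co l (N - 1) * co l N := by
  rw [dag, cobar_mkPoint _ _ (by omega), if_pos rfl]

theorem coProd_dag_of_lt (l : Idx N → ℂ) {k : ℕ} (h : k + 2 ≤ N) :
    coProd (dag l) k = cobarProd l k :=
  Finset.prod_congr rfl fun i hi => by
    rw [Finset.mem_range] at hi
    exact co_dag_of_lt l (by omega) (by omega)

theorem cobarProd_dag_of_lt (l : Idx N → ℂ) {k : ℕ} (h : k + 2 ≤ N) :
    cobarProd (dag l) k = coProd l k :=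
  Finset.prod_congr rfl fun i hi => by
    rw [Finset.mem_range] at hi
    exact cobar_dag_of_lt l (by omega) (by omega)

theorem coProd_dag_pred (l : Idx N → ℂ) (hN : 4 ≤ N) :
    coProd (dag l) (N - 1) = cobarProd l (N - 1) * co l N := by
  obtain ⟨n, rfl⟩ : ∃ n, N = n + 2 := ⟨N - 2, by omega⟩
  have h := co_dag_pred l hN
  rw [show n + 2 - 1 = n + 1 by omega] at h ⊢
  rw [coProd_succ, coProd_dag_of_lt l (by omega), cobarProd_succ, h]
  ring

theorem cobarProd_dag_pred (l : Idx N → ℂ) (hN : 4 ≤ N) :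
    cobarProd (dag l) (N - 1) = coProd l N := by
  obtain ⟨n, rfl⟩ : ∃ n, N = n + 2 := ⟨N - 2, by omega⟩
  have h := cobar_dag_pred l hN
  have h' := coProd_pred l hN
  rw [show n + 2 - 1 = n + 1 by omega] at h h' ⊢
  rw [cobarProd_succ, cobarProd_dag_of_lt l (by omega), ← h', coProd_succ, h]
  ring

theorem coProd_dag_self (hl : l ∈ crystalB N L) (hN : 4 ≤ N) :
    coProd (dag l) N = cobarProd l (N - 1) := by
  rw [← coProd_pred _ hN, coProd_dag_pred l hN, co_dag_self l hN]
  field_simp [co_ne_zero hl N]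

theorem dag_mem (hl : l ∈ crystalB N L) (hN : 4 ≤ N) : dag l ∈ crystalB N L := by
  refine mem_crystalB_iff.2 ⟨fun i h1 h2 => ?_, fun i h1 h2 => ?_, ?_⟩
  · rw [dag, co_mkPoint _ _ ⟨h1, h2⟩]
    split_ifs
    exacts [mul_ne_zero (cobar_ne_zero hl _) (co_ne_zero hl _),
      one_div_ne_zero (co_ne_zero hl _), cobar_ne_zero hl _]
  · rw [dag, cobar_mkPoint _ _ ⟨h1, h2⟩]
    split_ifs
    exacts [mul_ne_zero (co_ne_zero hl _) (co_ne_zero hl _), co_ne_zero hl _]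
  · rw [coProd_dag_self hl hN, cobarProd_dag_pred l hN, mul_comm, coProd_mul_cobarProd hl]

theorem dag_dag (hl : l ∈ crystalB N L) (hN : 4 ≤ N) : dag (dag l) = l := by
  have := co_ne_zero hl N
  refine ext_co (fun i h1 h2 => ?_) fun i h1 h2 => ?_
  · rcases lt_trichotomy i (N - 1) with h | rfl | h
    · rw [co_dag_of_lt _ h1 (by omega), cobar_dag_of_lt _ h1 (by omega)]
    · rw [co_dag_pred _ hN, cobar_dag_pred _ hN, co_dag_self _ hN]
      field_simp
    · obtain rfl : i = N := by omega
      rw [co_dag_self _ hN, co_dag_self _ hN, one_div_one_div]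
  · rcases eq_or_ne i (N - 1) with rfl | h
    · rw [cobar_dag_pred _ hN, co_dag_pred _ hN, co_dag_self _ hN]
      field_simp
    · rw [cobar_dag_of_lt _ h1 (by omega), co_dag_of_lt _ h1 (by omega)]

/-- The involution exchanges v with the reversal of u, so facts about row vectors of right factors
become facts about column vectors of left factors. -/
theorem rowVec_dag (hl : l ∈ crystalB N L) (hN : 4 ≤ N) {j : ℕ} (hj : j < 2 * N) :
    rowVec (dag l) j = colVec l (2 * N - 1 - j) := by
  have hd := dag_mem hl hN
  rcases lt_trichotomy j (N - 1) with h | rfl | h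
  · rw [rowVec_of_lt hd hN (by omega), coProd_dag_of_lt l (by omega), colVec_of_gt hl (by omega)]
  · have := cobarProd_ne_zero hl (N - 1)
    have := co_ne_zero hl N
    rw [rowVec_of_lt hd hN (by omega), coProd_dag_pred l hN, ← coProd_mul_cobarProd hl,
      show 2 * N - 1 - (N - 1) = N by omega, colVec_mid hl hN, ← coProd_pred l hN]
    field_simp
  rcases eq_or_lt_of_le (show N ≤ j by omega) with h' | h'
  · subst h'
    rw [rowVec_mid hd hN, cobarProd_dag_pred l hN, show 2 * N - 1 - N = N - 1 by omega,
      colVec_pred hl hN]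
  obtain ⟨k, hk, rfl⟩ : ∃ k, k + 2 ≤ N ∧ j = 2 * N - 1 - k := ⟨2 * N - 1 - j, by omega, by omega⟩
  rw [show 2 * N - 1 - (2 * N - 1 - k) = k by omega]
  rcases Nat.eq_zero_or_pos k with rfl | h0
  · rw [Nat.sub_zero, rowVec_last _ hN, colVec_zero l hN, co_dag_of_lt l le_rfl (by omega),
      cobar_dag_of_lt l le_rfl (by omega)]
  rw [rowVec_of_gt hd hN h0 hk, colVec_of_lt hl h0 hk, cobarProd_dag_of_lt l hk]
  congr 1
  rcases eq_or_ne (k + 1) (N - 1) with h1 | h1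
  · have := cobar_ne_zero hl (N - 1)
    have := co_ne_zero hl N
    rw [h1, cobarProd_dag_pred l hN, co_dag_pred l hN, ← coProd_pred l hN]
    field_simp
  · rw [cobarProd_dag_of_lt l (by omega), co_dag_of_lt l (by omega) (by omega)]

theorem colVec_dag (hl : l ∈ crystalB N L) (hN : 4 ≤ N) {i : ℕ} (hi : i < 2 * N) :
    colVec (dag l) i = rowVec l (2 * N - 1 - i) := by
  have := rowVec_dag (dag_mem hl hN) hN (j := 2 * N - 1 - i) (by omega)
  rw [dag_dag hl hN, show 2 * N - 1 - (2 * N - 1 - i) = i by omega] at this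
  exact this.symm

end Dagger

/-! ### Evaluations of the M-matrix -/

section Evaluation

variable {N : ℕ} {L : ℂ} {l : Idx N → ℂ}

open Matrix

/-- The value of the M-matrix at `z`. -/
def evalM (L : ℂ) (l : Idx N → ℂ) (z : ℂ) : Matrix (Fin (2 * N)) (Fin (2 * N)) ℂ :=
  Matrix.of fun r s => entryA l (r.val + 1) (s.val + 1) + z * entryB L l (r.val + 1) (s.val + 1)
    + z ^ 2 * entryC N L (r.val + 1) (s.val + 1)

/-- The last row of `A(l)` as a vector. -/
def rowV (l : Idx N → ℂ) : Fin (2 * N) → ℂ := fun j => rowVec l j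

/-- The first column of `A(l)` as a vector. -/
def colV (l : Idx N → ℂ) : Fin (2 * N) → ℂ := fun i => colVec l i

theorem map_eval_matM (L : ℂ) (l : Idx N → ℂ) (z : ℂ) :
    (matM L l).map (Polynomial.eval z) = evalM L l z := by
  ext r s
  simp only [matM, evalM, map_apply, of_apply, Polynomial.eval_add, Polynomial.eval_mul,
    Polynomial.eval_C, Polynomial.eval_X, Polynomial.eval_pow]

theorem evalM_apply (hl : l ∈ crystalB N L) (hN : 4 ≤ N) (z : ℂ) (i j : Fin (2 * N)) :
    evalM L l z i j = (if i.val < j.val then L * z else 1) * (colV l i * rowV l j / L)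
      - (1 - L * z) * corr N z i j :=
  entryM_eq hl hN i.2 j.2 z

theorem evalM_inv_level (hL : L ≠ 0) (l : Idx N → ℂ) :
    evalM L l L⁻¹ = L⁻¹ • vecMulVec (colV l) (rowV l) := by
  ext i j
  simp only [evalM, of_apply, Matrix.smul_apply, vecMulVec_apply, smul_eq_mul, entryB, entryC, colV, rowV,
    colVec, rowVec]
  field_simp
  ring

theorem corr_rev (z : ℂ) (hN : 4 ≤ N) (i j : Fin (2 * N)) :
    corr N z (Fin.rev j) (Fin.rev i) = corr N z i j := by
  rw [corr, corr, Fin.val_rev, Fin.val_rev]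
  split_ifs <;> first | rfl | omega

/-- M is determined by u, v and `corr`, and all three are compatible with reflection in the
antidiagonal. -/
theorem evalM_dag (hl : l ∈ crystalB N L) (hN : 4 ≤ N) (z : ℂ) (i j : Fin (2 * N)) :
    evalM L (dag l) z i j = evalM L l z j.rev i.rev := by
  rw [evalM_apply (dag_mem hl hN) hN, evalM_apply hl hN, corr_rev z hN]
  simp only [colV, rowV, Fin.val_rev, rowVec_dag hl hN j.2, colVec_dag hl hN i.2]
  have e1 : 2 * N - 1 - (j : ℕ) = 2 * N - (j + 1) := by omega
  have e2 : 2 * N - 1 - (i : ℕ) = 2 * N - (i + 1) := by omega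
  have e3 : 2 * N - ((j : ℕ) + 1) < 2 * N - (i + 1) ↔ (i : ℕ) < j := by omega
  simp only [e1, e2, e3]
  ring

theorem mEquation_iff {L K : ℂ} {p q : Idx N ⊕ Idx N → ℂ} : MEquation L K p q ↔
    ∀ z, evalM L (p ∘ Sum.inl) z * evalM K (p ∘ Sum.inr) z
      = evalM K (q ∘ Sum.inl) z * evalM L (q ∘ Sum.inr) z := by
  have key : ∀ (A B : Matrix (Fin (2 * N)) (Fin (2 * N)) (Polynomial ℂ)) (z : ℂ),
      (A * B).map (Polynomial.eval z) = A.map (Polynomial.eval z) * B.map (Polynomial.eval z) :=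
    fun A B z => Matrix.map_mul (f := Polynomial.evalRingHom z)
  simp only [← map_eval_matM, ← key]
  refine ⟨fun h z => congrArg (fun M => M.map (Polynomial.eval z)) h, fun h => ?_⟩
  ext1 i j
  refine Polynomial.funext fun z => ?_
  exact congrFun (congrFun (h z) i) j

/-! ### The quadratic form -/

/-- The symmetric bilinear form preserved by the M-matrices up to a factor. -/
def form (x y : Fin (2 * N) → ℂ) : ℂ :=
  ∑ i : Fin (2 * N), sgn N i * (x i * y i.rev)

theorem sgn_fin_rev (i : Fin (2 * N)) : sgn N i.rev = sgn N i := by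
  rw [Fin.val_rev, show 2 * N - ((i : ℕ) + 1) = 2 * N - 1 - i by omega, sgn_rev i.2]

theorem form_comm (x y : Fin (2 * N) → ℂ) : form x y = form y x := by
  unfold form
  rw [← Equiv.sum_comp Fin.revPerm]
  refine Finset.sum_congr rfl fun i _ => ?_
  rw [Fin.revPerm_apply, sgn_fin_rev, Fin.rev_rev]
  ring

theorem form_add_left (x x' y : Fin (2 * N) → ℂ) : form (x + x') y = form x y + form x' y := by
  simp only [form, ← Finset.sum_add_distrib, Pi.add_apply]
  exact Finset.sum_congr rfl fun i _ => by ring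

theorem form_smul_left (c : ℂ) (x y : Fin (2 * N) → ℂ) : form (c • x) y = c * form x y := by
  simp only [form, Finset.mul_sum, Pi.smul_apply, smul_eq_mul]
  exact Finset.sum_congr rfl fun i _ => by ring

theorem form_add_right (x y y' : Fin (2 * N) → ℂ) : form x (y + y') = form x y + form x y' := by
  rw [form_comm, form_add_left, form_comm y, form_comm y']

theorem form_smul_right (c : ℂ) (x y : Fin (2 * N) → ℂ) : form x (c • y) = c * form x y := by
  rw [form_comm, form_smul_left, form_comm]

theorem form_single_left (i : Fin (2 * N)) (y : Fin (2 * N) → ℂ) :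
    form (Pi.single i 1) y = sgn N i * y i.rev := by
  unfold form
  rw [Finset.sum_eq_single i]
  · simp
  · intro j _ hj
    rw [Pi.single_eq_of_ne hj]
    ring
  · simp

/-- The Gram matrix of `form`. -/
def signMat (N : ℕ) : Matrix (Fin (2 * N)) (Fin (2 * N)) ℂ :=
  Matrix.of fun i j => if j = i.rev then sgn N i else 0

theorem mul_signMat_apply (X : Matrix (Fin (2 * N)) (Fin (2 * N)) ℂ) (i j : Fin (2 * N)) :
    (X * signMat N) i j = X i j.rev * sgn N j := by
  rw [mul_apply, Finset.sum_eq_single j.rev]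
  · rw [signMat, of_apply, if_pos (Fin.rev_rev _).symm, sgn_fin_rev]
  · intro k _ hk
    rw [signMat, of_apply, if_neg, mul_zero]
    rintro rfl
    exact hk (Fin.rev_rev _).symm
  · simp

theorem signMat_mul_apply (X : Matrix (Fin (2 * N)) (Fin (2 * N)) ℂ) (i j : Fin (2 * N)) :
    (signMat N * X) i j = sgn N i * X i.rev j := by
  rw [mul_apply, Finset.sum_eq_single i.rev]
  · simp [signMat]
  · intro k _ hk
    rw [signMat, of_apply, if_neg hk, zero_mul]
  · simp

theorem signMat_mul_self : signMat N * signMat N = 1 := by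
  ext i j
  rw [signMat_mul_apply, signMat, of_apply, one_apply, Fin.rev_rev, sgn_fin_rev]
  split_ifs with h1 h2 h2
  · exact sgn_mul_self _ _
  · exact absurd h1.symm h2
  · exact absurd h2.symm h1
  · ring

theorem mul_signMat_mul_transpose_apply (X Y : Matrix (Fin (2 * N)) (Fin (2 * N)) ℂ)
    (i k : Fin (2 * N)) : (X * signMat N * Yᵀ) i k = form (X i) (Y k) := by
  rw [mul_apply, form, ← Equiv.sum_comp Fin.revPerm]
  refine Finset.sum_congr rfl fun j _ => ?_
  rw [mul_signMat_apply, transpose_apply, Fin.revPerm_apply, Fin.rev_rev, sgn_fin_rev]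
  ring

theorem form_entryA (hl : l ∈ crystalB N L) (hN : 4 ≤ N) (i k : Fin (2 * N)) :
    form (fun j : Fin (2 * N) => entryA l (i + 1) (j + 1))
      (fun j : Fin (2 * N) => entryA l (k + 1) (j + 1)) = signMat N i k := by
  have h := rowPairing_eq hl hN i.2 k.2
  rw [rowPairing, Finset.sum_range] at h
  rw [signMat, of_apply, form]
  refine Eq.trans ?_ (h.trans ?_)
  · refine Finset.sum_congr rfl fun j _ => ?_
    rw [Fin.val_rev, show 2 * N - ((j : ℕ) + 1) = 2 * N - 1 - j by omega]
  · have e : (k : ℕ) = 2 * N - 1 - i ↔ k = i.rev := by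
      rw [Fin.ext_iff, Fin.val_rev]
      omega
    simp only [e]

/-- The last index. -/
def lastIdx (hN : 4 ≤ N) : Fin (2 * N) := ⟨2 * N - 1, by omega⟩

/-- The first index. -/
def firstIdx (hN : 4 ≤ N) : Fin (2 * N) := ⟨0, by omega⟩

theorem rev_lastIdx (hN : 4 ≤ N) : (lastIdx hN).rev = firstIdx hN := by
  rw [Fin.ext_iff, Fin.val_rev]
  simp only [lastIdx, firstIdx]
  omega

theorem rowV_eq (l : Idx N → ℂ) (hN : 4 ≤ N) :
    rowV l = fun j : Fin (2 * N) => entryA l ((lastIdx hN : Fin (2 * N)) + 1) (j + 1) := by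
  funext j
  rw [rowV, rowVec, lastIdx, show 2 * N - 1 + 1 = 2 * N by omega]

theorem rowV_first (hl : l ∈ crystalB N L) (hN : 4 ≤ N) : rowV l (firstIdx hN) = L :=
  rowVec_zero hl hN

theorem form_rowV_self (hl : l ∈ crystalB N L) (hN : 4 ≤ N) : form (rowV l) (rowV l) = 0 := by
  rw [rowV_eq l hN, form_entryA hl hN, signMat, of_apply, if_neg]
  rw [rev_lastIdx, Fin.ext_iff]
  simp only [lastIdx, firstIdx]
  omega

/-- The rows of M = (1 - Lz) A - z (1 - Lz) E_{1,2N} + z u vᵀ, a form in which orthogonality reduces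
to that of A. -/
theorem evalM_row (hN : 4 ≤ N) (z : ℂ) (i : Fin (2 * N)) :
    evalM L l z i = (1 - L * z) • (fun j : Fin (2 * N) => entryA l (i + 1) (j + 1))
      + (if i = firstIdx hN then -(z * (1 - L * z)) else 0) •
        (Pi.single (lastIdx hN) 1 : Fin (2 * N) → ℂ) + (z * colV l i) • rowV l := by
  funext j
  have e : (i = firstIdx hN ∧ j = lastIdx hN) ↔ ((i : ℕ) + 1 = 1 ∧ (j : ℕ) + 1 = 2 * N) := by
    rw [Fin.ext_iff, Fin.ext_iff]
    simp only [lastIdx, firstIdx]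
    omega
  simp only [evalM, of_apply, Pi.add_apply, Pi.smul_apply, smul_eq_mul, entryB, entryC,
    cornerDelta, Pi.single_apply, ← e, colV, rowV, colVec, rowVec]
  by_cases h1 : i = firstIdx hN <;> by_cases h2 : j = lastIdx hN <;>
    simp only [h1, h2, and_true, and_false, if_true, if_false] <;> ring

/-- All pairings between the three summands of a row are known: A S Aᵀ = S, v is isotropic with
first entry L, and v is itself the last row of A. -/
theorem evalM_mul_signMat_mul_transpose (hl : l ∈ crystalB N L) (hN : 4 ≤ N) (z : ℂ) :
    evalM L l z * signMat N * (evalM L l z)ᵀ = (1 - L * z) ^ 2 • signMat N := by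
  have hAlast : ∀ i : Fin (2 * N), entryA l (i + 1) ((firstIdx hN : Fin (2 * N)) + 1) = colV l i :=
    fun i => rfl
  have hs : sgn N (lastIdx hN : Fin (2 * N)) = 1 := by
    rw [← sgn_fin_rev, rev_lastIdx]
    exact (sgn_of_lt (show 0 < N by omega)).trans (pow_zero _)
  have hsingle : ∀ y : Fin (2 * N) → ℂ,
      form (Pi.single (lastIdx hN) 1) y = y (firstIdx hN) := fun y => by
    rw [form_single_left, rev_lastIdx, hs, one_mul]
  have hlf : firstIdx hN ≠ lastIdx hN := by
    rw [Ne, Fin.ext_iff]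
    simp only [lastIdx, firstIdx]
    omega
  have hv : ∀ i : Fin (2 * N), form (fun j : Fin (2 * N) => entryA l (i + 1) (j + 1)) (rowV l)
      = if i = firstIdx hN then 1 else 0 := fun i => by
    rw [form_comm, rowV_eq l hN, form_entryA hl hN, signMat, of_apply, rev_lastIdx, hs]
  ext i k
  rw [mul_signMat_mul_transpose_apply, evalM_row hN, evalM_row hN, Matrix.smul_apply, smul_eq_mul]
  simp only [form_add_left, form_add_right, form_smul_left, form_smul_right, form_entryA hl hN, hv,
    hsingle, form_comm _ (Pi.single (lastIdx hN) 1 : Fin (2 * N) → ℂ),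
    form_comm (rowV l) (fun j : Fin (2 * N) => entryA l _ (j + 1)),
    form_rowV_self hl hN, rowV_first hl hN, Pi.add_apply,
    Pi.smul_apply, smul_eq_mul, Pi.single_eq_of_ne hlf, hAlast]
  split_ifs <;> ring

/-- The previous identity for `dag l`, reflected in the antidiagonal. -/
theorem evalM_transpose_mul_signMat_mul (hl : l ∈ crystalB N L) (hN : 4 ≤ N) (z : ℂ) :
    (evalM L l z)ᵀ * signMat N * evalM L l z = (1 - L * z) ^ 2 • signMat N := by
  have h := evalM_mul_signMat_mul_transpose (dag_mem hl hN) hN z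
  ext i k
  have h' := congrFun (congrFun h i.rev) k.rev
  rw [mul_signMat_mul_transpose_apply, Matrix.smul_apply, signMat, of_apply, sgn_fin_rev] at h'
  rw [Matrix.smul_apply, ← transpose_transpose (evalM L l z), transpose_transpose (evalM L l z)ᵀ,
    mul_signMat_mul_transpose_apply, signMat, of_apply]
  have e : k.rev = i.rev.rev ↔ k = i.rev := Fin.rev_inj
  simp only [e] at h'
  rw [← h', form, form, ← Equiv.sum_comp Fin.revPerm]
  refine Finset.sum_congr rfl fun j _ => ?_
  simp only [Fin.revPerm_apply, sgn_fin_rev, evalM_dag hl hN, Fin.rev_rev, transpose_apply]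

end Evaluation

end FoldedR

namespace FoldedR

open Matrix Filter Topology

/-! ### Cancellation of poles -/

section Poles

variable {N : ℕ}

/-- The polynomial extension of `form`. -/
def polyForm (x y : Fin (2 * N) → Polynomial ℂ) : Polynomial ℂ :=
  ∑ i : Fin (2 * N), Polynomial.C (sgn N i) * (x i * y i.rev)

theorem eval_polyForm (x y : Fin (2 * N) → Polynomial ℂ) (z : ℂ) :
    (polyForm x y).eval z = form (fun i => (x i).eval z) (fun i => (y i).eval z) := by
  simp only [polyForm, form, Polynomial.eval_finsetSum, Polynomial.eval_mul, Polynomial.eval_C]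

theorem eval_derivative_polyForm (x y : Fin (2 * N) → Polynomial ℂ) (z : ℂ) :
    (polyForm x y).derivative.eval z =
      form (fun i => (x i).derivative.eval z) (fun i => (y i).eval z) +
        form (fun i => (x i).eval z) (fun i => (y i).derivative.eval z) := by
  simp only [polyForm, form, Polynomial.derivative_sum, Polynomial.eval_finsetSum,
    Polynomial.derivative_mul, Polynomial.derivative_C, ← Finset.sum_add_distrib,
    Polynomial.eval_mul, Polynomial.eval_C, Polynomial.eval_add, Polynomial.eval_zero]
  exact Finset.sum_congr rfl fun i _ => by ring

theorem sq_dvd_of_eval_eq_zero {f : Polynomial ℂ} {a : ℂ} (h : f.eval a = 0)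
    (h' : f.derivative.eval a = 0) : (Polynomial.X - Polynomial.C a) ^ 2 ∣ f := by
  obtain ⟨g, rfl⟩ := Polynomial.dvd_iff_isRoot.2 h
  simp only [Polynomial.derivative_mul, Polynomial.derivative_sub, Polynomial.derivative_X,
    Polynomial.derivative_C, Polynomial.eval_add, Polynomial.eval_mul, Polynomial.eval_sub,
    Polynomial.eval_X, Polynomial.eval_C, sub_self, zero_mul, add_zero, sub_zero,
    one_mul] at h'
  rw [sq]
  exact mul_dvd_mul_left _ (Polynomial.dvd_iff_isRoot.2 h')

/-- The rows of `X` are isotropic up to second order at `a`, and `X` has rank one at `a`. -/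
theorem form_derivative_eq_zero {X : Matrix (Fin (2 * N)) (Fin (2 * N)) (Polynomial ℂ)} {a : ℂ}
    {g : Polynomial ℂ} {x v : Fin (2 * N) → ℂ} (hx : x ≠ 0)
    (hX : ∀ z, X.map (Polynomial.eval z) * signMat N * (X.map (Polynomial.eval z))ᵀ
      = ((z - a) ^ 2 * g.eval z) • signMat N)
    (hXa : X.map (Polynomial.eval a) = vecMulVec x v) :
    form v v = 0 ∧ ∀ i, form (fun j => (X i j).derivative.eval a) v = 0 := by
  have hrow : ∀ i, (fun j => (X i j).eval a) = x i • v := fun i => by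
    funext j
    exact congrFun (congrFun hXa i) j
  have hpoly : ∀ i k, polyForm (X i) (X k)
      = (Polynomial.X - Polynomial.C a) ^ 2 * g * Polynomial.C (signMat N i k) := fun i k => by
    refine Polynomial.funext fun z => ?_
    have := congrFun (congrFun (hX z) i) k
    rw [mul_signMat_mul_transpose_apply, Matrix.smul_apply, smul_eq_mul] at this
    rw [eval_polyForm]
    simp only [Polynomial.eval_mul, Polynomial.eval_pow, Polynomial.eval_sub, Polynomial.eval_X,
      Polynomial.eval_C]
    exact this
  obtain ⟨i₀, hi₀⟩ : ∃ i, x i ≠ 0 := by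
    by_contra! h
    exact hx (funext h)
  -- The pairing of rows i and k has a double zero at a; this is the vanishing of its derivative,
  -- with the rows at a written as multiples of v. Taking i = k = i₀ settles row i₀, and comparison
  -- with row i₀ settles the rest.
  have hd : ∀ i k, x k * form (fun j => (X i j).derivative.eval a) v
      + x i * form (fun j => (X k j).derivative.eval a) v = 0 := fun i k => by
    have := congrArg (fun f => (Polynomial.derivative f).eval a) (hpoly i k)
    simp only [eval_derivative_polyForm, hrow, form_smul_left, form_smul_right] at this
    rw [form_comm v] at this
    rw [this]
    simp [Polynomial.derivative_mul, Polynomial.derivative_pow]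
  refine ⟨?_, fun i => ?_⟩
  · have := congrArg (fun f => Polynomial.eval a f) (hpoly i₀ i₀)
    simp only [eval_polyForm, hrow, form_smul_left, form_smul_right] at this
    have h2 : x i₀ * (x i₀ * form v v) = 0 := by
      rw [this]
      simp
    simpa [hi₀] using h2
  · have h0 : form (fun j => (X i₀ j).derivative.eval a) v = 0 := by
      have h2 : (2 * x i₀) * form (fun j => (X i₀ j).derivative.eval a) v = 0 := by
        linear_combination hd i₀ i₀
      exact (mul_eq_zero.1 h2).resolve_left (mul_ne_zero two_ne_zero hi₀)
    have := hd i i₀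
    rw [h0, mul_zero, add_zero] at this
    exact (mul_eq_zero.1 this).resolve_left hi₀

/-- At a the rows of both matrices are multiples of the same isotropic v, and their derivatives are
orthogonal to v. So the pairing vanishes at a together with its derivative, which is the
cancellation of a double pole. -/
theorem sq_dvd_polyForm {X Y : Matrix (Fin (2 * N)) (Fin (2 * N)) (Polynomial ℂ)} {a : ℂ}
    {g g' : Polynomial ℂ} {x y v : Fin (2 * N) → ℂ} (hx : x ≠ 0) (hy : y ≠ 0)
    (hX : ∀ z, X.map (Polynomial.eval z) * signMat N * (X.map (Polynomial.eval z))ᵀ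
      = ((z - a) ^ 2 * g.eval z) • signMat N)
    (hY : ∀ z, Y.map (Polynomial.eval z) * signMat N * (Y.map (Polynomial.eval z))ᵀ
      = ((z - a) ^ 2 * g'.eval z) • signMat N)
    (hXa : X.map (Polynomial.eval a) = vecMulVec x v)
    (hYa : Y.map (Polynomial.eval a) = vecMulVec y v) (i k : Fin (2 * N)) :
    (Polynomial.X - Polynomial.C a) ^ 2 ∣ polyForm (X i) (Y k) := by
  obtain ⟨hv, hX'⟩ := form_derivative_eq_zero hx hX hXa
  obtain ⟨_, hY'⟩ := form_derivative_eq_zero hy hY hYa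
  have hXrow : (fun j => (X i j).eval a) = x i • v := by
    funext j
    exact congrFun (congrFun hXa i) j
  have hYrow : (fun j => (Y k j).eval a) = y k • v := by
    funext j
    exact congrFun (congrFun hYa k) j
  refine sq_dvd_of_eval_eq_zero ?_ ?_
  · rw [eval_polyForm, hXrow, hYrow, form_smul_left, form_smul_right, hv]
    ring
  · rw [eval_derivative_polyForm, hXrow, hYrow, form_smul_left, form_smul_right, hX' i,
      form_comm v, hY' k]
    ring

end Poles

/-! ### Asymptotics at infinity -/

section Infinity

variable {N : ℕ} {L : ℂ} {l : Idx N → ℂ}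

/-- The principal grading. -/
def wt (N i : ℕ) : ℕ := if i < N then i else i - 1

/-- Conjugation by the diagonal matrix with entries `r ^ wt N i`. -/
def scaled (r : ℂ) (X : Matrix (Fin (2 * N)) (Fin (2 * N)) ℂ) :
    Matrix (Fin (2 * N)) (Fin (2 * N)) ℂ :=
  Matrix.of fun i j => r ^ wt N j * X i j / r ^ wt N i

theorem scaled_mul {r : ℂ} (hr : r ≠ 0) (X Y : Matrix (Fin (2 * N)) (Fin (2 * N)) ℂ) :
    scaled r (X * Y) = scaled r X * scaled r Y := by
  ext i j
  simp only [scaled, of_apply, mul_apply, Finset.mul_sum, Finset.sum_div]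
  refine Finset.sum_congr rfl fun k _ => ?_
  have := pow_ne_zero (wt N k) hr
  have := pow_ne_zero (wt N i) hr
  field_simp

theorem scaled_smul (r c : ℂ) (X : Matrix (Fin (2 * N)) (Fin (2 * N)) ℂ) :
    scaled r (c • X) = c • scaled r X := by
  ext i j
  simp only [scaled, of_apply, Matrix.smul_apply, smul_eq_mul]
  ring

/-- The permutation matrix exchanging the two outer and the two middle indices. -/
def outerMid (N : ℕ) : Matrix (Fin (2 * N)) (Fin (2 * N)) ℂ :=
  Matrix.of fun i j =>
    if (i : ℕ) = 0 ∨ (i : ℕ) = N - 1 ∨ (i : ℕ) = N ∨ (i : ℕ) = 2 * N - 1 then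
      (if j = i.rev then 1 else 0)
    else if j = i then 1 else 0

theorem outerMid_mul_self (hN : 4 ≤ N) : outerMid N * outerMid N = 1 := by
  ext i j
  have hi := Fin.val_rev i
  by_cases h : (i : ℕ) = 0 ∨ (i : ℕ) = N - 1 ∨ (i : ℕ) = N ∨ (i : ℕ) = 2 * N - 1
  · rw [mul_apply, Finset.sum_eq_single i.rev]
    · rw [outerMid, of_apply, of_apply, if_pos h, if_pos rfl, if_pos (by omega), Fin.rev_rev,
        one_apply, one_mul]
      simp only [eq_comm]
    · intro k _ hk
      rw [outerMid, of_apply, if_pos h, if_neg hk, zero_mul]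
    · simp
  · rw [mul_apply, Finset.sum_eq_single i]
    · rw [outerMid, of_apply, of_apply, if_neg h, if_pos rfl, if_neg h, one_apply, one_mul]
      simp only [eq_comm]
    · intro k _ hk
      rw [outerMid, of_apply, if_neg h, if_neg hk, zero_mul]
    · simp

/-- The matrix `S Xᵀ S`, where `S` is the Gram matrix of the quadratic form. -/
def adj (X : Matrix (Fin (2 * N)) (Fin (2 * N)) ℂ) : Matrix (Fin (2 * N)) (Fin (2 * N)) ℂ :=
  signMat N * Xᵀ * signMat N

theorem adj_apply (X : Matrix (Fin (2 * N)) (Fin (2 * N)) ℂ) (i j : Fin (2 * N)) :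
    adj X i j = sgn N i * X j.rev i.rev * sgn N j := by
  rw [adj, mul_signMat_apply, signMat_mul_apply, transpose_apply]

theorem wt_rev (i : Fin (2 * N)) : wt N i.rev = 2 * N - 2 - wt N i := by
  unfold wt
  have := i.2
  have := Fin.val_rev i
  split_ifs <;> omega

theorem wt_le (hN : 4 ≤ N) (i : Fin (2 * N)) : wt N i ≤ 2 * N - 2 := by
  unfold wt
  have := i.2
  split_ifs <;> omega

theorem adj_scaled (hN : 4 ≤ N) {r : ℂ} (hr : r ≠ 0)
    (X : Matrix (Fin (2 * N)) (Fin (2 * N)) ℂ) : scaled r (adj X) = adj (scaled r X) := by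
  ext i j
  have h1 := wt_le hN i
  have h2 := wt_le hN j
  have h : r ^ wt N j / r ^ wt N i = r ^ wt N i.rev / r ^ wt N j.rev := by
    rw [wt_rev, wt_rev, div_eq_div_iff (pow_ne_zero _ hr) (pow_ne_zero _ hr), ← pow_add, ← pow_add]
    congr 1
    omega
  simp only [scaled, of_apply, adj_apply]
  linear_combination (sgn N i * X j.rev i.rev * sgn N j) * h

theorem adj_smul (c : ℂ) (X : Matrix (Fin (2 * N)) (Fin (2 * N)) ℂ) :
    adj (c • X) = c • adj X := by
  rw [adj, adj, transpose_smul, Matrix.mul_smul, Matrix.smul_mul]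

theorem adj_outerMid : adj (outerMid N) = outerMid N := by
  ext i j
  have hj := Fin.val_rev j
  have hi := Fin.val_rev i
  rw [adj_apply, outerMid, of_apply, of_apply]
  by_cases h : (i : ℕ) = 0 ∨ (i : ℕ) = N - 1 ∨ (i : ℕ) = N ∨ (i : ℕ) = 2 * N - 1
  · rw [if_pos h]
    by_cases e : j = i.rev
    · subst e
      rw [if_pos (by rw [Fin.rev_rev]; exact h), Fin.rev_rev, if_pos rfl, sgn_fin_rev, mul_one,
        sgn_mul_self]
    · rw [if_neg e]
      split_ifs with h1 h2 h2
      · rw [Fin.rev_rev] at h2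
        exact absurd h2.symm e
      · ring
      · rw [Fin.rev_inj] at h2
        subst h2
        omega
      · ring
  · rw [if_neg h]
    by_cases e : j = i
    · subst e
      rw [if_neg (by omega), if_pos rfl, if_pos rfl, mul_one, sgn_mul_self]
    · rw [if_neg e]
      split_ifs with h1 h2 h2
      · rw [Fin.rev_rev] at h2
        rw [← h2, Fin.rev_rev] at h1
        exact absurd h1 h
      · ring
      · rw [Fin.rev_inj] at h2
        exact absurd h2.symm e
      · ring

theorem colVec_pred_mul_rowVec_mid (hl : l ∈ crystalB N L) (hN : 4 ≤ N) :
    colVec l (N - 1) * rowVec l N = L := by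
  rw [colVec_pred hl hN, rowVec_mid hl hN, coProd_mul_cobarProd hl]

/-- The substitution is z = r^{-h} with h = 2N - 2, the Coxeter number. The indices N - 1 and N have
the same weight. Each rescaled entry is a polynomial in r; its constant term survives only at the
positions of `outerMid`, where u_i v_j or the correction has a fixed value. -/
theorem tendsto_scaled_apply (hl : l ∈ crystalB N L) (hN : 4 ≤ N) (i j : Fin (2 * N)) :
    Tendsto (fun r : ℂ => r ^ (2 * N - 2) * scaled r (evalM L l (r ^ (2 * N - 2))⁻¹) i j)
      (𝓝[≠] 0) (𝓝 (L * outerMid N i j)) := by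
  have hL := level_ne_zero hl
  have hrev := Fin.val_rev i
  have hwi := wt_le hN i
  have hwj := wt_le hN j
  -- It suffices to give, for every entry, a continuous function of r that agrees with it for r ≠ 0
  -- and has the right value at 0.
  have key : ∀ (G : ℂ → ℂ), Continuous G → G 0 = L * outerMid N i j →
      (∀ r, r ≠ 0 → r ^ (2 * N - 2) * scaled r (evalM L l (r ^ (2 * N - 2))⁻¹) i j = G r) →
      Tendsto (fun r : ℂ => r ^ (2 * N - 2) * scaled r (evalM L l (r ^ (2 * N - 2))⁻¹) i j)
        (𝓝[≠] 0) (𝓝 (L * outerMid N i j)) := by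
    intro G hG h0 h
    rw [← h0]
    refine ((hG.tendsto 0).mono_left nhdsWithin_le_nhds).congr' ?_
    filter_upwards [self_mem_nhdsWithin] with r hr
    exact (h r hr).symm
  have hz : (0 : ℂ) ^ (2 * N - 2) = 0 := zero_pow (by omega)
  simp only [scaled, of_apply, evalM_apply hl hN] at key ⊢
  set w := colV l i * rowV l j with hw
  rcases lt_trichotomy (i : ℕ) j with h | h | h
  · simp only [if_pos h] at key ⊢
    by_cases hc : (i : ℕ) = 0 ∧ (j : ℕ) = 2 * N - 1
    · have hw1 : w = 1 := by
        rw [hw, colV, rowV, hc.1, hc.2, colVec_zero_mul_rowVec_last hl hN]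
      have hcorr : ∀ z, corr N z i j = z := fun z => by
        rw [corr, if_neg (by omega), if_neg (by omega), if_pos hc]
      have hout : outerMid N i j = 1 := by
        rw [outerMid, of_apply, if_pos (by omega), if_pos (by omega)]
      have wi : wt N i = 0 := by rw [wt, if_pos (by omega), hc.1]
      have wj : wt N j = 2 * N - 2 := by rw [wt, if_neg (by omega), hc.2]; omega
      refine key (fun _ => L) continuous_const (by rw [hout, mul_one]) fun r hr => ?_
      have := pow_ne_zero (2 * N - 2) hr
      rw [hw1, hcorr, wi, wj]
      field_simp
      ring
    have hcorr : ∀ z, corr N z i j = 0 := fun z => by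
      rw [corr, if_neg (by omega), if_neg (by omega), if_neg hc]
    have hmono : wt N i ≤ wt N j := by
      unfold wt
      split_ifs <;> omega
    refine key (fun r => w * r ^ (wt N j - wt N i)) (by fun_prop) ?_ fun r hr => ?_
    · by_cases hm : (i : ℕ) = N - 1 ∧ (j : ℕ) = N
      · rw [outerMid, of_apply, if_pos (by omega), if_pos (by omega),
          show wt N j - wt N i = 0 by unfold wt; split_ifs <;> omega, hw, colV, rowV, hm.1, hm.2,
          colVec_pred_mul_rowVec_mid hl hN]
        simp
      · rw [zero_pow (by unfold wt; split_ifs <;> omega)]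
        have : outerMid N i j = 0 := by
          rw [outerMid, of_apply]
          split_ifs <;> first | rfl | omega
        rw [this]
        ring
    · have := pow_ne_zero (2 * N - 2) hr
      have := pow_ne_zero (wt N i) hr
      rw [hcorr, pow_sub₀ _ hr hmono]
      field_simp
      ring
  · obtain rfl : i = j := Fin.ext h
    simp only [if_neg (lt_irrefl _)] at key ⊢
    have hcorr : ∀ z, corr N z i i = outerMid N i i := fun z => by
      rw [corr, if_pos rfl, outerMid, of_apply]
      split_ifs <;> first | rfl | omega
    refine key (fun r => r ^ (2 * N - 2) * (w / L) - (r ^ (2 * N - 2) - L) * outerMid N i i)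
      (by fun_prop) (by simp only [hz]; ring) fun r hr => ?_
    have := pow_ne_zero (2 * N - 2) hr
    have := pow_ne_zero (wt N i) hr
    rw [hcorr]
    field_simp
  · have hnot : ¬ (i : ℕ) < j := by omega
    simp only [if_neg hnot] at key ⊢
    by_cases hm : (i : ℕ) = N ∧ (j : ℕ) = N - 1
    · have hcorr : ∀ z, corr N z i j = 1 := fun z => by
        rw [corr, if_neg (by omega), if_pos hm]
      have hout : outerMid N i j = 1 := by
        rw [outerMid, of_apply, if_pos (by omega), if_pos (by omega)]
      have wij : wt N i = wt N j := by
        unfold wt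
        split_ifs <;> omega
      refine key (fun r => r ^ (2 * N - 2) * (w / L) - (r ^ (2 * N - 2) - L)) (by fun_prop)
        (by simp only [hz, hout]; ring) fun r hr => ?_
      have := pow_ne_zero (2 * N - 2) hr
      have := pow_ne_zero (wt N j) hr
      rw [hcorr, wij]
      field_simp
    have hcorr : ∀ z, corr N z i j = 0 := fun z => by
      rw [corr, if_neg (by omega), if_neg hm, if_neg (by omega)]
    refine key (fun r => w / L * r ^ (2 * N - 2 + wt N j - wt N i)) (by fun_prop) ?_ fun r hr => ?_
    · by_cases hc : (i : ℕ) = 2 * N - 1 ∧ (j : ℕ) = 0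
      · rw [outerMid, of_apply, if_pos (by omega), if_pos (by omega),
          show 2 * N - 2 + wt N j - wt N i = 0 by unfold wt; split_ifs <;> omega, hw, colV, rowV,
          hc.1, hc.2, colVec_last hl hN, rowVec_zero hl hN]
        field_simp
      · rw [zero_pow (by unfold wt; split_ifs <;> omega)]
        have : outerMid N i j = 0 := by
          rw [outerMid, of_apply]
          split_ifs <;> first | rfl | omega
        rw [this]
        ring
    · have := pow_ne_zero (wt N i) hr
      have e : r ^ (2 * N - 2 + wt N j - wt N i)
          = r ^ (2 * N - 2) * r ^ wt N j / r ^ wt N i := by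
        rw [eq_div_iff this, ← pow_add, ← pow_add]
        congr 1
        omega
      rw [hcorr, e]
      ring

theorem tendsto_scaled (hl : l ∈ crystalB N L) (hN : 4 ≤ N) :
    Tendsto (fun r : ℂ => r ^ (2 * N - 2) • scaled r (evalM L l (r ^ (2 * N - 2))⁻¹))
      (𝓝[≠] 0) (𝓝 (L • outerMid N)) :=
  tendsto_pi_nhds.2 fun i => tendsto_pi_nhds.2 fun j => tendsto_scaled_apply hl hN i j

theorem continuous_adj : Continuous (adj (N := N)) := by
  unfold adj
  fun_prop

theorem tendsto_scaled_adj (hl : l ∈ crystalB N L) (hN : 4 ≤ N) :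
    Tendsto (fun r : ℂ => r ^ (2 * N - 2) • scaled r (adj (evalM L l (r ^ (2 * N - 2))⁻¹)))
      (𝓝[≠] 0) (𝓝 (L • outerMid N)) := by
  have h := (continuous_adj.tendsto _).comp (tendsto_scaled hl hN)
  rw [adj_smul, adj_outerMid] at h
  refine h.congr' ?_
  filter_upwards [self_mem_nhdsWithin] with r hr
  rw [Function.comp_apply, adj_smul, adj_scaled hN hr]

/-- The hypothesis says f(z) / z → 0 along z = r^{-h}. In positive degree this would force the
leading coefficient, which is the value of the reversed polynomial at 0, to vanish. -/
theorem eq_C_of_tendsto {f : Polynomial ℂ} {h : ℕ} (hh : h ≠ 0)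
    (hf : Tendsto (fun r : ℂ => r ^ h * f.eval (r ^ h)⁻¹) (𝓝[≠] 0) (𝓝 0)) :
    f = Polynomial.C (f.coeff 0) := by
  by_contra hne
  have hdeg : f.natDegree ≠ 0 := fun h0 => hne (Polynomial.eq_C_of_natDegree_eq_zero h0)
  obtain ⟨n, hn⟩ : ∃ n, f.natDegree = n + 1 := ⟨f.natDegree - 1, by omega⟩
  have hpow : Tendsto (fun r : ℂ => r ^ h) (𝓝[≠] 0) (𝓝 0) := by
    have : Continuous fun r : ℂ => r ^ h := by fun_prop
    simpa [hh] using (this.tendsto 0).mono_left nhdsWithin_le_nhds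
  have h1 : Tendsto (fun r : ℂ => f.reverse.eval (r ^ h)) (𝓝[≠] 0) (𝓝 f.leadingCoeff) := by
    have := (f.reverse.continuous.tendsto 0).comp hpow
    rwa [← Polynomial.coeff_zero_eq_eval_zero, Polynomial.coeff_zero_reverse] at this
  have h2 : Tendsto (fun r : ℂ => (r ^ h) ^ n * (r ^ h * f.eval (r ^ h)⁻¹)) (𝓝[≠] 0)
      (𝓝 (0 ^ n * 0)) := (hpow.pow n).mul hf
  have h3 : Tendsto (fun r : ℂ => f.reverse.eval (r ^ h)) (𝓝[≠] 0) (𝓝 (0 ^ n * 0)) := by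
    refine h2.congr' ?_
    filter_upwards [self_mem_nhdsWithin] with r hr
    have hr' : (r ^ h)⁻¹ ≠ 0 := inv_ne_zero (pow_ne_zero _ hr)
    let _ := invertibleOfNonzero hr'
    have e := Polynomial.eval₂_reverse_mul_pow (RingHom.id ℂ) (r ^ h)⁻¹ f
    rw [invOf_eq_inv, inv_inv, hn] at e
    simp only [Polynomial.eval₂_id] at e
    have : r ^ h ≠ 0 := pow_ne_zero _ hr
    rw [← e, inv_pow, pow_succ]
    field_simp
  have := tendsto_nhds_unique h1 h3
  rw [mul_zero, Polynomial.leadingCoeff_eq_zero] at this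
  rw [this] at hdeg
  simp at hdeg

end Infinity

end FoldedR

namespace FoldedR

open Matrix Filter Topology

/-! ### Existence of the refactorization -/

section Refactorization

variable {N : ℕ} {L K : ℂ}

theorem map_eval_mul (A B : Matrix (Fin (2 * N)) (Fin (2 * N)) (Polynomial ℂ)) (z : ℂ) :
    (A * B).map (Polynomial.eval z) = A.map (Polynomial.eval z) * B.map (Polynomial.eval z) :=
  Matrix.map_mul (f := Polynomial.evalRingHom z)

theorem map_eval_map_C (A : Matrix (Fin (2 * N)) (Fin (2 * N)) ℂ) (z : ℂ) :
    (A.map Polynomial.C).map (Polynomial.eval z) = A := by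
  ext i j
  simp

theorem poly_mul_signMat_mul_transpose_apply
    (X Y : Matrix (Fin (2 * N)) (Fin (2 * N)) (Polynomial ℂ)) (i k : Fin (2 * N)) :
    (X * (signMat N).map Polynomial.C * Yᵀ) i k = polyForm (X i) (Y k) := by
  refine Polynomial.funext fun z => ?_
  have : (X * (signMat N).map Polynomial.C * Yᵀ).map (Polynomial.eval z) i k
      = form (fun j => (X i j).eval z) (fun j => (Y k j).eval z) := by
    rw [map_eval_mul, map_eval_mul, map_eval_map_C, transpose_map,
      mul_signMat_mul_transpose_apply]
    rfl
  rw [eval_polyForm, ← this, map_apply]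

theorem exists_eq_smul_of_dvd {X : Matrix (Fin (2 * N)) (Fin (2 * N)) (Polynomial ℂ)}
    {q : Polynomial ℂ} (h : ∀ i j, q ∣ X i j) : ∃ Q, X = q • Q := by
  choose Q hQ using h
  exact ⟨Matrix.of Q, by ext1 i j; exact hQ i j⟩

theorem mul_adj_evalM {l : Idx N → ℂ} (hl : l ∈ crystalB N L) (hN : 4 ≤ N) (z : ℂ) :
    evalM L l z * adj (evalM L l z) = (1 - L * z) ^ 2 • 1 := by
  rw [adj, ← mul_assoc, ← mul_assoc, evalM_mul_signMat_mul_transpose hl hN, Matrix.smul_mul,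
    signMat_mul_self]

theorem adj_evalM_mul {l : Idx N → ℂ} (hl : l ∈ crystalB N L) (hN : 4 ≤ N) (z : ℂ) :
    adj (evalM L l z) * evalM L l z = (1 - L * z) ^ 2 • 1 := by
  rw [adj, mul_assoc, mul_assoc, ← mul_assoc (evalM L l z)ᵀ,
    evalM_transpose_mul_signMat_mul hl hN, Matrix.mul_smul, signMat_mul_self]

theorem adj_triangular {X : Matrix (Fin (2 * N)) (Fin (2 * N)) ℂ}
    (hX : X.BlockTriangular OrderDual.toDual) : (adj X).BlockTriangular OrderDual.toDual := by
  intro i j hij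
  have hij' : i < j := hij
  have h : X j.rev i.rev = 0 := hX (show j.rev < i.rev from Fin.rev_lt_rev.2 hij')
  rw [adj_apply, h, mul_zero, zero_mul]

theorem evalM_zero_triangular (L : ℂ) (l : Idx N → ℂ) :
    (evalM L l 0).BlockTriangular OrderDual.toDual := by
  intro i j hij
  have hij' : (i : ℕ) < j := hij
  simp only [evalM, of_apply, entryA_eq_zero hij']
  ring

/-- A matrix of polynomials which is lower triangular at `0` and tends to a scalar matrix in the
principal grading at infinity is that scalar matrix. -/
theorem eq_scalar_of_tendsto (hN : 4 ≤ N)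
    {H : Matrix (Fin (2 * N)) (Fin (2 * N)) (Polynomial ℂ)} {c : ℂ}
    (h0 : (H.map (Polynomial.eval 0)).BlockTriangular OrderDual.toDual)
    (h : Tendsto (fun r : ℂ => scaled r (H.map (Polynomial.eval (r ^ (2 * N - 2))⁻¹)))
      (𝓝[≠] 0) (𝓝 (c • 1))) (z : ℂ) : H.map (Polynomial.eval z) = c • 1 := by
  have hent : ∀ i j : Fin (2 * N), Tendsto (fun r : ℂ => r ^ wt N j *
      (H i j).eval (r ^ (2 * N - 2))⁻¹ / r ^ wt N i) (𝓝[≠] 0) (𝓝 ((c • 1 : Matrix _ _ ℂ) i j)) :=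
    fun i j => tendsto_pi_nhds.1 (tendsto_pi_nhds.1 h i) j
  have hpow : ∀ k : ℕ, Tendsto (fun r : ℂ => r ^ k) (𝓝[≠] 0) (𝓝 (0 ^ k)) := fun k =>
    ((continuous_pow k).tendsto 0).mono_left nhdsWithin_le_nhds
  have hconst : ∀ i j, H i j = Polynomial.C ((H i j).coeff 0) := fun i j => by
    have h1 := wt_le hN i
    have h2 := wt_le hN j
    refine eq_C_of_tendsto (h := 2 * N - 2) (by omega) ?_
    -- This exponent is zero only for the first row and the last column, and there the limit itself
    -- is zero because the position is off the diagonal.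
    have := (hpow (2 * N - 2 + wt N i - wt N j)).mul (hent i j)
    have e : (0 : ℂ) ^ (2 * N - 2 + wt N i - wt N j) * (c • 1 : Matrix _ _ ℂ) i j = 0 := by
      by_cases hij : i = j
      · rw [hij, zero_pow (by omega), zero_mul]
      · rw [Matrix.smul_apply, one_apply_ne hij, smul_zero, mul_zero]
    rw [e] at this
    refine this.congr' ?_
    filter_upwards [self_mem_nhdsWithin] with r hr
    have hr0 : r ≠ 0 := hr
    have e2 : r ^ (2 * N - 2 + wt N i - wt N j) * r ^ wt N j = r ^ (2 * N - 2) * r ^ wt N i := by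
      rw [← pow_add, ← pow_add]
      congr 1
      omega
    have := pow_ne_zero (wt N i) hr0
    rw [mul_div_assoc', div_eq_iff this, ← mul_assoc, e2]
    ring
  -- The entries are now constants. Those above the diagonal are read off at z = 0, the others from
  -- the limit at infinity.
  ext i j
  rw [map_apply, hconst, Polynomial.eval_C]
  rcases lt_trichotomy i j with hij | rfl | hij
  · have := h0 (show OrderDual.toDual j < OrderDual.toDual i from hij)
    rw [map_apply, hconst, Polynomial.eval_C] at this
    rw [this, Matrix.smul_apply, one_apply_ne hij.ne, smul_zero]
  · refine tendsto_nhds_unique (tendsto_const_nhds.congr' ?_) (hent i i)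
    filter_upwards [self_mem_nhdsWithin] with r hr
    have := pow_ne_zero (wt N i) (show r ≠ 0 from hr)
    rw [hconst, Polynomial.eval_C, Polynomial.coeff_C_zero]
    field_simp
  · have hw : wt N j ≤ wt N i := by
      have : (j : ℕ) < i := hij
      unfold wt
      split_ifs <;> omega
    have hlim := (hpow (wt N i - wt N j)).mul (hent i j)
    rw [Matrix.smul_apply, one_apply_ne hij.ne', smul_zero, mul_zero] at hlim
    rw [Matrix.smul_apply, one_apply_ne hij.ne', smul_zero]
    refine tendsto_nhds_unique (tendsto_const_nhds.congr' ?_) hlim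
    filter_upwards [self_mem_nhdsWithin] with r hr
    have hr0 : r ≠ 0 := hr
    have := pow_ne_zero (wt N i) hr0
    have := pow_ne_zero (wt N j) hr0
    rw [hconst, Polynomial.eval_C, Polynomial.coeff_C_zero, pow_sub₀ _ hr0 hw]
    field_simp

/-- Only the rank one data have to match: the rows at 1/L and the columns at 1/K. All poles of the
quotient of the two products then cancel, and its behaviour at 0 and at infinity forces it to be the
identity. -/
theorem refactorization (hN : 4 ≤ N) (hLK : L ≠ K) {l m l' m' : Idx N → ℂ}
    (hl : l ∈ crystalB N L) (hm : m ∈ crystalB N K) (hl' : l' ∈ crystalB N K)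
    (hm' : m' ∈ crystalB N L) {c d : ℂ} (hc : c ≠ 0) (hd : d ≠ 0)
    (hrow : rowV l ᵥ* evalM K m L⁻¹ = c • rowV m')
    (hcol : evalM L l K⁻¹ *ᵥ colV m = d • colV l') (z : ℂ) :
    evalM L l z * evalM K m z = evalM K l' z * evalM L m' z := by
  have hL := level_ne_zero hl
  have hK := level_ne_zero hm
  have hcol0 : ∀ {M : ℂ} {l : Idx N → ℂ}, l ∈ crystalB N M → ∀ a : ℂ, a ≠ 0 → a • colV l ≠ 0 :=
    fun hl a ha h0 => by
      have h1 := congrFun h0 (lastIdx hN)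
      rw [Pi.smul_apply, Pi.zero_apply, smul_eq_mul, colV, lastIdx, colVec_last hl hN] at h1
      exact mul_ne_zero ha (level_ne_zero hl) h1
  have hrow0 : ∀ {M : ℂ} {l : Idx N → ℂ}, l ∈ crystalB N M → ∀ a : ℂ, a ≠ 0 → a • rowV l ≠ 0 :=
    fun hl a ha h0 => by
      have h1 := congrFun h0 (firstIdx hN)
      rw [Pi.smul_apply, Pi.zero_apply, smul_eq_mul, rowV_first hl hN] at h1
      exact mul_ne_zero ha (level_ne_zero hl) h1
  set P := matM L l * matM K m with hP
  set Sp := (signMat N).map Polynomial.C with hSp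
  have hPz : ∀ z, P.map (Polynomial.eval z) = evalM L l z * evalM K m z := fun z => by
    rw [hP, map_eval_mul, map_eval_matM, map_eval_matM]
  have hfac : ∀ {M : ℂ}, M ≠ 0 → ∀ z : ℂ, (1 - M * z) ^ 2 = (z - M⁻¹) ^ 2 * M ^ 2 :=
    fun hM z => by
      field_simp
      ring
  have hPP : ∀ z, P.map (Polynomial.eval z) * signMat N * (P.map (Polynomial.eval z))ᵀ
      = ((1 - L * z) ^ 2 * (1 - K * z) ^ 2) • signMat N := fun z => by
    rw [hPz, transpose_mul, mul_assoc (evalM L l z), mul_assoc (evalM L l z),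
      ← mul_assoc _ (evalM K m z)ᵀ, evalM_mul_signMat_mul_transpose hm hN, Matrix.smul_mul,
      Matrix.mul_smul, ← mul_assoc, evalM_mul_signMat_mul_transpose hl hN, smul_smul,
      mul_comm ((1 - K * z) ^ 2)]
  have hPP' : ∀ z, (P.map (Polynomial.eval z))ᵀ * signMat N * P.map (Polynomial.eval z)
      = ((1 - L * z) ^ 2 * (1 - K * z) ^ 2) • signMat N := fun z => by
    rw [hPz, transpose_mul, mul_assoc (evalM K m z)ᵀ, mul_assoc (evalM K m z)ᵀ,
      ← mul_assoc _ (evalM L l z), evalM_transpose_mul_signMat_mul hl hN, Matrix.smul_mul,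
      Matrix.mul_smul, ← mul_assoc, evalM_transpose_mul_signMat_mul hm hN, smul_smul]
  -- the pole at `1 / L`
  have hdvdL : ∀ i k, (Polynomial.X - Polynomial.C L⁻¹) ^ 2 ∣ (P * Sp * (matM L m')ᵀ) i k := by
    intro i k
    rw [hSp, poly_mul_signMat_mul_transpose_apply]
    refine sq_dvd_polyForm (a := L⁻¹)
      (g := Polynomial.C (L ^ 2) * (1 - Polynomial.C K * Polynomial.X) ^ 2)
      (g' := Polynomial.C (L ^ 2)) (x := (L⁻¹ * c) • colV l) (y := L⁻¹ • colV m') (v := rowV m')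
      (hcol0 hl _ (mul_ne_zero (inv_ne_zero hL) hc)) (hcol0 hm' _ (inv_ne_zero hL))
      (fun z => ?_) (fun z => ?_) ?_ ?_ i k
    · rw [hPP, hfac hL]
      simp only [Polynomial.eval_mul, Polynomial.eval_C, Polynomial.eval_pow, Polynomial.eval_sub,
        Polynomial.eval_one, Polynomial.eval_X, mul_assoc]
    · rw [map_eval_matM, evalM_mul_signMat_mul_transpose hm' hN, hfac hL, Polynomial.eval_C]
    · rw [hPz, evalM_inv_level hL, Matrix.smul_mul, vecMulVec_mul, hrow, vecMulVec_smul, smul_smul,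
        smul_vecMulVec]
    · rw [map_eval_matM, evalM_inv_level hL, smul_vecMulVec]
  -- the pole at `1 / K`
  have hdvdK : ∀ i k, (Polynomial.X - Polynomial.C K⁻¹) ^ 2 ∣ ((matM K l')ᵀ * Sp * P) i k := by
    intro i k
    have e : (matM K l')ᵀ * Sp * P = (matM K l')ᵀ * Sp * Pᵀᵀ := by rw [transpose_transpose]
    rw [e, hSp, poly_mul_signMat_mul_transpose_apply]
    refine sq_dvd_polyForm (a := K⁻¹) (g := Polynomial.C (K ^ 2))
      (g' := Polynomial.C (K ^ 2) * (1 - Polynomial.C L * Polynomial.X) ^ 2)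
      (x := K⁻¹ • rowV l') (y := (K⁻¹ * d) • rowV m) (v := colV l')
      (hrow0 hl' _ (inv_ne_zero hK)) (hrow0 hm _ (mul_ne_zero (inv_ne_zero hK) hd))
      (fun z => ?_) (fun z => ?_) ?_ ?_ i k
    · rw [transpose_map, transpose_transpose, map_eval_matM,
        evalM_transpose_mul_signMat_mul hl' hN, hfac hK, Polynomial.eval_C]
    · rw [transpose_map, transpose_transpose, hPP', mul_comm ((1 - L * z) ^ 2), hfac hK]
      simp only [Polynomial.eval_mul, Polynomial.eval_C, Polynomial.eval_pow, Polynomial.eval_sub,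
        Polynomial.eval_one, Polynomial.eval_X, mul_assoc]
    · rw [transpose_map, map_eval_matM, evalM_inv_level hK, transpose_smul, transpose_vecMulVec,
        smul_vecMulVec]
    · rw [transpose_map, hPz, evalM_inv_level hK, Matrix.mul_smul, mul_vecMulVec, hcol,
        transpose_smul, transpose_vecMulVec, vecMulVec_smul, smul_smul, smul_vecMulVec]
  obtain ⟨Q₁, hQ₁⟩ := exists_eq_smul_of_dvd hdvdL
  obtain ⟨Q₂, hQ₂⟩ := exists_eq_smul_of_dvd hdvdK
  -- Since `adj` of an M-matrix is its inverse up to the squared factor, D is M_K(l')⁻¹ P M_L(m')⁻¹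
  -- times (1 - Kz)² (1 - Lz)².
  set D := Sp * ((matM K l')ᵀ * Sp * (P * Sp * (matM L m')ᵀ)) * Sp with hD
  -- Here L ≠ K enters: the double zeros of D at 1/L and at 1/K lie at different points and can be
  -- divided out together.
  have hcop : IsCoprime ((Polynomial.X - Polynomial.C L⁻¹) ^ 2 : Polynomial ℂ)
      ((Polynomial.X - Polynomial.C K⁻¹) ^ 2) :=
    (Polynomial.isCoprime_X_sub_C_of_isUnit_sub
      (sub_ne_zero.2 (fun h => hLK (inv_injective h))).isUnit).pow
  have hDdvd : ∀ i j, (Polynomial.X - Polynomial.C L⁻¹) ^ 2 * (Polynomial.X - Polynomial.C K⁻¹) ^ 2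
      ∣ D i j := by
    intro i j
    refine hcop.mul_dvd ?_ ?_
    · rw [hD, hQ₁, Matrix.mul_smul, Matrix.mul_smul, Matrix.smul_mul]
      exact Dvd.intro _ rfl
    · have e : (matM K l')ᵀ * Sp * (P * Sp * (matM L m')ᵀ)
          = (matM K l')ᵀ * Sp * P * (Sp * (matM L m')ᵀ) := by simp only [mul_assoc]
      rw [hD, e, hQ₂]
      simp only [Matrix.smul_mul, Matrix.mul_smul]
      exact Dvd.intro _ rfl
  obtain ⟨H, hH⟩ := exists_eq_smul_of_dvd hDdvd
  have hDz : ∀ z, D.map (Polynomial.eval z) = adj (evalM K l' z) *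
      (evalM L l z * evalM K m z) * adj (evalM L m' z) := fun z => by
    simp only [hD, hSp, map_eval_mul, map_eval_map_C, hPz, transpose_map, map_eval_matM, adj,
      mul_assoc]
  have hHz : ∀ z, D.map (Polynomial.eval z) = ((z - L⁻¹) ^ 2 * (z - K⁻¹) ^ 2) •
      H.map (Polynomial.eval z) := fun z => by
    rw [hH]
    ext i j
    simp
  -- At z = 0 all four factors of D are lower triangular. At infinity each tends to a multiple of
  -- `outerMid`, whose square is the identity, so the limit is the scalar L² K².
  have hscal : ∀ z, H.map (Polynomial.eval z) = (L ^ 2 * K ^ 2) • 1 := by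
    refine eq_scalar_of_tendsto hN ?_ ?_
    · have h0 := hHz 0
      have hne : ((0 - L⁻¹) ^ 2 * (0 - K⁻¹) ^ 2 : ℂ) ≠ 0 := by
        simp [hL, hK]
      have h1 : H.map (Polynomial.eval 0) = ((0 - L⁻¹) ^ 2 * (0 - K⁻¹) ^ 2 : ℂ)⁻¹ •
          D.map (Polynomial.eval 0) := by
        rw [h0, smul_smul, inv_mul_cancel₀ hne, one_smul]
      have htri : (D.map (Polynomial.eval 0)).BlockTriangular OrderDual.toDual := by
        rw [hDz]
        exact ((adj_triangular (evalM_zero_triangular K l')).mul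
          ((evalM_zero_triangular L l).mul (evalM_zero_triangular K m))).mul
          (adj_triangular (evalM_zero_triangular L m'))
      intro i j hij
      rw [h1, Matrix.smul_apply, htri hij, smul_zero]
    · have hlim := ((tendsto_scaled_adj hl' hN).mul
        ((tendsto_scaled hl hN).mul (tendsto_scaled hm hN))).mul (tendsto_scaled_adj hm' hN)
      have hq : Tendsto (fun r : ℂ => ((1 - r ^ (2 * N - 2) * L⁻¹) ^ 2 *
          (1 - r ^ (2 * N - 2) * K⁻¹) ^ 2)⁻¹) (𝓝[≠] 0) (𝓝 1) := by
        have hcont : ContinuousAt (fun r : ℂ => ((1 - r ^ (2 * N - 2) * L⁻¹) ^ 2 *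
            (1 - r ^ (2 * N - 2) * K⁻¹) ^ 2)⁻¹) 0 := by
          refine ContinuousAt.inv₀ (by fun_prop) ?_
          simp [show 2 * N - 2 ≠ 0 by omega]
        have := hcont.tendsto.mono_left (nhdsWithin_le_nhds (s := {0}ᶜ))
        simpa [show 2 * N - 2 ≠ 0 by omega] using this
      have hlim2 := hq.smul hlim
      have e : (1 : ℂ) • (K • outerMid N * (L • outerMid N * K • outerMid N) * L • outerMid N)
          = (L ^ 2 * K ^ 2) • (1 : Matrix (Fin (2 * N)) (Fin (2 * N)) ℂ) := by
        simp only [Matrix.smul_mul, Matrix.mul_smul, outerMid_mul_self hN, mul_one,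
          smul_smul]
        congr 1
        ring
      rw [e] at hlim2
      refine hlim2.congr' ?_
      have hev : ∀ᶠ r : ℂ in 𝓝[≠] 0, (1 - r ^ (2 * N - 2) * L⁻¹) ^ 2 *
          (1 - r ^ (2 * N - 2) * K⁻¹) ^ 2 ≠ 0 := by
        have hcont : ContinuousAt (fun r : ℂ => (1 - r ^ (2 * N - 2) * L⁻¹) ^ 2 *
            (1 - r ^ (2 * N - 2) * K⁻¹) ^ 2) 0 := by fun_prop
        refine (hcont.eventually_ne ?_).filter_mono nhdsWithin_le_nhds
        simp [show 2 * N - 2 ≠ 0 by omega]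
      filter_upwards [self_mem_nhdsWithin, hev] with r hr hne
      have hr0 : r ≠ 0 := hr
      have hrh := pow_ne_zero (2 * N - 2) hr0
      have hHr := hHz (r ^ (2 * N - 2))⁻¹
      rw [hDz] at hHr
      simp only [Matrix.smul_mul, Matrix.mul_smul, smul_smul, ← scaled_mul hr0, hHr, scaled_smul]
      refine (congrArg (fun a => a • _) ?_).trans (one_smul ℂ _)
      rw [inv_mul_eq_iff_eq_mul₀ hne]
      field_simp
  -- conclusion
  have hq : ∀ z, ((1 - L * z) ^ 2 * (1 - K * z) ^ 2) • (evalM L l z * evalM K m z)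
      = ((1 - L * z) ^ 2 * (1 - K * z) ^ 2) • (evalM K l' z * evalM L m' z) := fun z => by
    have h1 := (hDz z).symm.trans (hHz z)
    rw [hscal] at h1
    have h2 := congrArg (fun X => evalM K l' z * X * evalM L m' z) h1
    rw [mul_assoc (adj (evalM K l' z)), ← mul_assoc (evalM K l' z), mul_adj_evalM hl' hN,
      Matrix.smul_mul, one_mul, Matrix.smul_mul, mul_assoc (evalM L l z * evalM K m z),
      adj_evalM_mul hm' hN, Matrix.mul_smul, mul_one, smul_smul, smul_smul, Matrix.mul_smul,
      Matrix.smul_mul, mul_one, mul_comm ((1 - K * z) ^ 2)] at h2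
    rw [h2]
    congr 1
    rw [hfac hL, hfac hK]
    ring
  -- The factor (1 - Lz)² (1 - Kz)² is cancelled in the polynomial ring, so that the values at 1/L
  -- and 1/K are covered too.
  have hpoly : P = matM K l' * matM L m' := by
    ext1 i j
    have hne : ((1 - Polynomial.C L * Polynomial.X) ^ 2 * (1 - Polynomial.C K * Polynomial.X) ^ 2 :
        Polynomial ℂ) ≠ 0 := fun h0 => by
      have := congrArg (Polynomial.eval 0) h0
      simp at this
    refine mul_left_cancel₀ hne (Polynomial.funext fun z => ?_)
    have h1 := congrFun (congrFun (hq z) i) j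
    rw [← hPz, ← map_eval_matM, ← map_eval_matM, ← map_eval_mul] at h1
    simpa using h1
  rw [← hPz, hpoly, map_eval_mul, map_eval_matM, map_eval_matM]

end Refactorization

end FoldedR

namespace FoldedR

open Matrix

/-! ### Points of the crystal as isotropic vectors -/

section Points

variable {N : ℕ} {L K : ℂ}

/-- The entries of a vector, extended by zero. -/
def entry (x : Fin (2 * N) → ℂ) (j : ℕ) : ℂ := if h : j < 2 * N then x ⟨j, h⟩ else 0

theorem entry_of_lt (x : Fin (2 * N) → ℂ) {j : ℕ} (h : j < 2 * N) : entry x j = x ⟨j, h⟩ :=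
  dif_pos h

theorem entry_rowV (l : Idx N → ℂ) {j : ℕ} (h : j < 2 * N) : entry (rowV l) j = rowVec l j :=
  dif_pos h

theorem entry_smul (c : ℂ) (x : Fin (2 * N) → ℂ) (j : ℕ) :
    entry (c • x) j = c * entry x j := by
  unfold entry
  split_ifs
  · rfl
  · rw [mul_zero]

theorem form_self_eq (x : Fin (2 * N) → ℂ) : form x x = 2 * partialForm N (entry x) N := by
  rw [← partialForm_two_mul, partialForm, Finset.sum_range, form]
  refine Finset.sum_congr rfl fun j _ => ?_
  rw [entry_of_lt x j.2, entry_of_lt x (show 2 * N - 1 - (j : ℕ) < 2 * N by omega)]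
  congr 3
  rw [Fin.ext_iff, Fin.val_rev]
  simp only
  omega

theorem partialForm_entry_smul (c : ℂ) (x : Fin (2 * N) → ℂ) (k : ℕ) :
    partialForm N (entry (c • x)) k = c ^ 2 * partialForm N (entry x) k := by
  simp only [partialForm, entry_smul, Finset.mul_sum]
  exact Finset.sum_congr rfl fun j _ => by ring

theorem partialForm_entry_rowV (l : Idx N → ℂ) {k : ℕ} (hk : k ≤ 2 * N) :
    partialForm N (entry (rowV l)) k = partialForm N (rowVec l) k :=
  Finset.sum_congr rfl fun j hj => by
    rw [Finset.mem_range] at hj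
    rw [entry_rowV l (by omega), entry_rowV l (by omega)]

/-- The product of the quantities which have to be nonzero for an isotropic vector to come from a
point of the crystal. -/
def goodPoly (x : Fin (2 * N) → ℂ) : ℂ :=
  (∏ j ∈ Finset.range (N + 1), entry x j) *
    ∏ k ∈ Finset.range (N - 1), partialForm N (entry x) (k + 1)

/-- The condition for an isotropic vector to come from a point of the crystal. -/
def Good (x : Fin (2 * N) → ℂ) : Prop := goodPoly x ≠ 0

theorem good_iff (x : Fin (2 * N) → ℂ) : Good x ↔ (∀ j, j ≤ N → entry x j ≠ 0) ∧
    ∀ k, 1 ≤ k → k + 1 ≤ N → partialForm N (entry x) k ≠ 0 := by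
  rw [Good, goodPoly, mul_ne_zero_iff, Finset.prod_ne_zero_iff, Finset.prod_ne_zero_iff]
  simp only [Finset.mem_range]
  refine and_congr ⟨fun h j hj => h j (by omega), fun h j hj => h j (by omega)⟩
    ⟨fun h k h1 h2 => ?_, fun h k hk => h (k + 1) (by omega) (by omega)⟩
  have := h (k - 1) (by omega)
  rwa [show k - 1 + 1 = k by omega] at this

theorem good_smul {c : ℂ} (hc : c ≠ 0) {x : Fin (2 * N) → ℂ} : Good (c • x) ↔ Good x := by
  simp only [good_iff, entry_smul, partialForm_entry_smul, ne_eq, mul_eq_zero, hc, false_or,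
    pow_eq_zero_iff, OfNat.ofNat_ne_zero, not_false_eq_true]

theorem good_rowV {l : Idx N → ℂ} (hl : l ∈ crystalB N L) (hN : 4 ≤ N) : Good (rowV l) := by
  have hL := level_ne_zero hl
  refine (good_iff _).2 ⟨fun j hj => ?_, fun k h1 h2 => ?_⟩
  · rw [entry_rowV l (by omega)]
    rcases eq_or_lt_of_le hj with rfl | h
    · rw [rowVec_mid hl hN]
      exact cobarProd_ne_zero hl _
    · rw [rowVec_of_lt hl hN h]
      exact div_ne_zero hL (coProd_ne_zero hl _)
  · rw [partialForm_entry_rowV l (by omega), partialForm_rowVec hl hN h1 h2]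
    exact mul_ne_zero (pow_ne_zero _ (by norm_num))
      (div_ne_zero (mul_ne_zero hL (cobarProd_ne_zero hl _)) (coProd_ne_zero hl _))

/-- The ratio `l̄_i / l_i` of the point of the crystal with a given isotropic vector. -/
def pointRatio (L : ℂ) (x : Fin (2 * N) → ℂ) (i : ℕ) : ℂ :=
  if i = 1 then L * partialForm N (entry x) 1 / entry x 0 ^ 2
  else -(partialForm N (entry x) i / partialForm N (entry x) (i - 1))

/-- The point of the crystal of level `L` with a given isotropic vector. -/
def pointOf (L : ℂ) (x : Fin (2 * N) → ℂ) : Idx N → ℂ :=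
  mkPoint N (fun i => entry x (i - 1) / entry x i)
    (fun i => pointRatio L x i * (entry x (i - 1) / entry x i))

/-- All coordinates are homogeneous of degree 0 in x: the point depends only on the line. -/
theorem pointOf_smul (L : ℂ) {c : ℂ} (hc : c ≠ 0) (x : Fin (2 * N) → ℂ) :
    pointOf L (c • x) = pointOf L x := by
  have h1 : ∀ i j, entry (c • x) i / entry (c • x) j = entry x i / entry x j := fun i j => by
    rw [entry_smul, entry_smul, mul_div_mul_left _ _ hc]
  have h2 : ∀ i, pointRatio L (c • x) i = pointRatio L x i := fun i => by
    unfold pointRatio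
    rw [partialForm_entry_smul, partialForm_entry_smul, partialForm_entry_smul, entry_smul,
      mul_div_mul_left _ _ (pow_ne_zero 2 hc), mul_pow, mul_left_comm,
      mul_div_mul_left _ _ (pow_ne_zero 2 hc)]
  unfold pointOf
  simp only [h1, h2]

/-- One has v_{i-1} / v_i = l_i, and consecutive partial sums of the form have quotient -l̄_i / l_i
for i ≥ 2. For i = 1 the normalization v_0 = L takes the place of the missing partial sum. -/
theorem pointOf_rowV {l : Idx N → ℂ} (hl : l ∈ crystalB N L) (hN : 4 ≤ N) :
    pointOf L (rowV l) = l := by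
  have hL := level_ne_zero hl
  have hco : ∀ i, 1 ≤ i → i ≤ N → rowVec l (i - 1) / rowVec l i = co l i := by
    intro i h1 h2
    obtain ⟨k, rfl⟩ : ∃ k, i = k + 1 := ⟨i - 1, by omega⟩
    have hP := coProd_ne_zero hl k
    have hc := co_ne_zero hl (k + 1)
    rw [Nat.add_sub_cancel]
    rcases eq_or_lt_of_le h2 with h | h
    · have hQ := cobarProd_ne_zero hl (N - 1)
      obtain rfl : k = N - 1 := by omega
      rw [h, rowVec_mid hl hN, rowVec_pred hl hN]
      field_simp
    · rw [rowVec_of_lt hl hN (by omega), rowVec_of_lt hl hN h, coProd_succ]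
      field_simp
  refine ext_co (fun i h1 h2 => ?_) fun i h1 h2 => ?_
  · rw [pointOf, co_mkPoint _ _ ⟨h1, h2⟩, entry_rowV l (by omega), entry_rowV l (by omega),
      hco i h1 h2]
  · rw [pointOf, cobar_mkPoint _ _ ⟨h1, h2⟩, entry_rowV l (by omega), entry_rowV l (by omega),
      hco i h1 (by omega), pointRatio]
    have hc := co_ne_zero hl i
    split_ifs with h
    · subst h
      rw [partialForm_entry_rowV l (by omega), partialForm_rowVec hl hN le_rfl (by omega),
        entry_rowV l (by omega), rowVec_zero hl hN, coProd_succ, cobarProd_succ]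
      simp only [coProd_zero, cobarProd_zero, zero_add]
      field_simp
      simp
    · obtain ⟨k, rfl⟩ : ∃ k, i = k + 2 := ⟨i - 2, by omega⟩
      have hP := coProd_ne_zero hl (k + 1)
      have hQ := cobarProd_ne_zero hl (k + 1)
      rw [partialForm_entry_rowV l (by omega), partialForm_entry_rowV l (by omega),
        partialForm_rowVec hl hN (by omega) (by omega),
        partialForm_rowVec hl hN (by omega) (by omega), show k + 2 - 1 = k + 1 by omega,
        Nat.add_sub_cancel, show k + 2 = k + 1 + 1 by omega, coProd_succ, cobarProd_succ, pow_succ]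
      have : ((-1 : ℂ)) ^ k ≠ 0 := pow_ne_zero _ (by norm_num)
      field_simp

section OfVector

/-! ### From good isotropic vectors to points of the crystal -/

variable {x : Fin (2 * N) → ℂ}

theorem coProd_pointOf (hx : Good x) {k : ℕ} (hk : k ≤ N) :
    coProd (pointOf L x) k = entry x 0 / entry x k := by
  have h := ((good_iff x).1 hx).1
  induction k with
  | zero => rw [coProd_zero, div_self (h 0 (by omega))]
  | succ k ih =>
    have := h k (by omega)
    rw [coProd_succ, ih (by omega), pointOf, co_mkPoint _ _ (by omega), Nat.add_sub_cancel]
    field_simp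

theorem cobarProd_pointOf (hx : Good x) {k : ℕ} (hk : 1 ≤ k) (hk' : k + 1 ≤ N) :
    cobarProd (pointOf L x) k
      = (-1) ^ (k - 1) * partialForm N (entry x) k * L / (entry x 0 * entry x k) := by
  obtain ⟨h, h'⟩ := (good_iff x).1 hx
  induction k, hk using Nat.le_induction with
  | base =>
    have := h 0 (by omega)
    rw [cobarProd_succ, cobarProd_zero, pointOf, cobar_mkPoint _ _ (by omega), pointRatio,
      if_pos (by omega)]
    simp only [Nat.sub_self, pow_zero, zero_add]
    field_simp
  | succ k hk ih =>
    have h1 := h k (by omega)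
    have h2 := h' k hk (by omega)
    have h3 := h 0 (by omega)
    rw [cobarProd_succ, ih (by omega), pointOf, cobar_mkPoint _ _ (by omega), pointRatio,
      if_neg (by omega), Nat.add_sub_cancel]
    obtain ⟨m, rfl⟩ : ∃ m, k = m + 1 := ⟨k - 1, by omega⟩
    rw [Nat.add_sub_cancel, pow_succ]
    field_simp

/-- Isotropy makes the last partial sum cancel against the middle pair. This gives the point built
from x the level L. -/
theorem partialForm_pred (hN : 4 ≤ N) (hx0 : form x x = 0) :
    (-1) ^ (N - 1 - 1) * partialForm N (entry x) (N - 1) = entry x (N - 1) * entry x N := by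
  rw [form_self_eq] at hx0
  have h0 : partialForm N (entry x) N = 0 := by simpa using hx0
  have h1 := partialForm_succ (N := N) (entry x) (N - 1)
  rw [show N - 1 + 1 = N by omega, h0, sgn_of_lt (by omega),
    show 2 * N - 1 - (N - 1) = N by omega] at h1
  obtain ⟨m, rfl⟩ : ∃ m, N = m + 2 := ⟨N - 2, by omega⟩
  rw [show m + 2 - 1 = m + 1 by omega, pow_succ] at h1
  rw [show m + 2 - 1 = m + 1 by omega, Nat.add_sub_cancel]
  have e : ((-1 : ℂ)) ^ m * (-1) ^ m = 1 := by
    rw [← mul_pow]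
    simp
  linear_combination (-(-1) ^ m) * h1 + entry x (m + 1) * entry x (m + 2) * e

theorem pointOf_mem (hN : 4 ≤ N) (hL : L ≠ 0) (hx : Good x) (hx0 : form x x = 0) :
    pointOf L x ∈ crystalB N L := by
  obtain ⟨h, h'⟩ := (good_iff x).1 hx
  refine mem_crystalB_iff.2 ⟨fun i h1 h2 => ?_, fun i h1 h2 => ?_, ?_⟩
  · rw [pointOf, co_mkPoint _ _ ⟨h1, h2⟩]
    exact div_ne_zero (h _ (by omega)) (h _ h2)
  · rw [pointOf, cobar_mkPoint _ _ ⟨h1, h2⟩]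
    refine mul_ne_zero ?_ (div_ne_zero (h _ (by omega)) (h _ (by omega)))
    unfold pointRatio
    split_ifs
    · exact div_ne_zero (mul_ne_zero hL (h' 1 le_rfl (by omega))) (pow_ne_zero _ (h 0 (by omega)))
    · exact neg_ne_zero.2 (div_ne_zero (h' i h1 (by omega)) (h' (i - 1) (by omega) (by omega)))
  · have h1 := h 0 (by omega)
    have h2 := h N le_rfl
    have h3 := h (N - 1) (by omega)
    rw [coProd_pointOf hx le_rfl, cobarProd_pointOf hx (by omega) (by omega),
      partialForm_pred hN hx0]
    field_simp

/-- The entries of x after position N are forced by the partial sums, which the point retains. The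
scalar normalizes the first entry to L. -/
theorem rowV_pointOf (hN : 4 ≤ N) (hL : L ≠ 0) (hx : Good x) (hx0 : form x x = 0) :
    rowV (pointOf L x) = (L / entry x 0) • x := by
  have hl := pointOf_mem hN hL hx hx0
  obtain ⟨h, h'⟩ := (good_iff x).1 hx
  have h0 := h 0 (by omega)
  suffices ∀ j, j < 2 * N → rowVec (pointOf L x) j = L / entry x 0 * entry x j by
    funext j
    rw [rowV, this j j.2, Pi.smul_apply, smul_eq_mul, entry_of_lt x j.2]
  intro j hj
  rcases lt_trichotomy j N with hlt | rfl | hgt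
  · have := h j hlt.le
    rw [rowVec_of_lt hl hN hlt, coProd_pointOf hx hlt.le]
    field_simp
  · have := h (j - 1) (by omega)
    rw [rowVec_mid hl hN, cobarProd_pointOf hx (by omega) (by omega), partialForm_pred hN hx0]
    field_simp
  obtain ⟨k, hk, rfl⟩ : ∃ k, k + 2 ≤ N ∧ j = 2 * N - 1 - k := ⟨2 * N - 1 - j, by omega, by omega⟩
  have hk0 := h k (by omega)
  have hk1 := h (k + 1) (by omega)
  rcases Nat.eq_zero_or_pos k with rfl | hpos
  · have hb : partialForm N (entry x) 1 = entry x 0 * entry x (2 * N - 1) := by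
      rw [partialForm_succ, partialForm_zero, sgn_of_lt (by omega), Nat.sub_zero]
      ring
    rw [Nat.sub_zero, rowVec_last _ hN, pointOf, co_mkPoint _ _ (by omega),
      cobar_mkPoint _ _ (by omega), pointRatio, if_pos rfl, hb]
    simp only [Nat.sub_self]
    simp only [zero_add] at hk1
    field_simp
  · rw [rowVec_of_gt hl hN hpos hk, cobarProd_pointOf hx hpos (by omega),
      cobarProd_pointOf hx (by omega) (by omega), pointOf, co_mkPoint _ _ (by omega),
      partialForm_succ, sgn_of_lt (by omega)]
    obtain ⟨m, rfl⟩ : ∃ m, k = m + 1 := ⟨k - 1, by omega⟩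
    simp only [Nat.add_sub_cancel, pow_succ]
    have e : ((-1 : ℂ)) ^ m * (-1) ^ m = 1 := by
      rw [← mul_pow]
      simp
    field_simp
    linear_combination (entry x (m + 1) * entry x (2 * N - 1 - (m + 1))) * e

end OfVector

end Points

end FoldedR

namespace FoldedR

open Matrix

/-! ### The map on pairs of points -/

section RMap

variable {N : ℕ} {L K : ℂ} {l m l' m' : Idx N → ℂ}

theorem form_eq_dotProduct (x y : Fin (2 * N) → ℂ) : form x y = x ⬝ᵥ (signMat N *ᵥ y) := by
  refine Finset.sum_congr rfl fun i _ => ?_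
  have : (signMat N *ᵥ y) i = sgn N i * y i.rev := by
    rw [mulVec, dotProduct, Finset.sum_eq_single i.rev]
    · simp [signMat]
    · intro k _ hk
      simp [signMat, hk]
    · simp
  rw [this]
  ring

theorem form_vecMul (hm : m ∈ crystalB N K) (hN : 4 ≤ N) (z : ℂ) (x y : Fin (2 * N) → ℂ) :
    form (x ᵥ* evalM K m z) (y ᵥ* evalM K m z) = (1 - K * z) ^ 2 * form x y := by
  have h := evalM_mul_signMat_mul_transpose hm hN z
  rw [form_eq_dotProduct, ← dotProduct_mulVec, ← mulVec_transpose _ y, mulVec_mulVec,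
    mulVec_mulVec, h, smul_mulVec, dotProduct_smul, form_eq_dotProduct,
    smul_eq_mul]

theorem rowV_ne_zero (hl : l ∈ crystalB N L) (hN : 4 ≤ N) : rowV l ≠ 0 := fun h => by
  have := congrFun h (firstIdx hN)
  rw [rowV_first hl hN] at this
  exact level_ne_zero hl this

theorem colV_rev (hl : l ∈ crystalB N L) (hN : 4 ≤ N) (i : Fin (2 * N)) :
    colV l i.rev = rowV (dag l) i := by
  rw [rowV, rowVec_dag hl hN i.2, colV, Fin.val_rev]
  congr 1
  omega

theorem colV_eq (hl : l ∈ crystalB N L) (hN : 4 ≤ N) (i : Fin (2 * N)) :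
    colV l i = rowV (dag l) i.rev := by
  rw [← colV_rev hl hN, Fin.rev_rev]

/-- The vector of the second component of the refactorization of `(l, m)`, up to a factor. -/
def outVec (L K : ℂ) (l m : Idx N → ℂ) : Fin (2 * N) → ℂ := rowV l ᵥ* evalM K m L⁻¹

theorem form_outVec (hl : l ∈ crystalB N L) (hm : m ∈ crystalB N K) (hN : 4 ≤ N) :
    form (outVec L K l m) (outVec L K l m) = 0 := by
  rw [outVec, form_vecMul hm hN, form_rowV_self hl hN, mul_zero]

/-- Reflection in the antidiagonal turns the column that determines l' into the row attached to the
pair (`dag m`, `dag l`). -/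
theorem outVec_dag_rev (hl : l ∈ crystalB N L) (hm : m ∈ crystalB N K) (hN : 4 ≤ N)
    (i : Fin (2 * N)) :
    outVec K L (dag m) (dag l) i.rev = (evalM L l K⁻¹ *ᵥ colV m) i := by
  rw [outVec, vecMul, dotProduct, mulVec, dotProduct, ← Equiv.sum_comp Fin.revPerm]
  refine Finset.sum_congr rfl fun j _ => ?_
  rw [Fin.revPerm_apply, evalM_dag hl hN, Fin.rev_rev, Fin.rev_rev, colV_eq hm hN, mul_comm]

/-- The equation `M_L(l, z) M_K(m, z) = M_K(l', z) M_L(m', z)`. -/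
def Refactors (L K : ℂ) (l m l' m' : Idx N → ℂ) : Prop :=
  ∀ z, evalM L l z * evalM K m z = evalM K l' z * evalM L m' z

theorem Refactors.symm (h : Refactors L K l m l' m') : Refactors K L l' m' l m :=
  fun z => (h z).symm

theorem Refactors.dag (h : Refactors L K l m l' m') (hN : 4 ≤ N) (hl : l ∈ crystalB N L)
    (hm : m ∈ crystalB N K) (hl' : l' ∈ crystalB N K) (hm' : m' ∈ crystalB N L) :
    Refactors K L (dag m) (dag l) (dag m') (dag l') := by
  have key : ∀ {L K : ℂ} {l m : Idx N → ℂ}, l ∈ crystalB N L → m ∈ crystalB N K → ∀ z i j,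
      (evalM K (FoldedR.dag m) z * evalM L (FoldedR.dag l) z) i j
        = (evalM L l z * evalM K m z) j.rev i.rev := by
    intro L K l m hl hm z i j
    rw [mul_apply, mul_apply, ← Equiv.sum_comp Fin.revPerm]
    refine Finset.sum_congr rfl fun k _ => ?_
    rw [Fin.revPerm_apply, evalM_dag hl hN, evalM_dag hm hN, Fin.rev_rev, mul_comm]
  intro z
  ext i j
  rw [key hl hm, key hl' hm', h z]

/-- At z = 1/L both products are rank one matrices. Their last rows are compared, the last entry of
u(l) being L. -/
theorem Refactors.smul_outVec (h : Refactors L K l m l' m') (hN : 4 ≤ N)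
    (hl : l ∈ crystalB N L) (hl' : l' ∈ crystalB N K)
    (hm' : m' ∈ crystalB N L) :
    L • outVec L K l m = outVec L K (FoldedR.dag m') (FoldedR.dag l') (firstIdx hN) • rowV m' := by
  have hL := level_ne_zero hl
  have hz := h L⁻¹
  rw [evalM_inv_level hL, evalM_inv_level hL, smul_mul_assoc, mul_smul_comm,
    smul_right_inj (inv_ne_zero hL), vecMulVec_mul, mul_vecMulVec] at hz
  have hr := congrFun hz (lastIdx hN)
  have h1 : colV l (lastIdx hN) = L := colVec_last hl hN
  rw [← rev_lastIdx hN, outVec_dag_rev hl' hm' hN, outVec]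
  funext j
  have := congrFun hr j
  rw [vecMulVec_apply, vecMulVec_apply, h1] at this
  exact this

/-- The pairs of points for which both components of the refactorization are determined by the
vectors `outVec`. -/
def goodSet (N : ℕ) (L K : ℂ) : Set (Idx N ⊕ Idx N → ℂ) :=
  {p | p ∈ prodSet (crystalB N L) (crystalB N K) ∧
    Good (outVec L K (p ∘ Sum.inl) (p ∘ Sum.inr)) ∧
    Good (outVec K L (dag (p ∘ Sum.inr)) (dag (p ∘ Sum.inl)))}

/-- The refactorization map, on good pairs. -/
def rmap (L K : ℂ) (p : Idx N ⊕ Idx N → ℂ) : Idx N ⊕ Idx N → ℂ :=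
  Sum.elim (dag (pointOf K (outVec K L (dag (p ∘ Sum.inr)) (dag (p ∘ Sum.inl)))))
    (pointOf L (outVec L K (p ∘ Sum.inl) (p ∘ Sum.inr)))

theorem goodSet_subset : goodSet N L K ⊆ prodSet (crystalB N L) (crystalB N K) := fun _ hp => hp.1

theorem Good.ne_zero {x : Fin (2 * N) → ℂ} (h : Good x) {j : ℕ} (hj : j ≤ N) : entry x j ≠ 0 :=
  ((good_iff x).1 h).1 j hj

theorem Good.ne_zero' {x : Fin (2 * N) → ℂ} (h : Good x) : x ≠ 0 := fun h0 => by
  have := h.ne_zero (Nat.zero_le N)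
  rw [h0, entry] at this
  split_ifs at this <;> exact this rfl

theorem rmap_mem (hN : 4 ≤ N) (hL : L ≠ 0) (hK : K ≠ 0) {p : Idx N ⊕ Idx N → ℂ}
    (hp : p ∈ goodSet N L K) : rmap L K p ∈ prodSet (crystalB N K) (crystalB N L) :=
  ⟨dag_mem (pointOf_mem hN hK hp.2.2
      (form_outVec (dag_mem hp.1.2 hN) (dag_mem hp.1.1 hN) hN)) hN,
    pointOf_mem hN hL hp.2.1 (form_outVec hp.1.1 hp.1.2 hN)⟩

theorem smul_rowV_pointOf (hN : 4 ≤ N) (hL : L ≠ 0) {x : Fin (2 * N) → ℂ} (hx : Good x)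
    (hx0 : form x x = 0) : x = (entry x 0 / L) • rowV (pointOf L x) := by
  have := hx.ne_zero (Nat.zero_le N)
  rw [rowV_pointOf hN hL hx hx0, smul_smul, div_mul_div_comm, mul_comm L,
    div_self (mul_ne_zero this hL), one_smul]

theorem mEquation_rmap (hN : 4 ≤ N) (hL : L ≠ 0) (hK : K ≠ 0) (hLK : L ≠ K)
    {p : Idx N ⊕ Idx N → ℂ} (hp : p ∈ goodSet N L K) : MEquation L K p (rmap L K p) := by
  have hmem := rmap_mem hN hL hK hp
  have hx := smul_rowV_pointOf hN hL hp.2.1 (form_outVec hp.1.1 hp.1.2 hN)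
  have hd := form_outVec (dag_mem hp.1.2 hN) (dag_mem hp.1.1 hN) hN
  have hy := smul_rowV_pointOf hN hK hp.2.2 hd
  refine mEquation_iff.2 (refactorization hN hLK hp.1.1 hp.1.2 hmem.1 hmem.2
    (div_ne_zero (hp.2.1.ne_zero (Nat.zero_le N)) hL)
    (div_ne_zero (hp.2.2.ne_zero (Nat.zero_le N)) hK) hx ?_)
  funext i
  rw [← outVec_dag_rev hp.1.1 hp.1.2 hN, Pi.smul_apply, colV_eq hmem.1 hN]
  conv_lhs => rw [hy]
  rw [rmap, Sum.elim_comp_inl, dag_dag (pointOf_mem hN hK hp.2.2 hd) hN]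
  rfl

/-- A good vector is nonzero, so the scalar in `Refactors.smul_outVec` does not vanish and the line
of v(m') is determined. -/
theorem Refactors.eq_pointOf (h : Refactors L K l m l' m') (hN : 4 ≤ N)
    (hl : l ∈ crystalB N L) (hl' : l' ∈ crystalB N K) (hm' : m' ∈ crystalB N L) (hg : Good (outVec L K l m)) :
    m' = pointOf L (outVec L K l m) := by
  have h1 := h.smul_outVec hN hl hl' hm'
  have hL := level_ne_zero hl
  have hc : outVec L K (FoldedR.dag m') (FoldedR.dag l') (firstIdx hN) ≠ 0 := fun h0 => by
    rw [h0, zero_smul] at h1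
    exact hg.ne_zero' ((smul_eq_zero.1 h1).resolve_left hL)
  rw [← pointOf_smul L hL, h1, pointOf_smul L hc, pointOf_rowV hm' hN]

/-- The second component is determined by the equation at 1/L, the first by the reflected equation.
The levels may coincide, which serves the case L = K. -/
theorem eq_rmap (hN : 4 ≤ N) {p q : Idx N ⊕ Idx N → ℂ} (hp : p ∈ goodSet N L K)
    (hq : q ∈ prodSet (crystalB N K) (crystalB N L)) (h : MEquation L K p q) :
    q = rmap L K p := by
  have hR : Refactors L K _ _ _ _ := mEquation_iff.1 h
  have h1 := hR.eq_pointOf hN hp.1.1 hq.1 hq.2 hp.2.1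
  have h2 := (hR.dag hN hp.1.1 hp.1.2 hq.1 hq.2).eq_pointOf hN (dag_mem hp.1.2 hN)
    (dag_mem hq.2 hN) (dag_mem hq.1 hN) hp.2.2
  rw [rmap, ← h1, ← h2, dag_dag hq.1 hN, Sum.elim_comp_inl_inr]

/-- Read from right to left, the equation makes v(l') M_L(m', 1/K) a multiple of v(m), and up to the
factor K the scalar is the first entry of a vector assumed to be good. -/
theorem Refactors.good_outVec (h : Refactors L K l m l' m') (hN : 4 ≤ N)
    (hl : l ∈ crystalB N L) (hm : m ∈ crystalB N K) (hl' : l' ∈ crystalB N K)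
    (hg : Good (outVec K L (FoldedR.dag m) (FoldedR.dag l))) :
    Good (outVec K L l' m') := by
  have hK := level_ne_zero hm
  have h1 := h.symm.smul_outVec hN hl' hl hm
  have hc : outVec K L (FoldedR.dag m) (FoldedR.dag l) (firstIdx hN) ≠ 0 := by
    have := hg.ne_zero (Nat.zero_le N)
    rwa [entry_of_lt _ (by omega)] at this
  rw [← good_smul hK, h1, good_smul hc]
  exact good_rowV hm hN

theorem mem_goodSet_of_mEquation (hN : 4 ≤ N) {p q : Idx N ⊕ Idx N → ℂ}
    (hp : p ∈ goodSet N L K) (hq : q ∈ prodSet (crystalB N K) (crystalB N L))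
    (h : MEquation L K p q) : q ∈ goodSet N K L := by
  have hR : Refactors L K _ _ _ _ := mEquation_iff.1 h
  refine ⟨hq, hR.good_outVec hN hp.1.1 hp.1.2 hq.1 hp.2.2, ?_⟩
  refine (hR.dag hN hp.1.1 hp.1.2 hq.1 hq.2).good_outVec hN (dag_mem hp.1.2 hN)
    (dag_mem hp.1.1 hN) (dag_mem hq.2 hN) ?_
  rw [dag_dag hp.1.1 hN, dag_dag hp.1.2 hN]
  exact hp.2.1

theorem rmap_mem_goodSet (hN : 4 ≤ N) (hL : L ≠ 0) (hK : K ≠ 0) (hLK : L ≠ K)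
    {p : Idx N ⊕ Idx N → ℂ} (hp : p ∈ goodSet N L K) : rmap L K p ∈ goodSet N K L :=
  mem_goodSet_of_mEquation hN hp (rmap_mem hN hL hK hp) (mEquation_rmap hN hL hK hLK hp)

/-- The M-equation is symmetric under exchanging its sides together with the levels, so uniqueness
for the levels K, L returns the original pair. -/
theorem rmap_rmap (hN : 4 ≤ N) (hL : L ≠ 0) (hK : K ≠ 0) (hLK : L ≠ K)
    {p : Idx N ⊕ Idx N → ℂ} (hp : p ∈ goodSet N L K) : rmap K L (rmap L K p) = p :=
  (eq_rmap hN (rmap_mem_goodSet hN hL hK hLK hp) hp.1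
    (mEquation_rmap hN hL hK hLK hp).symm).symm

end RMap

/-! ### Regularity -/

section RMapRegular

variable {N : ℕ} {L K : ℂ} {ι : Type*} {U : Set (ι → ℂ)} {f g : (ι → ℂ) → (Idx N → ℂ)}

theorem regularFunctions_prod {α : Type*} (s : Finset α) {F : α → (ι → ℂ) → ℂ}
    (h : ∀ a ∈ s, F a ∈ regularFunctions U) :
    (fun x => ∏ a ∈ s, F a x) ∈ regularFunctions U := by
  have := (regularFunctions U).prod_mem h
  rwa [show (∏ a ∈ s, F a) = fun x => ∏ a ∈ s, F a x from
    funext fun x => Finset.prod_apply x s F] at this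

theorem regularFunctions_sum {α : Type*} (s : Finset α) {F : α → (ι → ℂ) → ℂ}
    (h : ∀ a ∈ s, F a ∈ regularFunctions U) :
    (fun x => ∑ a ∈ s, F a x) ∈ regularFunctions U := by
  have := (regularFunctions U).sum_mem h
  rwa [show (∑ a ∈ s, F a) = fun x => ∑ a ∈ s, F a x from
    funext fun x => Finset.sum_apply x s F] at this

theorem regularFunctions_mul {F G : (ι → ℂ) → ℂ} (hF : F ∈ regularFunctions U)
    (hG : G ∈ regularFunctions U) : (fun x => F x * G x) ∈ regularFunctions U :=
  (regularFunctions U).mul_mem hF hG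

theorem regularFunctions_add {F G : (ι → ℂ) → ℂ} (hF : F ∈ regularFunctions U)
    (hG : G ∈ regularFunctions U) : (fun x => F x + G x) ∈ regularFunctions U :=
  (regularFunctions U).add_mem hF hG

theorem regularFunctions_sub {F G : (ι → ℂ) → ℂ} (hF : F ∈ regularFunctions U)
    (hG : G ∈ regularFunctions U) : (fun x => F x - G x) ∈ regularFunctions U :=
  (regularFunctions U).sub_mem hF hG

theorem regularFunctions_neg {F : (ι → ℂ) → ℂ} (hF : F ∈ regularFunctions U) :
    (fun x => - F x) ∈ regularFunctions U :=
  (regularFunctions U).neg_mem hF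

theorem regularFunctions_pow {F : (ι → ℂ) → ℂ} (hF : F ∈ regularFunctions U) (n : ℕ) :
    (fun x => F x ^ n) ∈ regularFunctions U :=
  (regularFunctions U).pow_mem hF n

theorem co_mem_regularFunctions (hf : IsRegularOn U f) (i : ℕ) :
    (fun x => co (f x) i) ∈ regularFunctions U := by
  unfold co
  split_ifs
  exacts [isRegularOn_iff.1 hf _, const_mem_regularFunctions U 1]

theorem cobar_mem_regularFunctions (hf : IsRegularOn U f) (i : ℕ) :
    (fun x => cobar (f x) i) ∈ regularFunctions U := by
  unfold cobar
  split_ifs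
  exacts [isRegularOn_iff.1 hf _, const_mem_regularFunctions U 1]

theorem isRegularOn_mkPoint {F G : (ι → ℂ) → ℕ → ℂ}
    (hF : ∀ i, 1 ≤ i → i ≤ N → (fun x => F x i) ∈ regularFunctions U)
    (hG : ∀ i, 1 ≤ i → i ≤ N - 1 → (fun x => G x i) ∈ regularFunctions U) :
    IsRegularOn U fun x => mkPoint N (F x) (G x) :=
  isRegularOn_iff.2 fun k => by
    rcases k with k | k
    · exact hF _ (by omega) (by omega)
    · exact hG _ (by omega) (by omega)

theorem isRegularOn_dag (hf : IsRegularOn U f) (hm : Set.MapsTo f U (crystalB N L)) :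
    IsRegularOn U fun x => dag (f x) := by
  have hco := co_mem_regularFunctions hf
  have hcb := cobar_mem_regularFunctions hf
  refine isRegularOn_mkPoint (fun i _ _ => ?_) fun i _ _ => ?_
  · split_ifs
    exacts [regularFunctions_mul (hcb _) (hco _),
      div_mem_regularFunctions (const_mem_regularFunctions U 1) (hco N)
        fun x hx => co_ne_zero (hm hx) N, hcb i]
  · split_ifs
    exacts [regularFunctions_mul (hco _) (hco _), hco i]

theorem entryA_mem_regularFunctions (hf : IsRegularOn U f)
    (hm : Set.MapsTo f U (crystalB N L)) (i j : ℕ) :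
    (fun x => entryA (f x) i j) ∈ regularFunctions U := by
  have hco := co_mem_regularFunctions hf
  have hcb := cobar_mem_regularFunctions hf
  have hco0 : ∀ i, ∀ x ∈ U, co (f x) i ≠ 0 := fun i x hx => co_ne_zero (hm hx) i
  have hcb0 : ∀ i, ∀ x ∈ U, cobar (f x) i ≠ 0 := fun i x hx => cobar_ne_zero (hm hx) i
  have h1 := fun i => div_mem_regularFunctions (hco i) (hcb i) (hcb0 i)
  have h2 := fun i => div_mem_regularFunctions (hcb i) (hco i) (hco0 i)
  have h3 := const_mem_regularFunctions U 1
  have h4 := fun s : Finset ℕ => regularFunctions_prod s fun a _ => hco a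
  have h5 := fun s : Finset ℕ => regularFunctions_prod s fun a _ => hcb a
  unfold entryA
  split_ifs
  exacts [h1 _, hco _, div_mem_regularFunctions h3 (hco _) (hco0 _), h2 _,
    regularFunctions_mul (h4 _) (regularFunctions_add h3 (h1 _)),
    regularFunctions_mul (h5 _) (regularFunctions_add h3 (h2 _)), h4 _, h4 _,
    regularFunctions_mul (h5 _) (hco _), h5 _, regularFunctions_mul (h4 _) (h5 _),
    const_mem_regularFunctions U 0]

theorem evalM_mem_regularFunctions (hf : IsRegularOn U f)
    (hm : Set.MapsTo f U (crystalB N L)) (z : ℂ) (i j : Fin (2 * N)) :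
    (fun x => evalM L (f x) z i j) ∈ regularFunctions U := by
  have h := entryA_mem_regularFunctions hf hm
  have hc := fun c => const_mem_regularFunctions U c
  exact regularFunctions_add (regularFunctions_add (h _ _) (regularFunctions_mul (hc z)
    (regularFunctions_sub (regularFunctions_sub (regularFunctions_mul (h _ _) (h _ _))
      (regularFunctions_mul (hc L) (h _ _))) (hc _)))) (hc _)

theorem isRegularOn_rowV (hf : IsRegularOn U f) (hm : Set.MapsTo f U (crystalB N L)) :
    IsRegularOn U fun x => rowV (f x) :=
  isRegularOn_iff.2 fun _ => entryA_mem_regularFunctions hf hm _ _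

theorem isRegularOn_outVec (hf : IsRegularOn U f) (hm : Set.MapsTo f U (crystalB N L))
    (hg : IsRegularOn U g) (hm' : Set.MapsTo g U (crystalB N K)) :
    IsRegularOn U fun x => outVec L K (f x) (g x) :=
  isRegularOn_iff.2 fun _ => regularFunctions_sum Finset.univ fun j _ =>
    regularFunctions_mul (isRegularOn_iff.1 (isRegularOn_rowV hf hm) j)
      (evalM_mem_regularFunctions hg hm' L⁻¹ j _)

variable {X : (ι → ℂ) → (Fin (2 * N) → ℂ)}

theorem entry_mem_regularFunctions (hX : IsRegularOn U X) (j : ℕ) :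
    (fun x => entry (X x) j) ∈ regularFunctions U := by
  unfold entry
  split_ifs
  exacts [isRegularOn_iff.1 hX _, const_mem_regularFunctions U 0]

theorem partialForm_mem_regularFunctions (hX : IsRegularOn U X) (k : ℕ) :
    (fun x => partialForm N (entry (X x)) k) ∈ regularFunctions U :=
  regularFunctions_sum _ fun _ _ => regularFunctions_mul (const_mem_regularFunctions U _)
    (regularFunctions_mul (entry_mem_regularFunctions hX _) (entry_mem_regularFunctions hX _))

theorem goodPoly_mem_regularFunctions (hX : IsRegularOn U X) :
    (fun x => goodPoly (X x)) ∈ regularFunctions U :=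
  regularFunctions_mul (regularFunctions_prod _ fun _ _ => entry_mem_regularFunctions hX _)
    (regularFunctions_prod _ fun _ _ => partialForm_mem_regularFunctions hX _)

theorem isRegularOn_pointOf (L : ℂ) (hX : IsRegularOn U X) (hg : ∀ x ∈ U, Good (X x)) :
    IsRegularOn U fun x => pointOf L (X x) := by
  have he := entry_mem_regularFunctions hX
  have hp := partialForm_mem_regularFunctions hX
  have h0 : ∀ j, j ≤ N → ∀ x ∈ U, entry (X x) j ≠ 0 := fun j hj x hx => (hg x hx).ne_zero hj
  have h1 : ∀ i, 1 ≤ i → i ≤ N → (fun x => entry (X x) (i - 1) / entry (X x) i)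
      ∈ regularFunctions U :=
    fun i _ hi => div_mem_regularFunctions (he _) (he _) (h0 i hi)
  refine isRegularOn_mkPoint h1 fun i hi hi' => ?_
  refine regularFunctions_mul ?_ (h1 i hi (by omega))
  unfold pointRatio
  split_ifs
  · exact div_mem_regularFunctions (regularFunctions_mul (const_mem_regularFunctions U L) (hp 1))
      (regularFunctions_pow (he 0) 2) fun x hx => pow_ne_zero _ (h0 0 (Nat.zero_le N) x hx)
  · exact regularFunctions_neg (div_mem_regularFunctions (hp _) (hp _) fun x hx =>
      ((good_iff _).1 (hg x hx)).2 _ (by omega) (by omega))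

theorem isRegularOn_comp_inl {α β : Type*} (V : Set (α ⊕ β → ℂ)) :
    IsRegularOn V fun p => p ∘ Sum.inl :=
  isRegularOn_iff.2 fun k => coord_mem_regularFunctions V (Sum.inl k)

theorem isRegularOn_comp_inr {α β : Type*} (V : Set (α ⊕ β → ℂ)) :
    IsRegularOn V fun p => p ∘ Sum.inr :=
  isRegularOn_iff.2 fun k => coord_mem_regularFunctions V (Sum.inr k)

variable {V : Set (Idx N ⊕ Idx N → ℂ)}

theorem isRegularOn_outVec_left (hV : V ⊆ prodSet (crystalB N L) (crystalB N K)) :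
    IsRegularOn V fun p => outVec L K (p ∘ Sum.inl) (p ∘ Sum.inr) :=
  isRegularOn_outVec (isRegularOn_comp_inl V) (fun _ hp => (hV hp).1) (isRegularOn_comp_inr V)
    fun _ hp => (hV hp).2

theorem isRegularOn_outVec_right (hN : 4 ≤ N)
    (hV : V ⊆ prodSet (crystalB N L) (crystalB N K)) :
    IsRegularOn V fun p => outVec K L (dag (p ∘ Sum.inr)) (dag (p ∘ Sum.inl)) :=
  isRegularOn_outVec (isRegularOn_dag (isRegularOn_comp_inr V) fun _ hp => (hV hp).2)
    (fun _ hp => dag_mem (hV hp).2 hN)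
    (isRegularOn_dag (isRegularOn_comp_inl V) fun _ hp => (hV hp).1)
    fun _ hp => dag_mem (hV hp).1 hN

theorem isZariskiOpenIn_goodSet (hN : 4 ≤ N) :
    IsZariskiOpenIn (prodSet (crystalB N L) (crystalB N K)) (goodSet N L K) := by
  have := (isZariskiOpenIn_ne_zero (goodPoly_mem_regularFunctions
    (isRegularOn_outVec_left (L := L) (K := K) (N := N) subset_rfl))).inter
    (isZariskiOpenIn_ne_zero (goodPoly_mem_regularFunctions
      (isRegularOn_outVec_right (L := L) (K := K) hN subset_rfl)))
  convert this using 1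
  ext p
  exact ⟨fun h => ⟨⟨h.1, h.2.1⟩, h.1, h.2.2⟩, fun h => ⟨h.1.1, h.1.2, h.2.2⟩⟩

theorem isRegularOn_rmap (hN : 4 ≤ N) (hK : K ≠ 0) :
    IsRegularOn (goodSet N L K) (rmap L K) := by
  have h1 := isRegularOn_pointOf L (isRegularOn_outVec_left (goodSet_subset (N := N) (L := L)
    (K := K))) fun p hp => hp.2.1
  have h2 := isRegularOn_dag (L := K) (isRegularOn_pointOf K (isRegularOn_outVec_right hN
    (goodSet_subset (N := N) (L := L) (K := K))) fun p hp => hp.2.2) fun p hp =>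
      pointOf_mem hN hK hp.2.2 (form_outVec (dag_mem hp.1.2 hN) (dag_mem hp.1.1 hN) hN)
  refine isRegularOn_iff.2 fun k => ?_
  rcases k with k | k
  · exact isRegularOn_iff.1 h2 k
  · exact isRegularOn_iff.1 h1 k

end RMapRegular

end FoldedR

namespace FoldedR

open Matrix

/-! ### Curves in the cone of isotropic vectors -/

section Curves

variable {N : ℕ} {L : ℂ}

theorem differentiable_goodPoly : Differentiable ℂ (goodPoly (N := N)) := by
  have h1 : ∀ j, Differentiable ℂ fun x : Fin (2 * N) → ℂ => entry x j := fun j => by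
    unfold entry
    split_ifs <;> fun_prop
  have h2 : ∀ k, Differentiable ℂ fun x : Fin (2 * N) → ℂ => partialForm N (entry x) k :=
    fun k => Differentiable.fun_sum fun j _ => ((h1 _).fun_mul (h1 _)).const_mul _
  have h3 : ∀ (s : Finset ℕ) {F : ℕ → (Fin (2 * N) → ℂ) → ℂ}, (∀ j, Differentiable ℂ (F j)) →
      Differentiable ℂ fun x => ∏ j ∈ s, F j x := by
    classical
    intro s F hF
    induction s using Finset.induction_on with
    | empty => simp
    | insert a s ha ih =>
      simp only [Finset.prod_insert ha]
      exact (hF a).fun_mul ih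
  exact (h3 _ h1).fun_mul (h3 _ fun k => h2 (k + 1))

theorem continuousAt_pointOf (L : ℂ) {x : Fin (2 * N) → ℂ} (hx : Good x) :
    ContinuousAt (pointOf L) x := by
  have hU : IsOpen {x : Fin (2 * N) → ℂ | Good x} :=
    isOpen_ne_fun differentiable_goodPoly.continuous continuous_const
  exact (isRegularOn_pointOf L (isRegularOn_id _) fun _ h => h).continuousOn.continuousAt
    (hU.mem_nhds hx)

/-- Goodness of ν(t) M is the nonvanishing of an entire function of t that is nonzero at 1; its
zeros cannot accumulate at 0. The points of the lines through ν(t) converge to l₀ as t → 0. -/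
theorem mem_closure_of_curve (hN : 4 ≤ N) {V : Submodule ℂ (Fin (2 * N) → ℂ)} {l₀ : Idx N → ℂ}
    (hl₀ : l₀ ∈ crystalB N L) (M : Matrix (Fin (2 * N)) (Fin (2 * N)) ℂ)
    {ν : ℂ → Fin (2 * N) → ℂ} (hν : Differentiable ℂ ν) {c : ℂ} (hc : c ≠ 0)
    (h0 : ν 0 = c • rowV l₀) (hV : ∀ t, ν t ∈ V) (hform : ∀ t, form (ν t) (ν t) = 0)
    (h1 : Good (ν 1 ᵥ* M)) :
    l₀ ∈ closure {l | l ∈ crystalB N L ∧ rowV l ∈ V ∧ Good (rowV l ᵥ* M)} := by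
  have hL := level_ne_zero hl₀
  have hd : Differentiable ℂ fun t => goodPoly (ν t ᵥ* M) :=
    differentiable_goodPoly.comp ((LinearMap.toContinuousLinearMap M.vecMulLinear).differentiable.comp hν)
  have hne : ∀ᶠ t in nhdsWithin (0 : ℂ) {0}ᶜ, Good (ν t ᵥ* M) := by
    have ha : AnalyticOnNhd ℂ (fun t => goodPoly (ν t ᵥ* M)) Set.univ :=
      fun t _ => hd.analyticAt t
    by_contra hcon
    have hfreq : ∃ᶠ t in nhdsWithin (0 : ℂ) {0}ᶜ, goodPoly (ν t ᵥ* M) = 0 := by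
      rw [Filter.not_eventually] at hcon
      exact hcon.mono fun t ht => not_not.1 ht
    exact h1 (ha.eqOn_zero_of_preconnected_of_frequently_eq_zero isPreconnected_univ
      (Set.mem_univ 0) hfreq (Set.mem_univ 1))
  have hg0 : Good (ν 0) := by
    rw [h0, good_smul hc]
    exact good_rowV hl₀ hN
  have hgood : ∀ᶠ t in nhds (0 : ℂ), Good (ν t) :=
    (differentiable_goodPoly.continuous.comp hν.continuous).continuousAt.eventually_ne hg0
  have hlim : Filter.Tendsto (fun t => pointOf L (ν t)) (nhdsWithin (0 : ℂ) {0}ᶜ) (nhds l₀) := by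
    have := (ContinuousAt.comp (g := pointOf L) (continuousAt_pointOf L hg0)
      hν.continuous.continuousAt).tendsto
    rw [Function.comp_apply, h0, pointOf_smul L hc, pointOf_rowV hl₀ hN] at this
    exact this.mono_left nhdsWithin_le_nhds
  refine mem_closure_of_tendsto hlim ?_
  filter_upwards [hne, nhdsWithin_le_nhds hgood] with t ht hgt
  refine ⟨pointOf_mem hN hL hgt (hform t), ?_⟩
  rw [rowV_pointOf hN hL hgt (hform t), smul_vecMul,
    good_smul (div_ne_zero hL (hgt.ne_zero (Nat.zero_le N)))]
  exact ⟨V.smul_mem _ (hV t), ht⟩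

/-- If v(l₀) and b are orthogonal, the segment between them is isotropic. Otherwise a vector x
orthogonal to both, but not isotropic, spans with them a plane conic of isotropic lines through
both. -/
theorem mem_closure_good (hN : 4 ≤ N) {V : Submodule ℂ (Fin (2 * N) → ℂ)} {l₀ : Idx N → ℂ}
    (hl₀ : l₀ ∈ crystalB N L) (ha : rowV l₀ ∈ V) (M : Matrix (Fin (2 * N)) (Fin (2 * N)) ℂ)
    {b : Fin (2 * N) → ℂ} (hb : b ∈ V) (hbb : form b b = 0) (hg : Good (b ᵥ* M))
    (hx : form (rowV l₀) b = 0 ∨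
      ∃ x ∈ V, form (rowV l₀) x = 0 ∧ form b x = 0 ∧ form x x ≠ 0) :
    l₀ ∈ closure {l | l ∈ crystalB N L ∧ rowV l ∈ V ∧ Good (rowV l ᵥ* M)} := by
  have haa := form_rowV_self hl₀ hN
  by_cases hab : form (rowV l₀) b = 0
  · refine mem_closure_of_curve hN hl₀ M (ν := fun t => (1 - t) • rowV l₀ + t • b)
      (by fun_prop) one_ne_zero (by simp) (fun t => V.add_mem (V.smul_mem _ ha) (V.smul_mem _ hb))
      (fun t => ?_) (by simpa using hg)
    simp only [form_add_left, form_add_right, form_smul_left, form_smul_right, haa, hab, hbb,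
      form_comm b]
    ring
  · obtain ⟨x, hxV, hax, hbx, hxx⟩ := hx.resolve_left hab
    -- The coefficients balance the cross term of v(l₀) with b against the square of the x-term. At
    -- t = 0 only v(l₀) remains, at t = 1 only b.
    refine mem_closure_of_curve hN hl₀ M (c := 2 * form (rowV l₀) b)
      (ν := fun t => (2 * form (rowV l₀) b * (1 - t) ^ 2) • rowV l₀
        + (2 * form (rowV l₀) b * t * (1 - t)) • x + (-(t ^ 2 * form x x)) • b)
      (by fun_prop) (mul_ne_zero two_ne_zero hab) (by simp) (fun t => V.add_mem
        (V.add_mem (V.smul_mem _ ha) (V.smul_mem _ hxV)) (V.smul_mem _ hb)) (fun t => ?_) ?_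
    · simp only [form_add_left, form_add_right, form_smul_left, form_smul_right, haa, hbb, hax,
        hbx, form_comm b (rowV l₀), form_comm x (rowV l₀), form_comm x b]
      ring
    · have : (-((1 : ℂ) ^ 2 * form x x)) ≠ 0 := by simpa using hxx
      simp only [sub_self, ne_eq, OfNat.ofNat_ne_zero, not_false_eq_true, zero_pow, mul_zero,
        zero_smul, zero_add, smul_vecMul]
      exact (good_smul this).2 hg

/-- Two vectors of a nondegenerate subspace which contains two suitable unit vectors have a common
orthogonal vector which is not isotropic, unless they are orthogonal. -/
theorem exists_orthogonal_of_nondegenerate {V : Submodule ℂ (Fin (2 * N) → ℂ)}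
    {a b : Fin (2 * N) → ℂ} (ha : a ∈ V) (hb : b ∈ V) (haa : form a a = 0) (hbb : form b b = 0)
    (hV : ∀ x ∈ V, (∀ y ∈ V, form x y = 0) → x = 0) {e f : Fin (2 * N) → ℂ} (he : e ∈ V)
    (hf : f ∈ V) (hee : form e e = 0) (hff : form f f = 0) (hef : form e f = 0)
    (hli : ∀ r s : ℂ, r • e + s • f = 0 → r = 0 ∧ s = 0) :
    form a b = 0 ∨ ∃ x ∈ V, form a x = 0 ∧ form b x = 0 ∧ form x x ≠ 0 := by
  by_cases hab : form a b = 0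
  · exact Or.inl hab
  refine Or.inr ?_
  by_contra! hcon
  -- If every vector of V orthogonal to a and b were isotropic, such vectors would be pairwise
  -- orthogonal by polarization, hence in the radical. Then V would be the hyperbolic plane spanned
  -- by a and b.
  have proj : ∀ y ∈ V, y = (form b y / form a b) • a + (form a y / form a b) • b := by
    have hperp : ∀ y, form a (y - ((form b y / form a b) • a + (form a y / form a b) • b)) = 0 ∧
        form b (y - ((form b y / form a b) • a + (form a y / form a b) • b)) = 0 := by
      intro y
      rw [sub_eq_add_neg, ← neg_one_smul ℂ (_ + _)]
      simp only [form_add_right, form_smul_right, haa, hbb, form_comm b a]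
      constructor <;> field_simp <;> ring
    have hmem : ∀ y ∈ V, y - ((form b y / form a b) • a + (form a y / form a b) • b) ∈ V :=
      fun y hy => V.sub_mem hy (V.add_mem (V.smul_mem _ ha) (V.smul_mem _ hb))
    intro y hy
    refine sub_eq_zero.1 (hV _ (hmem y hy) fun z hz => ?_)
    set w := y - ((form b y / form a b) • a + (form a y / form a b) • b) with hw
    set w' := z - ((form b z / form a b) • a + (form a z / form a b) • b) with hw'
    have hwa : form a w = 0 ∧ form b w = 0 := hperp y
    have hwa' : form a w' = 0 ∧ form b w' = 0 := hperp z
    have hz' : z = w' + ((form b z / form a b) • a + (form a z / form a b) • b) := by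
      rw [hw', sub_add_cancel]
    have h1 := hcon w (hmem y hy) hwa.1 hwa.2
    have h2 := hcon w' (hmem z hz) hwa'.1 hwa'.2
    have h3 := hcon (w + w') (V.add_mem (hmem y hy) (hmem z hz))
      (by rw [form_add_right, hwa.1, hwa'.1, add_zero])
      (by rw [form_add_right, hwa.2, hwa'.2, add_zero])
    have h4 : form w w' = 0 := by
      simp only [form_add_left, form_add_right, h1, h2, form_comm w' w] at h3
      simpa using h3
    rw [hz', form_add_right, h4, form_add_right, form_smul_right, form_smul_right, form_comm w a,
      form_comm w b, hwa.1, hwa.2]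
    ring
  have he' := proj e he
  have hf' := proj f hf
  set p := form b e / form a b
  set q := form a e / form a b
  set r := form b f / form a b
  set s := form a f / form a b
  have h1 : p * q = 0 := by
    rw [he'] at hee
    simp only [form_add_left, form_add_right, form_smul_left, form_smul_right, haa, hbb,
      form_comm b a] at hee
    have : p * q * (2 * form a b) = 0 := by linear_combination hee
    exact (mul_eq_zero.1 this).resolve_right (mul_ne_zero two_ne_zero hab)
  have h2 : r * s = 0 := by
    rw [hf'] at hff
    simp only [form_add_left, form_add_right, form_smul_left, form_smul_right, haa, hbb,
      form_comm b a] at hff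
    have : r * s * (2 * form a b) = 0 := by linear_combination hff
    exact (mul_eq_zero.1 this).resolve_right (mul_ne_zero two_ne_zero hab)
  have h3 : p * s + q * r = 0 := by
    rw [he', hf'] at hef
    simp only [form_add_left, form_add_right, form_smul_left, form_smul_right, haa, hbb,
      form_comm b a] at hef
    have : (p * s + q * r) * form a b = 0 := by linear_combination hef
    exact (mul_eq_zero.1 this).resolve_right hab
  have hk1 := hli r (-p) (by
    rw [he', hf', smul_add, smul_add, smul_smul, smul_smul, smul_smul, smul_smul]
    have e1 : r * q + -p * s = 0 ∧ r * p + -p * r = 0 := by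
      refine ⟨?_, by ring⟩
      rcases mul_eq_zero.1 h1 with h | h
      · simp only [h] at h3 ⊢
        linear_combination h3
      · simp only [h] at h3 ⊢
        linear_combination -h3
    have : (r * p) • a + (r * q) • b + ((-p * r) • a + (-p * s) • b)
        = (r * p + -p * r) • a + (r * q + -p * s) • b := by
      rw [add_smul, add_smul]
      abel
    rw [this, e1.1, e1.2, zero_smul, zero_smul, add_zero])
  have hk2 := hli s (-q) (by
    rw [he', hf', smul_add, smul_add, smul_smul, smul_smul, smul_smul, smul_smul]
    have hp0 : p = 0 := by linear_combination -hk1.2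
    have : (s * p) • a + (s * q) • b + ((-q * r) • a + (-q * s) • b)
        = (s * p + -q * r) • a + (s * q + -q * s) • b := by
      rw [add_smul, add_smul]
      abel
    rw [this, hp0, hk1.1, show s * 0 + -q * 0 = 0 by ring, show s * q + -q * s = 0 by ring,
      zero_smul, zero_smul, add_zero])
  have := hli 1 0 (by
    rw [he', show p = 0 by linear_combination -hk1.2, show q = 0 by linear_combination -hk2.2]
    simp)
  exact one_ne_zero this.1

end Curves

end FoldedR

namespace FoldedR

open Matrix

/-! ### The folding operators on vectors -/

section FoldOp

variable {N : ℕ} {L K : ℂ} {l m : Idx N → ℂ}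

/-- The permutations of the indices underlying `Σ₀`, `Σ₁`, `Σ₂` and `Σ₂ Σ₁ Σ₀`. -/
def foldPerm (N : ℕ) : Fin 4 → ℕ → ℕ
  | 0, j => if j = 0 then 2 * N - 1 else if j = 2 * N - 1 then 0 else j
  | 1, j => if j = N - 1 then N else if j = N then N - 1 else j
  | 2, j => if j < N then j + N else j - N
  | 3, j => if j = 0 then N - 1 else if j = N - 1 then 0 else if j = N then 2 * N - 1
      else if j = 2 * N - 1 then N else if j < N then j + N else j - N

/-- The exponents of the level in the operators underlying `Σ₀`, `Σ₁`, `Σ₂` and `Σ₂ Σ₁ Σ₀`. -/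
def foldExp (N : ℕ) : Fin 4 → ℕ → ℤ
  | 0, j => if j = 0 then -1 else if j = 2 * N - 1 then 1 else 0
  | 1, _ => 0
  | 2, j => if j < N then 0 else 1
  | 3, j => if j = N then 0 else if j = N - 1 then 1 else if j < N then 0 else 1

/-- The square of the folding operator is the power of the level with the negative of this
exponent. -/
def foldScale : Fin 4 → ℤ
  | 0 => 0
  | 1 => 0
  | 2 => 1
  | 3 => 1

/-! ### Combinatorics of the index permutations and the exponents -/

section Combinatorics

variable (hN : 4 ≤ N) (s : Fin 4) {i j : ℕ} (hi : i < 2 * N) (hj : j < 2 * N)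
include hN hi

theorem foldPerm_lt : foldPerm N s i < 2 * N := by
  fin_cases s <;> simp only [foldPerm] <;> split_ifs <;> omega

theorem foldPerm_foldPerm : foldPerm N s (foldPerm N s i) = i := by
  fin_cases s <;> simp only [foldPerm] <;> split_ifs <;> omega

theorem foldPerm_rev : foldPerm N s (2 * N - 1 - i) = 2 * N - 1 - foldPerm N s i := by
  fin_cases s <;> simp only [foldPerm] <;> split_ifs <;> omega

theorem foldExp_add_rev : foldExp N s i + foldExp N s (2 * N - 1 - i) = foldScale s := by
  fin_cases s <;> simp only [foldExp, foldScale] <;> (try split_ifs) <;> omega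

theorem foldExp_add_foldPerm : foldExp N s i + foldExp N s (foldPerm N s i) = foldScale s := by
  fin_cases s <;> simp only [foldExp, foldPerm, foldScale] <;> (try split_ifs) <;> omega

include hj

/-- The permutation changes whether (i, j) lies above the diagonal exactly as the exponents
prescribe. This fails only at the corner pairs, which `evalM_corner` treats separately. -/
theorem foldPerm_lt_foldPerm (hij : ¬ (i + j = 2 * N - 1 ∧ (i = 0 ∨ i = N - 1 ∨ i = N ∨
    i = 2 * N - 1))) :
    (if foldPerm N s i < foldPerm N s j then (1 : ℤ) else 0)
      = foldExp N s i - foldExp N s j + if i < j then 1 else 0 := by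
  fin_cases s <;> simp only [foldExp, foldPerm] <;> split_ifs <;> omega

end Combinatorics


/-- The pairs of indices at which the M-matrices do not have the generic form. -/
def IsCorner (N i j : ℕ) : Prop :=
  i + j = 2 * N - 1 ∧ (i = 0 ∨ i = N - 1 ∨ i = N ∨ i = 2 * N - 1)

theorem corr_foldPerm (hN : 4 ≤ N) (s : Fin 4) {i j : ℕ} (hi : i < 2 * N) (hj : j < 2 * N)
    (hij : ¬ IsCorner N i j) (z : ℂ) :
    corr N z (foldPerm N s i) (foldPerm N s j) = corr N z i j := by
  unfold IsCorner at hij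
  have hp : foldPerm N s i = foldPerm N s j ↔ i = j :=
    ⟨fun h => by rw [← foldPerm_foldPerm hN s hi, h, foldPerm_foldPerm hN s hj], fun h => h ▸ rfl⟩
  have h1 : (foldPerm N s i = 0 ∨ foldPerm N s i = N - 1 ∨ foldPerm N s i = N ∨
      foldPerm N s i = 2 * N - 1) ↔ (i = 0 ∨ i = N - 1 ∨ i = N ∨ i = 2 * N - 1) := by
    fin_cases s <;> simp only [foldPerm] <;> split_ifs <;> omega
  have h2 : foldPerm N s i + foldPerm N s j = 2 * N - 1 ↔ i + j = 2 * N - 1 := by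
    have := foldPerm_rev hN s hi
    have := foldPerm_lt hN s hi
    have := foldPerm_lt hN s hj
    constructor
    · intro h
      have h3 : foldPerm N s j = foldPerm N s (2 * N - 1 - i) := by omega
      have h4 := congrArg (foldPerm N s) h3
      rw [foldPerm_foldPerm hN s hj, foldPerm_foldPerm hN s (by omega)] at h4
      omega
    · intro h
      rw [show j = 2 * N - 1 - i by omega]
      omega
  unfold corr
  by_cases h : i = j
  · rw [if_pos h, if_pos (hp.2 h)]
    exact if_congr h1 rfl rfl
  · rw [if_neg h, if_neg (mt hp.1 h), if_neg, if_neg, if_neg, if_neg] <;> omega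

theorem foldExp_corner (hN : 4 ≤ N) (s : Fin 4) {i : ℕ}
    (hi : i = 0 ∨ i = N - 1 ∨ i = N ∨ i = 2 * N - 1) :
    (if foldPerm N s i = 0 then (2 : ℤ) else if foldPerm N s i = 2 * N - 1 then 0 else 1)
      = foldExp N s i - foldExp N s (2 * N - 1 - i)
        + if i = 0 then 2 else if i = 2 * N - 1 then 0 else 1 := by
  fin_cases s <;> simp only [foldExp, foldPerm] <;> split_ifs <;> omega

theorem foldPerm_corner (hN : 4 ≤ N) (s : Fin 4) {i : ℕ}
    (hi : i = 0 ∨ i = N - 1 ∨ i = N ∨ i = 2 * N - 1) : foldPerm N s i = 0 ∨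
    foldPerm N s i = N - 1 ∨ foldPerm N s i = N ∨ foldPerm N s i = 2 * N - 1 := by
  fin_cases s <;> simp only [foldPerm] <;> split_ifs <;> omega

/-- At the corner pairs the rank one term and the correction combine into a monomial in z that
depends on l only through the level. -/
theorem evalM_corner (hl : l ∈ crystalB N L) (hN : 4 ≤ N) {z : ℂ} (hz : z ≠ 0)
    {i j : Fin (2 * N)} (hij : IsCorner N i j) :
    evalM L l z i j = L * z ^ (if (i : ℕ) = 0 then (2 : ℤ)
      else if (i : ℕ) = 2 * N - 1 then 0 else 1) := by
  have hL := level_ne_zero hl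
  obtain ⟨h1, h2⟩ := hij
  rw [evalM_apply hl hN]
  unfold colV rowV corr
  rcases h2 with h | h | h | h
  · have hj : (j : ℕ) = 2 * N - 1 := by omega
    rw [h, hj, if_pos (by omega), if_neg (by omega), if_neg (by omega), if_pos (by omega),
      if_pos rfl, colVec_zero_mul_rowVec_last hl hN]
    field_simp
    ring
  · have hj : (j : ℕ) = N := by omega
    rw [h, hj, if_pos (by omega), if_neg (by omega), if_neg (by omega), if_neg (by omega),
      if_neg (by omega), if_neg (by omega), colVec_pred hl hN, rowVec_mid hl hN,
      coProd_mul_cobarProd hl, zpow_one]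
    field_simp
    ring
  · have hj : (j : ℕ) = N - 1 := by omega
    have := coProd_ne_zero hl (N - 1)
    rw [h, hj, if_neg (by omega), if_neg (by omega), if_pos (by omega), if_neg (by omega),
      if_neg (by omega), colVec_mid hl hN, rowVec_of_lt hl hN (by omega), zpow_one]
    field_simp
    ring
  · have hj : (j : ℕ) = 0 := by omega
    rw [h, hj, if_neg (by omega), if_neg (by omega), if_neg (by omega), if_neg (by omega),
      if_neg (by omega), if_pos rfl, colVec_last hl hN, rowVec_zero hl hN, zpow_zero]
    field_simp
    ring

/-- The operator on vectors which corresponds to a folding involution. -/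
def foldOp (s : Fin 4) (L : ℂ) (x : Fin (2 * N) → ℂ) : Fin (2 * N) → ℂ :=
  fun j => L⁻¹ ^ foldExp N s j * entry x (foldPerm N s j)

theorem entry_foldOp (s : Fin 4) (L : ℂ) (x : Fin (2 * N) → ℂ) {j : ℕ} (hj : j < 2 * N) :
    entry (foldOp s L x) j = L⁻¹ ^ foldExp N s j * entry x (foldPerm N s j) :=
  entry_of_lt _ hj

theorem entry_add (x y : Fin (2 * N) → ℂ) (j : ℕ) : entry (x + y) j = entry x j + entry y j := by
  unfold entry
  split_ifs
  · rfl
  · rw [add_zero]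

theorem foldOp_add (s : Fin 4) (L : ℂ) (x y : Fin (2 * N) → ℂ) :
    foldOp s L (x + y) = foldOp s L x + foldOp s L y := by
  funext j
  rw [foldOp, entry_add, mul_add]
  rfl

theorem foldOp_smul (s : Fin 4) (L c : ℂ) (x : Fin (2 * N) → ℂ) :
    foldOp s L (c • x) = c • foldOp s L x := by
  funext j
  rw [foldOp, entry_smul, mul_left_comm]
  rfl

theorem foldOp_zero (s : Fin 4) (L : ℂ) : foldOp s L (0 : Fin (2 * N) → ℂ) = 0 := by
  have := foldOp_smul s L 0 (0 : Fin (2 * N) → ℂ)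
  rwa [zero_smul, zero_smul] at this

theorem foldOp_foldOp (hN : 4 ≤ N) (hL : L ≠ 0) (s : Fin 4) (x : Fin (2 * N) → ℂ) :
    foldOp s L (foldOp s L x) = L⁻¹ ^ foldScale s • x := by
  funext j
  rw [foldOp, entry_foldOp s L x (foldPerm_lt hN s j.2), foldPerm_foldPerm hN s j.2, ← mul_assoc,
    ← zpow_add₀ (inv_ne_zero hL), foldExp_add_foldPerm hN s j.2, entry_of_lt x j.2]
  rfl

theorem sq_eq_of_foldOp_eq (hN : 4 ≤ N) (hL : L ≠ 0) {s : Fin 4} {x : Fin (2 * N) → ℂ}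
    (hx : x ≠ 0) {c : ℂ} (h : foldOp s L x = c • x) : c ^ 2 = L⁻¹ ^ foldScale s := by
  have h2 := foldOp_foldOp hN hL s x
  rw [h, foldOp_smul, h, smul_smul, ← sub_eq_zero, ← sub_smul] at h2
  have := (smul_eq_zero.1 h2).resolve_right hx
  linear_combination this

/-- The index permutation as a permutation of `Fin (2 * N)`. -/
def foldEquiv (hN : 4 ≤ N) (s : Fin 4) : Equiv.Perm (Fin (2 * N)) :=
  Function.Involutive.toPerm (fun j => ⟨foldPerm N s j, foldPerm_lt hN s j.2⟩)
    fun j => Fin.ext (foldPerm_foldPerm hN s j.2)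

theorem foldOp_apply (hN : 4 ≤ N) (s : Fin 4) (L : ℂ) (x : Fin (2 * N) → ℂ) (j : Fin (2 * N)) :
    foldOp s L x j = L⁻¹ ^ foldExp N s j * x (foldEquiv hN s j) := by
  rw [foldOp, entry_of_lt x (foldPerm_lt hN s j.2)]
  rfl

theorem foldEquiv_foldEquiv (hN : 4 ≤ N) (s : Fin 4) (j : Fin (2 * N)) :
    foldEquiv hN s (foldEquiv hN s j) = j :=
  Fin.ext (foldPerm_foldPerm hN s j.2)

theorem foldEquiv_rev (hN : 4 ≤ N) (s : Fin 4) (j : Fin (2 * N)) :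
    foldEquiv hN s j.rev = (foldEquiv hN s j).rev := by
  have h1 := foldPerm_rev hN s j.2
  have h2 : ((foldEquiv hN s j : Fin (2 * N)) : ℕ) = foldPerm N s j := rfl
  have h3 : ((foldEquiv hN s j.rev : Fin (2 * N)) : ℕ) = foldPerm N s j.rev := rfl
  refine Fin.ext ?_
  rw [Fin.val_rev, h2, h3, Fin.val_rev, show 2 * N - ((j : ℕ) + 1) = 2 * N - 1 - j by omega, h1]
  omega

/-- The folding operators are similitudes of the form. For ε = -1 and multiplier nonzero this makes
eigenspaces of square equal to the scale factor totally isotropic. -/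
theorem form_foldOp (hN : 4 ≤ N) (hL : L ≠ 0) (s : Fin 4) {ε : ℂ}
    (hε : ∀ j, j < 2 * N → sgn N (foldPerm N s j) = ε * sgn N j) (x y : Fin (2 * N) → ℂ) :
    form (foldOp s L x) (foldOp s L y) = ε * L⁻¹ ^ foldScale s * form x y := by
  unfold form
  rw [← Equiv.sum_comp (foldEquiv hN s), Finset.mul_sum]
  refine Finset.sum_congr rfl fun j _ => ?_
  rw [foldOp_apply hN, foldOp_apply hN, ← foldEquiv_rev, foldEquiv_foldEquiv, foldEquiv_foldEquiv]
  have h1 : sgn N (foldEquiv hN s j : Fin (2 * N)) = ε * sgn N j := hε j j.2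
  have h2 := foldExp_add_rev hN s (foldPerm_lt hN s j.2)
  rw [← foldPerm_rev hN s j.2] at h2
  have h3 : ((foldEquiv hN s j.rev : Fin (2 * N)) : ℕ) = foldPerm N s (2 * N - 1 - j) := by
    rw [show ((foldEquiv hN s j.rev : Fin (2 * N)) : ℕ) = foldPerm N s j.rev from rfl, Fin.val_rev,
      show 2 * N - ((j : ℕ) + 1) = 2 * N - 1 - j by omega]
  have h4 : ((foldEquiv hN s j : Fin (2 * N)) : ℕ) = foldPerm N s j := rfl
  rw [h1, h3, h4, ← h2, zpow_add₀ (inv_ne_zero hL)]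
  ring

theorem sgn_foldPerm_zero (hN : 4 ≤ N) {s : Fin 4} (hs : s = 0 ∨ s = 1) {j : ℕ}
    (hj : j < 2 * N) : sgn N (foldPerm N s j) = 1 * sgn N j := by
  rw [one_mul]
  unfold sgn
  congr 1
  rcases hs with rfl | rfl <;> simp only [foldPerm] <;> split_ifs <;> omega

/-- The permutation sends the distance d of an index from the nearer end to N - 1 - d, and N - 1 is
odd. -/
theorem sgn_foldPerm_two (hN : 4 ≤ N) (hev : Even N) {s : Fin 4} (hs : s = 2 ∨ s = 3) {j : ℕ}
    (hj : j < 2 * N) : sgn N (foldPerm N s j) = -1 * sgn N j := by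
  obtain ⟨n, hn⟩ := hev
  unfold sgn
  have key : min (foldPerm N s j) (2 * N - 1 - foldPerm N s j)
      = N - 1 - min j (2 * N - 1 - j) := by
    rcases hs with rfl | rfl <;> simp only [foldPerm] <;> split_ifs <;> omega
  rw [key]
  have e : (-1 : ℂ) ^ (N - 1 - min j (2 * N - 1 - j)) * (-1) ^ min j (2 * N - 1 - j) = -1 := by
    rw [← pow_add, show N - 1 - min j (2 * N - 1 - j) + min j (2 * N - 1 - j) = 2 * (n - 1) + 1 by
      omega, pow_succ, pow_mul]
    simp
  have e' : (-1 : ℂ) ^ min j (2 * N - 1 - j) * (-1) ^ min j (2 * N - 1 - j) = 1 := by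
    rw [← mul_pow]
    simp
  linear_combination ((-1 : ℂ) ^ min j (2 * N - 1 - j)) * e
    - (-1 : ℂ) ^ (N - 1 - min j (2 * N - 1 - j)) * e'

/-- Commutation of the folding operators with the M-matrix of a folded point. -/
theorem foldExp_mul_evalM (hm : m ∈ crystalB N K) (hN : 4 ≤ N) {s : Fin 4} {c : ℂ}
    (hc : foldOp s K (rowV m) = c • rowV m)
    (hc' : foldOp s K (rowV (dag m)) = c • rowV (dag m)) {z : ℂ} (hz : z ≠ 0)
    (i j : Fin (2 * N)) :
    z ^ foldExp N s i * evalM K m z i j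
      = z ^ foldExp N s j * evalM K m z (foldEquiv hN s i) (foldEquiv hN s j) := by
  have hK := level_ne_zero hm
  have hi : ((foldEquiv hN s i : Fin (2 * N)) : ℕ) = foldPerm N s i := rfl
  have hj : ((foldEquiv hN s j : Fin (2 * N)) : ℕ) = foldPerm N s j := rfl
  by_cases hij : IsCorner N i j
  · have hρ : IsCorner N (foldEquiv hN s i : Fin (2 * N)) (foldEquiv hN s j : Fin (2 * N)) := by
      have h1 := foldPerm_rev hN s i.2
      have h2 := foldPerm_lt hN s i.2
      have h3 := hij.1
      refine ⟨?_, foldPerm_corner hN s hij.2⟩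
      rw [hi, hj, show (j : ℕ) = 2 * N - 1 - i by omega]
      omega
    rw [evalM_corner hm hN hz hij, evalM_corner hm hN hz hρ, hi, foldExp_corner hN s hij.2,
      show 2 * N - 1 - (i : ℕ) = j by have := hij.1; omega, zpow_add₀ hz, zpow_sub₀ hz]
    have := zpow_ne_zero (foldExp N s j) hz
    field_simp
  have hv : ∀ j, rowV m (foldEquiv hN s j) = c * K ^ foldExp N s j * rowV m j := fun j => by
    have := congrFun hc j
    have h0 := zpow_ne_zero (foldExp N s j) hK
    rw [foldOp_apply hN, _root_.inv_zpow, Pi.smul_apply, smul_eq_mul, inv_mul_eq_iff_eq_mul₀ h0] at this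
    rw [this]
    ring
  -- The eigenvector equation for `dag m`, read backwards, is the one for u.
  have hu : ∀ j, colV m (foldEquiv hN s j) = c * K ^ foldExp N s j.rev * colV m j := fun j => by
    have := congrFun hc' j.rev
    have h0 := zpow_ne_zero (foldExp N s j.rev) hK
    rw [foldOp_apply hN, _root_.inv_zpow, Pi.smul_apply, smul_eq_mul, inv_mul_eq_iff_eq_mul₀ h0,
      ← colV_rev hm hN, foldEquiv_rev, Fin.rev_rev, ← colV_rev hm hN, Fin.rev_rev] at this
    rw [this]
    ring
  have hc2 := sq_eq_of_foldOp_eq hN hK (rowV_ne_zero hm hN) hc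
  have he := foldExp_add_rev hN s i.2
  rw [show 2 * N - 1 - (i : ℕ) = i.rev by rw [Fin.val_rev]; omega] at he
  -- The two factors c contribute c², a power of K by the square of the operator; mirrored exponents
  -- add up to the same scale and only a difference of exponents survives.
  have huv : colV m (foldEquiv hN s i) * rowV m (foldEquiv hN s j)
      = K ^ (foldExp N s j - foldExp N s i) * (colV m i * rowV m j) := by
    rw [hu, hv, show c * K ^ foldExp N s i.rev * colV m i * (c * K ^ foldExp N s j * rowV m j)
      = c ^ 2 * (K ^ foldExp N s i.rev * K ^ foldExp N s j) * (colV m i * rowV m j) by ring, hc2,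
      ← he, _root_.inv_zpow, ← _root_.zpow_neg, ← zpow_add₀ hK, ← zpow_add₀ hK]
    congr 2
    ring
  have hcomb := foldPerm_lt_foldPerm hN s i.2 j.2 hij
  have hθ : ∀ (P : Prop) [Decidable P], (if P then K * z else 1) = (K * z) ^ (if P then (1 : ℤ) else 0) :=
    fun P _ => by split_ifs <;> simp
  rw [evalM_apply hm hN, evalM_apply hm hN, huv, hi, hj, corr_foldPerm hN s i.2 j.2 hij, hθ, hθ,
    hcomb]
  have hcorr : z ^ foldExp N s i * corr N z i j = z ^ foldExp N s j * corr N z i j := by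
    by_cases h : i = j
    · rw [h]
    · unfold IsCorner at hij
      rw [corr, if_neg (fun h' => h (Fin.ext h')), if_neg (by omega), if_neg (by omega), mul_zero,
        mul_zero]
  have hz1 := zpow_ne_zero (foldExp N s j) hz
  have hK1 := zpow_ne_zero (foldExp N s j) hK
  have hK2 := zpow_ne_zero (foldExp N s i) hK
  rw [zpow_add₀ (mul_ne_zero hK hz), zpow_sub₀ (mul_ne_zero hK hz), zpow_sub₀ hK,
    mul_zpow _ _ (foldExp N s i), mul_zpow _ _ (foldExp N s j), mul_sub, mul_sub,
    mul_left_comm _ (1 - K * z), mul_left_comm _ (1 - K * z), hcorr]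
  congr 1
  field_simp

/-- At z = 1/L the powers of z in `foldExp_mul_evalM` are those occurring in the operator of level
L. Hence the operator of level L, not of level K, commutes with this matrix of level K. -/
theorem foldOp_vecMul (hm : m ∈ crystalB N K) (hN : 4 ≤ N) (hL : L ≠ 0) {s : Fin 4} {c : ℂ}
    (hc : foldOp s K (rowV m) = c • rowV m)
    (hc' : foldOp s K (rowV (dag m)) = c • rowV (dag m)) (x : Fin (2 * N) → ℂ) :
    foldOp s L (x ᵥ* evalM K m L⁻¹) = foldOp s L x ᵥ* evalM K m L⁻¹ := by
  funext j
  rw [foldOp_apply hN, vecMul, vecMul, dotProduct, dotProduct, ← Equiv.sum_comp (foldEquiv hN s),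
    Finset.mul_sum]
  refine Finset.sum_congr rfl fun i _ => ?_
  rw [foldOp_apply hN]
  linear_combination (-(x (foldEquiv hN s i))) *
    foldExp_mul_evalM hm hN hc hc' (inv_ne_zero hL) i j

end FoldOp

end FoldedR

namespace FoldedR

open Matrix

/-! ### The folding operators and the points of the crystal -/

section FoldPoints

variable {N : ℕ} {L K : ℂ} {l m : Idx N → ℂ}

theorem foldOp_rowV_eq_iff (hN : 4 ≤ N) (s : Fin 4) (c : ℂ) :
    foldOp s L (rowV l) = c • rowV l ↔
      ∀ j, j < 2 * N → L⁻¹ ^ foldExp N s j * rowVec l (foldPerm N s j) = c * rowVec l j := by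
  rw [funext_iff, Fin.forall_iff]
  refine forall₂_congr fun j hj => ?_
  rw [foldOp, entry_rowV l (foldPerm_lt hN s hj)]
  rfl

/-- The index 1 is fixed by the permutation, which forces the eigenvalue 1; what remains is v_{2N-1}
= 1. -/
theorem exists_foldOp_zero_iff (hl : l ∈ crystalB N L) (hN : 4 ≤ N) :
    (∃ c : ℂ, foldOp 0 L (rowV l) = c • rowV l) ↔ co l 1 = cobar l 1 := by
  have hL := level_ne_zero hl
  have h1 := co_ne_zero hl 1
  constructor
  · rintro ⟨c, hc⟩
    rw [foldOp_rowV_eq_iff hN] at hc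
    have hc1 := hc 1 (by omega)
    have hc0 := hc 0 (by omega)
    have hv : rowVec l 1 ≠ 0 := by
      rw [rowVec_of_lt hl hN (by omega)]
      exact div_ne_zero hL (coProd_ne_zero hl _)
    simp only [foldExp, foldPerm] at hc1 hc0
    rw [if_neg (by omega), if_neg (by omega), if_neg (by omega), if_neg (by omega), zpow_zero] at hc1
    rw [← mul_right_cancel₀ hv hc1, if_pos trivial, if_pos trivial,
      rowVec_last l hN, rowVec_zero hl hN] at hc0
    simp only [Int.reduceNeg, _root_.zpow_neg, zpow_one, inv_inv, one_mul] at hc0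
    field_simp at hc0
    exact hc0.symm
  · intro h
    refine ⟨1, (foldOp_rowV_eq_iff hN 0 1).2 fun j _ => ?_⟩
    have hv : rowVec l (2 * N - 1) = 1 := by rw [rowVec_last l hN, ← h, div_self h1]
    simp only [foldExp, foldPerm]
    split_ifs with h1 h2
    · rw [h1, rowVec_zero hl hN, hv]
      simp
    · rw [h2, rowVec_zero hl hN, hv]
      simp [hL]
    · simp

theorem exists_foldOp_one_iff (hl : l ∈ crystalB N L) (hN : 4 ≤ N) :
    (∃ c : ℂ, foldOp 1 L (rowV l) = c • rowV l) ↔ co l N = 1 := by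
  have hL := level_ne_zero hl
  have hQ := cobarProd_ne_zero hl (N - 1)
  constructor
  · rintro ⟨c, hc⟩
    rw [foldOp_rowV_eq_iff hN] at hc
    have hc1 := hc 0 (by omega)
    have hc0 := hc (N - 1) (by omega)
    simp only [foldExp, foldPerm, zpow_zero, one_mul] at hc1 hc0
    rw [if_neg (by omega), if_neg (by omega), rowVec_zero hl hN] at hc1
    have hc' : c = 1 := mul_right_cancel₀ hL (by rw [← hc1, one_mul])
    rw [if_pos trivial, hc', rowVec_mid hl hN, rowVec_pred hl hN, one_mul] at hc0
    exact mul_left_cancel₀ hQ (by rw [← hc0, mul_one])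
  · intro h
    refine ⟨1, (foldOp_rowV_eq_iff hN 1 1).2 fun j _ => ?_⟩
    have hv : rowVec l (N - 1) = rowVec l N := by
      rw [rowVec_mid hl hN, rowVec_pred hl hN, h, mul_one]
    simp only [foldExp, foldPerm, zpow_zero]
    split_ifs with h1 h2
    · rw [h1, hv]
    · rw [h2, hv]
    · rfl

/-- The pair products determine the quantities `L Q_k / P_k`. -/
theorem rowVec_mul_rev (hl : l ∈ crystalB N L) (hN : 4 ≤ N) {k : ℕ} (hk : 1 ≤ k)
    (hk' : k + 2 ≤ N) : rowVec l k * rowVec l (2 * N - 1 - k)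
      = L * cobarProd l k / coProd l k + L * cobarProd l (k + 1) / coProd l (k + 1) := by
  have hP := coProd_ne_zero hl k
  have hc := co_ne_zero hl (k + 1)
  rw [rowVec_of_lt hl hN (by omega), rowVec_of_gt hl hN hk hk', coProd_succ]
  field_simp

theorem rowVec_zero_mul_last (hl : l ∈ crystalB N L) (hN : 4 ≤ N) :
    rowVec l 0 * rowVec l (2 * N - 1) = L * cobarProd l 1 / coProd l 1 := by
  rw [rowVec_zero hl hN, rowVec_last l hN, coProd_succ, cobarProd_succ, coProd_zero, cobarProd_zero,
    one_mul, one_mul, mul_div_assoc]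

theorem rowVec_pred_mul_mid (hl : l ∈ crystalB N L) (hN : 4 ≤ N) :
    rowVec l (N - 1) * rowVec l N = L * cobarProd l (N - 1) / coProd l (N - 1) := by
  rw [rowVec_of_lt hl hN (by omega), rowVec_mid hl hN]
  ring

/-- Multiply the eigenvector equations at k and at its mirror: the exponents add up to 1, and c² =
1/L cancels. -/
theorem pair_symm_of_foldOp (hl : l ∈ crystalB N L) (hN : 4 ≤ N) {s : Fin 4}
    (hs : s = 2 ∨ s = 3) {c : ℂ} (hc : foldOp s L (rowV l) = c • rowV l) {k : ℕ} (hk : k < N) :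
    rowVec l k * rowVec l (2 * N - 1 - k)
      = rowVec l (N - 1 - k) * rowVec l (2 * N - 1 - (N - 1 - k)) := by
  have hL := level_ne_zero hl
  have h2 := sq_eq_of_foldOp_eq hN hL (rowV_ne_zero hl hN) hc
  rw [foldOp_rowV_eq_iff hN] at hc
  have e1 := hc k (by omega)
  have e2 := hc (2 * N - 1 - k) (by omega)
  have hexp := foldExp_add_rev hN s (i := k) (by omega)
  have hsc : foldScale s = 1 := by rcases hs with rfl | rfl <;> rfl
  rw [hsc] at h2 hexp
  have hmul : L⁻¹ * (rowVec l (foldPerm N s k) * rowVec l (foldPerm N s (2 * N - 1 - k)))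
      = L⁻¹ * (rowVec l k * rowVec l (2 * N - 1 - k)) := by
    have e3 : (L⁻¹ : ℂ) = L⁻¹ ^ foldExp N s k * L⁻¹ ^ foldExp N s (2 * N - 1 - k) := by
      rw [← zpow_add₀ (inv_ne_zero hL), hexp, zpow_one]
    rw [zpow_one] at h2
    calc _ = (L⁻¹ ^ foldExp N s k * rowVec l (foldPerm N s k)) *
          (L⁻¹ ^ foldExp N s (2 * N - 1 - k) * rowVec l (foldPerm N s (2 * N - 1 - k))) := by
          conv_lhs => rw [e3]
          ring
      _ = _ := by
          rw [e1, e2, ← h2]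
          ring
  rw [← mul_left_cancel₀ (inv_ne_zero hL) hmul, foldPerm_rev hN s (by omega)]
  have hp : foldPerm N s k = N - 1 - k ∨ foldPerm N s k = 2 * N - 1 - (N - 1 - k) := by
    rcases hs with rfl | rfl <;> simp only [foldPerm] <;> split_ifs <;> omega
  rcases hp with h | h
  · rw [h]
  · rw [h, show 2 * N - 1 - (2 * N - 1 - (N - 1 - k)) = N - 1 - k by omega, mul_comm]

/-- Each pair product of v is the sum of two consecutive ratios L Q_k / P_k, with a single ratio at
either end. So the symmetry of the pair products propagates from the ends inwards. -/
theorem ratio_symm_of_foldOp (hl : l ∈ crystalB N L) (hN : 4 ≤ N) {s : Fin 4}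
    (hs : s = 2 ∨ s = 3) {c : ℂ} (hc : foldOp s L (rowV l) = c • rowV l) {k : ℕ} (hk : 1 ≤ k)
    (hk' : k + 1 ≤ N) :
    L * cobarProd l (N - k) / coProd l (N - k) = L * cobarProd l k / coProd l k := by
  induction k, hk using Nat.le_induction with
  | base =>
    have h := pair_symm_of_foldOp hl hN hs hc (k := 0) (by omega)
    rw [Nat.sub_zero, Nat.sub_zero, show 2 * N - 1 - (N - 1) = N by omega,
      rowVec_zero_mul_last hl hN, rowVec_pred_mul_mid hl hN] at h
    exact h.symm
  | succ k hk ih =>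
    have h := pair_symm_of_foldOp hl hN hs hc (k := k) (by omega)
    rw [rowVec_mul_rev hl hN hk (by omega), rowVec_mul_rev hl hN (by omega) (by omega),
      show N - 1 - k + 1 = N - k by omega, ih (by omega)] at h
    rw [show N - (k + 1) = N - 1 - k by omega]
    linear_combination -h

theorem foldOp_dag_aux (hl : l ∈ crystalB N L) (hN : 4 ≤ N) {s : Fin 4}
    (hs : s = 2 ∨ s = 3) {c : ℂ} (hc : foldOp s L (rowV l) = c • rowV l) {j : ℕ} (hj : 1 ≤ j)
    (hj' : j + 2 ≤ N) : rowVec (dag l) (j + N) = c * rowVec (dag l) j := by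
  have hL := level_ne_zero hl
  have hr := ratio_symm_of_foldOp hl hN hs hc hj (by omega)
  have h := (foldOp_rowV_eq_iff hN s c).1 hc j (by omega)
  have h1 : foldExp N s j = 0 ∧ foldPerm N s j = j + N := by
    rcases hs with rfl | rfl <;> simp only [foldExp, foldPerm] <;> constructor <;> split_ifs <;>
      first | rfl | omega
  obtain ⟨k, hk, hk', rfl⟩ : ∃ k, 1 ≤ k ∧ k + 2 ≤ N ∧ j = N - 1 - k :=
    ⟨N - 1 - j, by omega, by omega, by omega⟩
  have hP := coProd_ne_zero hl k
  have hQ := cobarProd_ne_zero hl k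
  have hPj := coProd_ne_zero hl (N - 1 - k)
  have hQj := cobarProd_ne_zero hl (N - 1 - k)
  have hp := co_ne_zero hl (k + 1)
  have hq := cobar_ne_zero hl (k + 1)
  rw [h1.1, h1.2, zpow_zero, one_mul, show N - 1 - k + N = 2 * N - 1 - k by omega,
    rowVec_of_gt hl hN hk hk', rowVec_of_lt hl hN (by omega), cobarProd_succ] at h
  rw [show N - (N - 1 - k) = k + 1 by omega, coProd_succ, cobarProd_succ] at hr
  have e1 : rowVec (dag l) (N - 1 - k + N) = coProd l k + coProd l k * co l (k + 1) / cobar l (k + 1) := by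
    rw [rowVec_dag hl hN (by omega), show 2 * N - 1 - (N - 1 - k + N) = k by omega,
      colVec_of_lt hl hk hk', coProd_succ]
  have e2 : rowVec (dag l) (N - 1 - k) = L / cobarProd l (N - 1 - k) := by
    rw [rowVec_dag hl hN (by omega), colVec_of_gt hl (by omega)]
  rw [e1, e2]
  field_simp at h hr ⊢
  refine mul_left_cancel₀ hp ?_
  linear_combination (-(cobar l (k + 1) + co l (k + 1))) * hr + cobar l (k + 1) * h

/-- For Σ₂ and Σ₂Σ₁Σ₀ the symmetry of the ratios transfers the equations at generic indices from v
to u, and the four special indices are computed. For Σ₀ and Σ₁ the eigenvalue is 1 and the condition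
is one on coordinates, visibly stable under `dag`. -/
theorem foldOp_dag (hl : l ∈ crystalB N L) (hN : 4 ≤ N) {s : Fin 4} {c : ℂ}
    (hc : foldOp s L (rowV l) = c • rowV l) :
    foldOp s L (rowV (dag l)) = c • rowV (dag l) := by
  have hL := level_ne_zero hl
  have hc2 := sq_eq_of_foldOp_eq hN hL (rowV_ne_zero hl hN) hc
  have hc0 : c ≠ 0 := fun h => by
    rw [h, zero_pow two_ne_zero] at hc2
    exact zpow_ne_zero _ (inv_ne_zero hL) hc2.symm
  have hd := dag_mem hl hN
  by_cases hs : s = 2 ∨ s = 3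
  · have hsc : foldScale s = 1 := by rcases hs with rfl | rfl <;> rfl
    rw [hsc, zpow_one] at hc2
    have hcL : c * (c * L) = 1 := by
      rw [← mul_assoc, ← sq, hc2, inv_mul_cancel₀ hL]
    have hv := (foldOp_rowV_eq_iff hN s c).1 hc
    rw [foldOp_rowV_eq_iff hN]
    -- Since c² is the scalar by which the squared operator acts, the equation at j implies the one
    -- at the permuted index; half of the indices suffice.
    have hinv : ∀ j, j < 2 * N →
        L⁻¹ ^ foldExp N s j * rowVec (dag l) (foldPerm N s j) = c * rowVec (dag l) j →
        L⁻¹ ^ foldExp N s (foldPerm N s j) * rowVec (dag l) j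
          = c * rowVec (dag l) (foldPerm N s j) := by
      intro j hj h
      have h1 := foldExp_add_foldPerm hN s hj
      have h2 := zpow_ne_zero (foldExp N s j) (inv_ne_zero hL)
      refine mul_left_cancel₀ h2 ?_
      rw [mul_left_comm _ c, h, ← mul_assoc, ← zpow_add₀ (inv_ne_zero hL), h1, hsc, zpow_one,
        ← hc2]
      ring
    have hP := coProd_ne_zero hl (N - 1)
    have hQ := cobarProd_ne_zero hl (N - 1)
    have hPQ := coProd_mul_cobarProd hl
    have huv := colVec_zero_mul_rowVec_last hl hN
    have w0 : rowVec (dag l) 0 = L := rowVec_zero hd hN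
    have w1 : rowVec (dag l) (2 * N - 1) = colVec l 0 := by
      rw [rowVec_dag hl hN (by omega), Nat.sub_self]
    have w2 : rowVec (dag l) (N - 1) = coProd l (N - 1) := by
      rw [rowVec_dag hl hN (by omega), show 2 * N - 1 - (N - 1) = N by omega, colVec_mid hl hN]
    have w3 : rowVec (dag l) N = coProd l N := by
      rw [rowVec_dag hl hN (by omega), show 2 * N - 1 - N = N - 1 by omega, colVec_pred hl hN]
    have v2 : rowVec l (N - 1) = L / coProd l (N - 1) := rowVec_of_lt hl hN (by omega)
    have v3 := rowVec_mid hl hN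
    have hgen : ∀ j, 1 ≤ j → j + 2 ≤ N →
        L⁻¹ ^ foldExp N s j * rowVec (dag l) (foldPerm N s j) = c * rowVec (dag l) j := by
      intro j hj hj'
      have h1 : foldExp N s j = 0 ∧ foldPerm N s j = j + N := by
        rcases hs with rfl | rfl <;> simp only [foldExp, foldPerm] <;> constructor <;> split_ifs <;>
          first | rfl | omega
      rw [h1.1, h1.2, zpow_zero, one_mul, foldOp_dag_aux hl hN hs hc hj hj']
    have hfirst : ∀ j, j = 0 ∨ j = N - 1 ∨ j = N ∨ j = 2 * N - 1 →
        L⁻¹ ^ foldExp N s j * rowVec (dag l) (foldPerm N s j) = c * rowVec (dag l) j := by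
      rcases hs with rfl | rfl
      · have p0 : foldPerm N 2 0 = N ∧ foldExp N 2 0 = 0 := by
          simp only [foldPerm, foldExp]
          constructor <;> split_ifs <;> omega
        have p1 : foldPerm N 2 (N - 1) = 2 * N - 1 ∧ foldExp N 2 (N - 1) = 0 := by
          simp only [foldPerm, foldExp]
          constructor <;> split_ifs <;> omega
        have q0 := hv 0 (by omega)
        have q1 := hv (N - 1) (by omega)
        rw [p0.1, p0.2, zpow_zero, one_mul, v3, rowVec_zero hl hN] at q0
        rw [p1.1, p1.2, zpow_zero, one_mul, v2] at q1
        have r0 : L⁻¹ ^ foldExp N 2 0 * rowVec (dag l) (foldPerm N 2 0) = c * rowVec (dag l) 0 := by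
          rw [p0.1, p0.2, zpow_zero, one_mul, w3, w0]
          refine mul_right_cancel₀ hQ ?_
          rw [hPQ, q0]
          linear_combination (-L) * hcL
        have r1 : L⁻¹ ^ foldExp N 2 (N - 1) * rowVec (dag l) (foldPerm N 2 (N - 1))
            = c * rowVec (dag l) (N - 1) := by
          rw [p1.1, p1.2, zpow_zero, one_mul, w1, w2]
          rw [q1] at huv
          field_simp at huv
          linear_combination (-(colVec l 0)) * hcL + c * huv
        have r2 := hinv 0 (by omega) r0
        have r3 := hinv (N - 1) (by omega) r1
        have i2 := foldPerm_foldPerm hN 2 (i := 0) (by omega)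
        have i3 := foldPerm_foldPerm hN 2 (i := N - 1) (by omega)
        rw [p0.1] at r2 i2
        rw [p1.1] at r3 i3
        rintro j (rfl | rfl | rfl | rfl)
        · exact r0
        · exact r1
        · rwa [i2]
        · rwa [i3]
      · have p0 : foldPerm N 3 0 = N - 1 ∧ foldExp N 3 0 = 0 := by
          simp only [foldPerm, foldExp]
          constructor <;> split_ifs <;> omega
        have p1 : foldPerm N 3 N = 2 * N - 1 ∧ foldExp N 3 N = 0 := by
          simp only [foldPerm, foldExp]
          constructor <;> split_ifs <;> omega
        have q0 := hv 0 (by omega)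
        have q1 := hv N (by omega)
        rw [p0.1, p0.2, zpow_zero, one_mul, v2, rowVec_zero hl hN] at q0
        rw [p1.1, p1.2, zpow_zero, one_mul, v3] at q1
        have r0 : L⁻¹ ^ foldExp N 3 0 * rowVec (dag l) (foldPerm N 3 0) = c * rowVec (dag l) 0 := by
          rw [p0.1, p0.2, zpow_zero, one_mul, w2, w0]
          field_simp at q0
          linear_combination (-(coProd l (N - 1))) * hcL - c * L * q0
        have r1 : L⁻¹ ^ foldExp N 3 N * rowVec (dag l) (foldPerm N 3 N)
            = c * rowVec (dag l) N := by
          rw [p1.1, p1.2, zpow_zero, one_mul, w1, w3]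
          rw [q1] at huv
          refine mul_right_cancel₀ hQ ?_
          refine mul_left_cancel₀ hc0 ?_
          linear_combination huv - hcL - c * c * hPQ
        have r2 := hinv 0 (by omega) r0
        have r3 := hinv N (by omega) r1
        have i2 := foldPerm_foldPerm hN 3 (i := 0) (by omega)
        have i3 := foldPerm_foldPerm hN 3 (i := N) (by omega)
        rw [p0.1] at r2 i2
        rw [p1.1] at r3 i3
        rintro j (rfl | rfl | rfl | rfl)
        · exact r0
        · rwa [i2]
        · exact r1
        · rwa [i3]
    intro j hj
    by_cases h1 : j = 0 ∨ j = N - 1 ∨ j = N ∨ j = 2 * N - 1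
    · exact hfirst j h1
    by_cases h2 : j < N
    · exact hgen j (by omega) (by omega)
    · have h3 : foldPerm N s (j - N) = j := by
        rcases hs with rfl | rfl <;> simp only [foldPerm] <;> split_ifs <;> omega
      have h4 := hinv _ (by omega) (hgen (j - N) (by omega) (by omega))
      have h5 := foldPerm_foldPerm hN s (i := j - N) (by omega)
      rw [h3] at h4 h5
      rwa [h5]
  · have hs' : s = 0 ∨ s = 1 := by omega
    have hone : ∀ {l : Idx N → ℂ} {c : ℂ}, l ∈ crystalB N L →
        foldOp s L (rowV l) = c • rowV l → c = 1 := by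
      intro l c hl h
      have h1 := (foldOp_rowV_eq_iff hN s c).1 h 1 (by omega)
      have h2 : foldExp N s 1 = 0 ∧ foldPerm N s 1 = 1 := by
        rcases hs' with rfl | rfl
        · exact ⟨by rw [foldExp, if_neg (by omega), if_neg (by omega)],
            by rw [foldPerm, if_neg (by omega), if_neg (by omega)]⟩
        · exact ⟨rfl, by rw [foldPerm, if_neg (by omega), if_neg (by omega)]⟩
      have hv : rowVec l 1 ≠ 0 := by
        rw [rowVec_of_lt hl hN (by omega)]
        exact div_ne_zero hL (coProd_ne_zero hl _)
      rw [h2.1, h2.2, zpow_zero] at h1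
      exact (mul_right_cancel₀ hv h1).symm
    have key : ∃ c' : ℂ, foldOp s L (rowV (dag l)) = c' • rowV (dag l) := by
      rcases hs' with rfl | rfl
      · rw [exists_foldOp_zero_iff hd hN, co_dag_of_lt l le_rfl (by omega),
          cobar_dag_of_lt l le_rfl (by omega)]
        exact ((exists_foldOp_zero_iff hl hN).1 ⟨c, hc⟩).symm
      · rw [exists_foldOp_one_iff hd hN, co_dag_self l hN,
          (exists_foldOp_one_iff hl hN).1 ⟨c, hc⟩, div_one]
    obtain ⟨c', hc'⟩ := key
    rw [hc', hone hd hc', hone hl hc]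

end FoldPoints

end FoldedR

namespace FoldedR

open Matrix

/-! ### The folding involutions in terms of vectors -/

section FoldInvolutions

variable {N : ℕ} {L : ℂ} {l : Idx N → ℂ} {x : Fin (2 * N) → ℂ}

theorem co_pointOf (L : ℂ) (x : Fin (2 * N) → ℂ) {i : ℕ} (h : 1 ≤ i ∧ i ≤ N) :
    co (pointOf L x) i = entry x (i - 1) / entry x i :=
  co_mkPoint _ _ h

theorem cobar_pointOf (L : ℂ) (x : Fin (2 * N) → ℂ) {i : ℕ} (h : 1 ≤ i ∧ i ≤ N - 1) :
    cobar (pointOf L x) i = pointRatio L x i * (entry x (i - 1) / entry x i) :=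
  cobar_mkPoint _ _ h

theorem co_eq_entry (hl : l ∈ crystalB N L) (hN : 4 ≤ N) {i : ℕ} (h : 1 ≤ i ∧ i ≤ N) :
    co l i = entry (rowV l) (i - 1) / entry (rowV l) i := by
  conv_lhs => rw [← pointOf_rowV hl hN]
  exact co_pointOf L _ h

theorem cobar_eq_entry (hl : l ∈ crystalB N L) (hN : 4 ≤ N) {i : ℕ} (h : 1 ≤ i ∧ i ≤ N - 1) :
    cobar l i = pointRatio L (rowV l) i * co l i := by
  rw [co_eq_entry hl hN (by omega)]
  conv_lhs => rw [← pointOf_rowV hl hN]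
  exact cobar_pointOf L _ h

theorem entry_foldOp_mul_rev (hN : 4 ≤ N) (hL : L ≠ 0) (s : Fin 4) (x : Fin (2 * N) → ℂ) {j : ℕ}
    (hj : j < 2 * N) : entry (foldOp s L x) j * entry (foldOp s L x) (2 * N - 1 - j)
      = L⁻¹ ^ foldScale s * (entry x (foldPerm N s j) * entry x (2 * N - 1 - foldPerm N s j)) := by
  rw [entry_foldOp s L x hj, entry_foldOp s L x (by omega), ← foldExp_add_rev hN s hj,
    zpow_add₀ (inv_ne_zero hL), foldPerm_rev hN s hj]
  ring

/-- These permutations only exchange an index with its mirror, and the two exponents of such a pair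
cancel. -/
theorem partialForm_foldOp_zero (hN : 4 ≤ N) (hL : L ≠ 0) {s : Fin 4} (hs : s = 0 ∨ s = 1)
    (x : Fin (2 * N) → ℂ) {k : ℕ} (hk : k ≤ 2 * N) :
    partialForm N (entry (foldOp s L x)) k = partialForm N (entry x) k := by
  refine Finset.sum_congr rfl fun j hj => ?_
  rw [Finset.mem_range] at hj
  have hsc : foldScale s = 0 := by rcases hs with rfl | rfl <;> rfl
  have hp : foldPerm N s j = j ∨ foldPerm N s j = 2 * N - 1 - j := by
    rcases hs with rfl | rfl <;> simp only [foldPerm] <;> split_ifs <;> omega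
  rw [entry_foldOp_mul_rev hN hL s x (by omega), hsc, zpow_zero, one_mul]
  rcases hp with h | h
  · rw [h]
  · rw [h, show 2 * N - 1 - (2 * N - 1 - j) = j by omega, mul_comm (entry x j)]

/-- The operator reverses the order of the mirror pairs and flips all signs. Because the sum over
all N pairs is zero, an initial sum becomes an initial sum counted from the other end. -/
theorem partialForm_foldOp_two (hN : 4 ≤ N) (hev : Even N) (hL : L ≠ 0)
    (hx : form x x = 0) {k : ℕ} (hk : k ≤ N) :
    partialForm N (entry (foldOp 2 L x)) k = L⁻¹ * partialForm N (entry x) (N - k) := by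
  induction k with
  | zero =>
    rw [form_self_eq] at hx
    rw [partialForm_zero, Nat.sub_zero, (mul_eq_zero.1 hx).resolve_left two_ne_zero, mul_zero]
  | succ k ih =>
    have h1 := partialForm_succ (N := N) (entry x) (N - (k + 1))
    have hs := sgn_foldPerm_two hN hev (s := 2) (Or.inl rfl) (j := k) (by omega)
    have hp : foldPerm N 2 k = k + N := by rw [foldPerm, if_pos (by omega)]
    rw [hp, show k + N = 2 * N - 1 - (N - (k + 1)) by omega, sgn_rev (by omega)] at hs
    rw [show N - (k + 1) + 1 = N - k by omega, hs] at h1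
    rw [partialForm_succ, ih (by omega), entry_foldOp_mul_rev hN hL 2 x (by omega), hp,
      show 2 * N - 1 - (k + N) = N - (k + 1) by omega, h1,
      show 2 * N - 1 - (N - (k + 1)) = k + N by omega, foldScale, zpow_one]
    ring

theorem good_foldOp_zero (hl : l ∈ crystalB N L) (hN : 4 ≤ N) {s : Fin 4} (hs : s = 0 ∨ s = 1) :
    Good (foldOp s L (rowV l)) := by
  have hL := level_ne_zero hl
  have hg := (good_iff _).1 (good_rowV hl hN)
  refine (good_iff _).2 ⟨fun j hj => ?_, fun k h1 h2 => ?_⟩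
  · rw [entry_foldOp s L _ (by omega)]
    refine mul_ne_zero (zpow_ne_zero _ (inv_ne_zero hL)) ?_
    have hp : foldPerm N s j ≤ N ∨ foldPerm N s j = 2 * N - 1 := by
      rcases hs with rfl | rfl <;> simp only [foldPerm] <;> split_ifs <;> omega
    rcases hp with h | h
    · exact hg.1 _ h
    · rw [h, entry_rowV l (by omega), rowVec_last l hN]
      exact div_ne_zero (cobar_ne_zero hl 1) (co_ne_zero hl 1)
  · rw [partialForm_foldOp_zero hN hL hs _ (by omega)]
    exact hg.2 k h1 h2

theorem rowVec_of_gt' (hl : l ∈ crystalB N L) (hN : 4 ≤ N) {k : ℕ} (hk : 1 ≤ k)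
    (hk' : k + 2 ≤ N) : rowVec l (2 * N - 1 - k)
      = cobarProd l k * (co l (k + 1) + cobar l (k + 1)) / co l (k + 1) := by
  have := co_ne_zero hl (k + 1)
  rw [rowVec_of_gt hl hN hk hk', cobarProd_succ]
  field_simp

theorem entry_foldOp_two (x : Fin (2 * N) → ℂ) {j : ℕ} (hj : j < N) :
    entry (foldOp 2 L x) j = entry x (j + N) := by
  rw [entry_foldOp _ _ _ (by omega), foldExp, foldPerm, if_pos hj, if_pos hj, zpow_zero, one_mul]

theorem entry_foldOp_two_mid (hl : l ∈ crystalB N L) (hN : 4 ≤ N) :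
    entry (foldOp 2 L (rowV l)) N = 1 := by
  rw [entry_foldOp _ _ _ (by omega), foldExp, foldPerm, if_neg (by omega), if_neg (by omega),
    Nat.sub_self, entry_rowV l (by omega), rowVec_zero hl hN, zpow_one,
    inv_mul_cancel₀ (level_ne_zero hl)]

/-- The denominators of Σ₂ are, up to nonzero factors, the only quantities in the goodness of the
transformed vector that can vanish. -/
theorem good_foldOp_two_iff (hl : l ∈ crystalB N L) (hN : 4 ≤ N) (hev : Even N) :
    Good (foldOp 2 L (rowV l)) ↔ Sigma2DefinedAt l := by
  have hL := level_ne_zero hl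
  have hg := (good_iff _).1 (good_rowV hl hN)
  have hent : ∀ k, 1 ≤ k → k + 2 ≤ N → (entry (foldOp 2 L (rowV l)) (N - 1 - k) ≠ 0 ↔
      co l (k + 1) + cobar l (k + 1) ≠ 0) := by
    intro k hk hk'
    rw [entry_foldOp_two _ (by omega), show N - 1 - k + N = 2 * N - 1 - k by omega,
      entry_rowV l (by omega), rowVec_of_gt' hl hN hk hk', ne_eq, div_eq_zero_iff, mul_eq_zero]
    simp only [cobarProd_ne_zero hl k, co_ne_zero hl (k + 1), false_or, or_false, ne_eq]
  rw [good_iff]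
  constructor
  · rintro ⟨h, -⟩ i h1 h2
    have := (hent (i - 1) (by omega) (by omega)).1 (h _ (by omega))
    rwa [show i - 1 + 1 = i by omega] at this
  · refine fun h => ⟨fun j hj => ?_, fun k h1 h2 => ?_⟩
    · rcases eq_or_lt_of_le hj with rfl | hj
      · rw [entry_foldOp_two_mid hl hN]
        exact one_ne_zero
      obtain ⟨k, hk, rfl⟩ : ∃ k, k + 1 ≤ N ∧ j = N - 1 - k := ⟨N - 1 - j, by omega, by omega⟩
      by_cases hk0 : k = 0
      · rw [entry_foldOp_two _ (by omega), hk0, show N - 1 - 0 + N = 2 * N - 1 by omega,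
          entry_rowV l (by omega), rowVec_last l hN]
        exact div_ne_zero (cobar_ne_zero hl 1) (co_ne_zero hl 1)
      by_cases hk1 : k = N - 1
      · rw [entry_foldOp_two _ (by omega), hk1, show N - 1 - (N - 1) + N = N by omega,
          entry_rowV l (by omega), rowVec_mid hl hN]
        exact cobarProd_ne_zero hl _
      · exact (hent k (by omega) (by omega)).2 (h _ (by omega) (by omega))
    · rw [partialForm_foldOp_two hN hev hL (form_rowV_self hl hN) (by omega)]
      exact mul_ne_zero (inv_ne_zero hL) (hg.2 _ (by omega) (by omega))

theorem form_foldOp_self (hl : l ∈ crystalB N L) (hN : 4 ≤ N) (s : Fin 4)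
    (hs : s = 0 ∨ s = 1 ∨ Even N) :
    form (foldOp s L (rowV l)) (foldOp s L (rowV l)) = 0 := by
  have hL := level_ne_zero hl
  have key : ∃ ε, ∀ j, j < 2 * N → sgn N (foldPerm N s j) = ε * sgn N j := by
    by_cases h : s = 0 ∨ s = 1
    · exact ⟨1, fun j hj => sgn_foldPerm_zero hN h hj⟩
    · exact ⟨-1, fun j hj => sgn_foldPerm_two hN (by tauto) (by omega) hj⟩
  obtain ⟨ε, hε⟩ := key
  rw [form_foldOp hN hL s hε, form_rowV_self hl hN, mul_zero]

/-- This and the two analogues for Σ₁ and Σ₂ identify the folding involutions with the action of the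
monomial operators on isotropic lines. -/
theorem sigma0_eq_pointOf (hl : l ∈ crystalB N L) (hN : 4 ≤ N) :
    sigma0 l = pointOf L (foldOp 0 L (rowV l)) := by
  have hL := level_ne_zero hl
  have h1 := co_ne_zero hl 1
  have h2 := cobar_ne_zero hl 1
  have hent : ∀ j, 1 ≤ j → j ≤ N → entry (foldOp 0 L (rowV l)) j = entry (rowV l) j := by
    intro j hj hj'
    rw [entry_foldOp _ _ _ (by omega), foldExp, foldPerm, if_neg (by omega), if_neg (by omega),
      if_neg (by omega), if_neg (by omega), zpow_zero, one_mul]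
  have hent0 : entry (foldOp 0 L (rowV l)) 0 = L * (cobar l 1 / co l 1) := by
    rw [entry_foldOp _ _ _ (by omega), foldExp, foldPerm, if_pos rfl, if_pos rfl,
      entry_rowV l (by omega), rowVec_last l hN, _root_.zpow_neg, zpow_one, inv_inv]
  have hent1 : entry (rowV l) 1 = L / co l 1 := by
    rw [entry_rowV l (by omega), rowVec_of_lt hl hN (by omega), coProd_succ, coProd_zero, one_mul]
  refine ext_co (fun i hi hi' => ?_) fun i hi hi' => ?_
  · rw [sigma0, co_mkPoint _ _ ⟨hi, hi'⟩, co_pointOf _ _ ⟨hi, hi'⟩]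
    split_ifs with h
    · subst h
      rw [Nat.sub_self, hent0, hent 1 le_rfl hi', hent1]
      field_simp
    · rw [hent _ (by omega) (by omega), hent i hi hi', co_eq_entry hl hN ⟨hi, hi'⟩]
  · rw [sigma0, cobar_mkPoint _ _ ⟨hi, hi'⟩, cobar_pointOf _ _ ⟨hi, hi'⟩]
    split_ifs with h
    · subst h
      rw [pointRatio, if_pos rfl, partialForm_foldOp_zero hN hL (Or.inl rfl) _ (by omega),
        partialForm_entry_rowV l (by omega), partialForm_rowVec hl hN le_rfl (by omega),
        Nat.sub_self, hent0, hent 1 le_rfl (by omega), hent1, coProd_succ, cobarProd_succ,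
        coProd_zero, cobarProd_zero]
      field_simp
    · rw [hent _ (by omega) (by omega), hent i hi (by omega), cobar_eq_entry hl hN ⟨hi, hi'⟩,
        co_eq_entry hl hN (by omega), pointRatio, pointRatio, if_neg h, if_neg h,
        partialForm_foldOp_zero hN hL (Or.inl rfl) _ (by omega),
        partialForm_foldOp_zero hN hL (Or.inl rfl) _ (by omega)]

theorem sigma1_eq_pointOf (hl : l ∈ crystalB N L) (hN : 4 ≤ N) :
    sigma1 l = pointOf L (foldOp 1 L (rowV l)) := by
  have hL := level_ne_zero hl
  have h1 := co_ne_zero hl N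
  have hQ := cobarProd_ne_zero hl (N - 1)
  have hent : ∀ j, j + 2 ≤ N → entry (foldOp 1 L (rowV l)) j = entry (rowV l) j := by
    intro j hj
    rw [entry_foldOp _ _ _ (by omega), foldExp, foldPerm, if_neg (by omega), if_neg (by omega),
      zpow_zero, one_mul]
  have hent1 : entry (foldOp 1 L (rowV l)) (N - 1) = entry (rowV l) N := by
    rw [entry_foldOp _ _ _ (by omega), foldExp, foldPerm, if_pos rfl, zpow_zero, one_mul]
  have hent2 : entry (foldOp 1 L (rowV l)) N = entry (rowV l) (N - 1) := by
    rw [entry_foldOp _ _ _ (by omega), foldExp, foldPerm, if_neg (by omega), if_pos rfl, zpow_zero,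
      one_mul]
  have hv : entry (rowV l) (N - 1) = co l N * entry (rowV l) N := by
    rw [entry_rowV l (by omega), entry_rowV l (by omega), rowVec_pred hl hN, rowVec_mid hl hN,
      mul_comm]
  have hv0 : entry (rowV l) N ≠ 0 := (good_rowV hl hN).ne_zero le_rfl
  have hv1 : entry (rowV l) (N - 2) / entry (rowV l) (N - 1) = co l (N - 1) := by
    rw [co_eq_entry hl hN (by omega), show N - 1 - 1 = N - 2 by omega]
  have hv2 : entry (rowV l) (N - 2) / entry (rowV l) N = co l (N - 1) * co l N := by
    rw [← hv1, hv]
    field_simp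
  refine ext_co (fun i hi hi' => ?_) fun i hi hi' => ?_
  · rw [sigma1, co_mkPoint _ _ ⟨hi, hi'⟩, co_pointOf _ _ ⟨hi, hi'⟩]
    split_ifs with h h'
    · rw [h, hent1, hent _ (by omega), show N - 1 - 1 = N - 2 by omega, hv2]
    · rw [h', hent1, hent2, hv]
      field_simp
    · rw [hent _ (by omega), hent _ (by omega), co_eq_entry hl hN ⟨hi, hi'⟩]
  · have hr : pointRatio L (foldOp 1 L (rowV l)) i = pointRatio L (rowV l) i := by
      rw [pointRatio, pointRatio, hent 0 (by omega),
        partialForm_foldOp_zero hN hL (Or.inr rfl) _ (by omega),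
        partialForm_foldOp_zero hN hL (Or.inr rfl) _ (by omega),
        partialForm_foldOp_zero hN hL (Or.inr rfl) _ (by omega)]
    rw [sigma1, cobar_mkPoint _ _ ⟨hi, hi'⟩, cobar_pointOf _ _ ⟨hi, hi'⟩, hr,
      cobar_eq_entry hl hN ⟨hi, hi'⟩]
    split_ifs with h
    · rw [cobar_eq_entry hl hN (by omega), h, hent1, hent _ (by omega),
        show N - 1 - 1 = N - 2 by omega, hv2]
      ring
    · rw [hent _ (by omega), hent _ (by omega), co_eq_entry hl hN (by omega)]

theorem sigma2_eq_pointOf (hl : l ∈ crystalB N L) (hN : 4 ≤ N) (hev : Even N)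
    (hd : Sigma2DefinedAt l) : sigma2 l = pointOf L (foldOp 2 L (rowV l)) := by
  have hL := level_ne_zero hl
  have hco : ∀ i, 1 ≤ i → i ≤ N → co (sigma2 l) i
      = entry (foldOp 2 L (rowV l)) (i - 1) / entry (foldOp 2 L (rowV l)) i := by
    intro i hi hi'
    rw [sigma2, co_mkPoint _ _ ⟨hi, hi'⟩, entry_foldOp_two _ (by omega)]
    split_ifs with h1 h2 h3
    · have := co_ne_zero hl (N - 1)
      have := hd (N - 1) (by omega) le_rfl
      have := cobarProd_ne_zero hl (N - 2)
      have e := rowVec_of_gt' hl hN (k := N - 2) (by omega) (by omega)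
      have e' := cobarProd_succ l (N - 2)
      rw [show N - 2 + 1 = N - 1 by omega] at e e'
      rw [h1, Nat.sub_self, zero_add, entry_foldOp_two _ (by omega), entry_rowV l (by omega),
        entry_rowV l (by omega), show 1 + N = 2 * N - 1 - (N - 2) by omega, e, rowVec_mid hl hN, e']
      field_simp
    · have := co_ne_zero hl 1
      have := co_ne_zero hl 2
      have := cobar_ne_zero hl 1
      have := cobar_ne_zero hl 2
      rw [h2, entry_foldOp_two _ (by omega), entry_rowV l (by omega), entry_rowV l (by omega),
        show N - 1 - 1 + N = 2 * N - 1 - 1 by omega, show N - 1 + N = 2 * N - 1 by omega,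
        rowVec_of_gt' hl hN le_rfl (by omega), rowVec_last l hN, cobarProd_succ, cobarProd_zero]
      field_simp
    · rw [h3, entry_foldOp_two_mid hl hN, entry_rowV l (by omega),
        show N - 1 + N = 2 * N - 1 by omega, rowVec_last l hN, div_one]
    · obtain ⟨k, hk, hk', rfl⟩ : ∃ k, 1 ≤ k ∧ k + 3 ≤ N ∧ i = N - (k + 1) :=
        ⟨N - i - 1, by omega, by omega, by omega⟩
      have := co_ne_zero hl (k + 1)
      have := co_ne_zero hl (k + 2)
      have := cobarProd_ne_zero hl k
      have := hd (k + 1) (by omega) (by omega)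
      rw [entry_foldOp_two _ (by omega), entry_rowV l (by omega), entry_rowV l (by omega),
        show N - (k + 1) - 1 + N = 2 * N - 1 - (k + 1) by omega,
        show N - (k + 1) + N = 2 * N - 1 - k by omega, rowVec_of_gt' hl hN (by omega) (by omega),
        rowVec_of_gt' hl hN hk (by omega), show N - (N - (k + 1)) = k + 1 by omega, cobarProd_succ]
      field_simp
  refine ext_co (fun i hi hi' => ?_) fun i hi hi' => ?_
  · rw [hco i hi hi', co_pointOf _ _ ⟨hi, hi'⟩]
  rw [cobar_pointOf _ _ ⟨hi, hi'⟩, ← hco i hi (by omega), pointRatio, sigma2,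
    cobar_mkPoint _ _ ⟨hi, hi'⟩, co_mkPoint _ _ (by omega)]
  split_ifs with h1 h2
  · have hs := partialForm_rowVec hl hN (k := N - 1) (by omega) (by omega)
    obtain ⟨n, hn⟩ := hev
    have hP := coProd_ne_zero hl (N - 1)
    have hQ := cobarProd_ne_zero hl (N - 1)
    have hPQ := coProd_mul_cobarProd hl
    rw [← coProd_pred l hN] at hPQ
    -- As N is even, the sign of the last partial sum is +1; without this the coordinate l̄₁' of Σ₂
    -- would come out with the wrong sign.
    rw [show N - 1 - 1 = 2 * (n - 1) by omega, pow_mul, neg_one_sq, one_pow, one_mul] at hs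
    rw [partialForm_foldOp_two hN ⟨n, hn⟩ hL (form_rowV_self hl hN) (by omega),
      partialForm_entry_rowV l (by omega), hs, entry_foldOp_two _ (by omega), zero_add,
      entry_rowV l (by omega), rowVec_mid hl hN]
    have e : L * (L⁻¹ * (L * cobarProd l (N - 1) / coProd l (N - 1))) / cobarProd l (N - 1) ^ 2
        = co l N := by
      field_simp
      linear_combination -hPQ
    rw [e]
    ring
  all_goals
    obtain ⟨k, hk, hk', rfl⟩ : ∃ k, 1 ≤ k ∧ k + 2 ≤ N ∧ i = N - k :=
      ⟨N - i, by omega, by omega, by omega⟩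
    have hP := coProd_ne_zero hl k
    have hQ := cobarProd_ne_zero hl k
    have hp := co_ne_zero hl (k + 1)
    have hq := cobar_ne_zero hl (k + 1)
    have hratio : -(partialForm N (entry (foldOp 2 L (rowV l))) (N - k) /
        partialForm N (entry (foldOp 2 L (rowV l))) (N - k - 1)) = co l (k + 1) / cobar l (k + 1) := by
      rw [partialForm_foldOp_two hN hev hL (form_rowV_self hl hN) (by omega),
        partialForm_foldOp_two hN hev hL (form_rowV_self hl hN) (by omega),
        show N - (N - k) = k by omega, show N - (N - k - 1) = k + 1 by omega,
        partialForm_entry_rowV l (by omega), partialForm_entry_rowV l (by omega),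
        partialForm_rowVec hl hN hk (by omega), partialForm_rowVec hl hN (by omega) (by omega),
        coProd_succ, cobarProd_succ]
      obtain ⟨j, rfl⟩ : ∃ j, k = j + 1 := ⟨k - 1, by omega⟩
      have : ((-1 : ℂ)) ^ j ≠ 0 := pow_ne_zero _ (by norm_num)
      rw [Nat.add_sub_cancel, Nat.add_sub_cancel, pow_succ]
      field_simp
    rw [hratio]
  · obtain rfl : k = 1 := by omega
    field_simp
  · omega
  · rw [show N - (N - k) = k by omega]
    field_simp

end FoldInvolutions

end FoldedR

namespace FoldedR

open Matrix

/-! ### The fixed-point varieties in terms of vectors -/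

section FoldVarieties

variable {N : ℕ} {L K : ℂ} {l m : Idx N → ℂ}

/-- The points of the crystal whose vectors are eigenvectors of some of the folding operators. -/
def foldVar (S : Set (Fin 4)) (N : ℕ) (L : ℂ) : Set (Idx N → ℂ) :=
  {l | l ∈ crystalB N L ∧ ∀ s ∈ S, ∃ c : ℂ, foldOp s L (rowV l) = c • rowV l}

theorem foldVar_empty (N : ℕ) (L : ℂ) : foldVar ∅ N L = crystalB N L := by
  ext l
  simp [foldVar]

theorem pointOf_eq_iff (hl : l ∈ crystalB N L) (hN : 4 ≤ N) {x : Fin (2 * N) → ℂ}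
    (hx : Good x) (hx0 : form x x = 0) : pointOf L x = l ↔ ∃ c : ℂ, x = c • rowV l := by
  constructor
  · rintro rfl
    exact ⟨_, smul_rowV_pointOf hN (level_ne_zero hl) hx hx0⟩
  · rintro ⟨c, rfl⟩
    have hc : c ≠ 0 := fun h => hx.ne_zero' (by rw [h, zero_smul])
    rw [pointOf_smul L hc, pointOf_rowV hl hN]

theorem sigma0_eq_self_iff (hl : l ∈ crystalB N L) (hN : 4 ≤ N) :
    sigma0 l = l ↔ ∃ c : ℂ, foldOp 0 L (rowV l) = c • rowV l := by
  rw [sigma0_eq_pointOf hl hN, pointOf_eq_iff hl hN (good_foldOp_zero hl hN (Or.inl rfl))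
    (form_foldOp_self hl hN 0 (Or.inl rfl))]

theorem sigma1_eq_self_iff (hl : l ∈ crystalB N L) (hN : 4 ≤ N) :
    sigma1 l = l ↔ ∃ c : ℂ, foldOp 1 L (rowV l) = c • rowV l := by
  rw [sigma1_eq_pointOf hl hN, pointOf_eq_iff hl hN (good_foldOp_zero hl hN (Or.inr rfl))
    (form_foldOp_self hl hN 1 (Or.inr (Or.inl rfl)))]

/-- Stated for two points because Σ₂ is later applied to Σ₁Σ₀(l). Proportionality to the vector of a
point already implies goodness, so the denominators do not vanish. -/
theorem sigma2_eq_iff {l' : Idx N → ℂ} (hl : l ∈ crystalB N L) (hl' : l' ∈ crystalB N L)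
    (hN : 4 ≤ N) (hev : Even N) : (Sigma2DefinedAt l ∧ sigma2 l = l') ↔
      ∃ c : ℂ, foldOp 2 L (rowV l) = c • rowV l' := by
  have hL := level_ne_zero hl
  have h0 := form_foldOp_self hl hN 2 (Or.inr (Or.inr hev))
  constructor
  · rintro ⟨hd, h⟩
    rw [sigma2_eq_pointOf hl hN hev hd] at h
    exact (pointOf_eq_iff hl' hN ((good_foldOp_two_iff hl hN hev).2 hd) h0).1 h
  · rintro ⟨c, hc⟩
    have hne : c ≠ 0 := fun h => by
      have h2 := foldOp_foldOp hN hL 2 (rowV l)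
      rw [hc, h, zero_smul, foldOp_zero] at h2
      exact smul_ne_zero (zpow_ne_zero _ (inv_ne_zero hL)) (rowV_ne_zero hl hN) h2.symm
    have hg : Good (foldOp 2 L (rowV l)) := by
      rw [hc, good_smul hne]
      exact good_rowV hl' hN
    have hd := (good_foldOp_two_iff hl hN hev).1 hg
    refine ⟨hd, ?_⟩
    rw [sigma2_eq_pointOf hl hN hev hd]
    exact (pointOf_eq_iff hl' hN hg h0).2 ⟨c, hc⟩

theorem foldOp_two_one_zero (hN : 4 ≤ N) (hL : L ≠ 0) (x : Fin (2 * N) → ℂ) :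
    foldOp 2 L (foldOp 1 L (foldOp 0 L x)) = foldOp 3 L x := by
  funext j
  have h1 := foldPerm_lt hN 2 j.2
  have h2 := foldPerm_lt hN 1 h1
  rw [foldOp, entry_foldOp _ _ _ h1, entry_foldOp _ _ _ h2, foldOp, ← mul_assoc, ← mul_assoc,
    ← zpow_add₀ (inv_ne_zero hL), ← zpow_add₀ (inv_ne_zero hL)]
  have hj := j.2
  have e1 : foldPerm N 0 (foldPerm N 1 (foldPerm N 2 j)) = foldPerm N 3 j := by
    simp only [foldPerm]
    split_ifs <;> omega
  have e2 : foldExp N 2 j + foldExp N 1 (foldPerm N 2 j)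
      + foldExp N 0 (foldPerm N 1 (foldPerm N 2 j)) = foldExp N 3 j := by
    simp only [foldPerm, foldExp]
    split_ifs <;> omega
  rw [e1, e2]

theorem foldOp_zero_one (hN : 4 ≤ N) (L : ℂ) (x : Fin (2 * N) → ℂ) :
    foldOp 0 L (foldOp 1 L x) = foldOp 1 L (foldOp 0 L x) := by
  funext j
  have hj := j.2
  rw [foldOp, foldOp, entry_foldOp _ _ _ (foldPerm_lt hN 0 hj),
    entry_foldOp _ _ _ (foldPerm_lt hN 1 hj)]
  have e1 : foldPerm N 1 (foldPerm N 0 j) = foldPerm N 0 (foldPerm N 1 j) := by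
    simp only [foldPerm]
    split_ifs <;> omega
  have e2 : foldExp N 0 (foldPerm N 1 j) = foldExp N 0 j := by
    simp only [foldPerm, foldExp]
    split_ifs <;> omega
  have e3 : ∀ i, foldExp N 1 i = 0 := fun _ => rfl
  rw [e1, e2, e3, e3, zpow_zero, one_mul, one_mul]

theorem fixedVariety_zero (hN : 4 ≤ N) (L : ℂ) : fixedVariety 0 N L = foldVar {0} N L := by
  ext l
  refine and_congr_right fun hl => ?_
  simp only [SigmaDefinedAt, true_and, sigma, Set.mem_singleton_iff, forall_eq]
  exact sigma0_eq_self_iff hl hN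

theorem fixedVariety_one (hN : 4 ≤ N) (L : ℂ) : fixedVariety 1 N L = foldVar {1} N L := by
  ext l
  refine and_congr_right fun hl => ?_
  simp only [SigmaDefinedAt, true_and, sigma, Set.mem_singleton_iff, forall_eq]
  exact sigma1_eq_self_iff hl hN

theorem fixedVariety_two (hN : 4 ≤ N) (hev : Even N) (L : ℂ) :
    fixedVariety 2 N L = foldVar {2} N L := by
  ext l
  refine and_congr_right fun hl => ?_
  simp only [SigmaDefinedAt, sigma, Set.mem_singleton_iff, forall_eq]
  exact sigma2_eq_iff hl hl hN hev

/-- The two involutions change disjoint sets of coordinates. -/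
theorem sigma0_sigma1_eq_self_iff (hl : l ∈ crystalB N L) (hN : 4 ≤ N) :
    sigma0 (sigma1 l) = l ↔ sigma0 l = l ∧ sigma1 l = l := by
  refine ⟨fun h => ?_, fun h => by rw [h.2, h.1]⟩
  have h1 := congrArg (co · 1) h
  have h2 := congrArg (co · (N - 1)) h
  have hc := co_ne_zero hl (N - 1)
  simp only [sigma0] at h1 h2
  rw [co_mkPoint _ _ (by omega), if_pos rfl, sigma1, cobar_mkPoint _ _ (by omega),
    if_neg (by omega)] at h1
  rw [co_mkPoint _ _ (by omega), if_neg (by omega), sigma1, co_mkPoint _ _ (by omega),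
    if_pos rfl] at h2
  rw [sigma0_eq_self_iff hl hN, sigma1_eq_self_iff hl hN, exists_foldOp_zero_iff hl hN,
    exists_foldOp_one_iff hl hN]
  exact ⟨h1.symm, mul_left_cancel₀ hc (by rw [h2, mul_one])⟩

theorem fixedVariety_three (hN : 4 ≤ N) (L : ℂ) : fixedVariety 3 N L = foldVar {0, 1} N L := by
  ext l
  refine and_congr_right fun hl => ?_
  simp only [SigmaDefinedAt, true_and, sigma, Set.mem_insert_iff, Set.mem_singleton_iff,
    forall_eq_or_imp, forall_eq]
  rw [sigma0_sigma1_eq_self_iff hl hN, sigma0_eq_self_iff hl hN, sigma1_eq_self_iff hl hN]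

theorem commonFixedVariety_eq (hN : 4 ≤ N) (hev : Even N) (L : ℂ) :
    commonFixedVariety N L = foldVar {0, 1, 2} N L := by
  ext l
  refine and_congr_right fun hl => ?_
  simp only [Set.mem_insert_iff, Set.mem_singleton_iff, forall_eq_or_imp, forall_eq]
  rw [← sigma0_eq_self_iff hl hN, ← sigma1_eq_self_iff hl hN, ← sigma2_eq_iff hl hl hN hev]
  tauto

/-- Σ₀ leaves the indices from 2 on alone, and Σ₁ only multiplies the last denominator by l_N. -/
theorem sigma2DefinedAt_sigma1_sigma0_iff (hl : l ∈ crystalB N L) (hN : 4 ≤ N) :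
    Sigma2DefinedAt (sigma1 (sigma0 l)) ↔ Sigma2DefinedAt l := by
  have hc := co_ne_zero hl N
  refine forall_congr' fun i => forall₂_congr fun h1 h2 => ?_
  have e1 : ∀ i, 2 ≤ i → i ≤ N → co (sigma0 l) i = co l i := fun i hi hi' => by
    rw [sigma0, co_mkPoint _ _ (by omega), if_neg (by omega)]
  have e2 : ∀ i, 2 ≤ i → i ≤ N - 1 → cobar (sigma0 l) i = cobar l i := fun i hi hi' => by
    rw [sigma0, cobar_mkPoint _ _ (by omega), if_neg (by omega)]
  rw [sigma1, co_mkPoint _ _ (by omega), cobar_mkPoint _ _ (by omega)]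
  by_cases h : i = N - 1
  · rw [if_pos h, if_pos h, e1 _ (by omega) (by omega), e1 _ (by omega) le_rfl,
      e2 _ (by omega) le_rfl, h, show co l (N - 1) * co l N + co l N * cobar l (N - 1)
        = co l N * (co l (N - 1) + cobar l (N - 1)) by ring, mul_ne_zero_iff]
    exact and_iff_right hc
  · rw [if_neg h, if_neg (by omega), if_neg h, e1 i h1 (by omega), e2 i h1 h2]

theorem rowV_sigma0 (hl : l ∈ crystalB N L) (hN : 4 ≤ N) :
    sigma0 l ∈ crystalB N L ∧ ∃ c : ℂ, c ≠ 0 ∧ rowV (sigma0 l) = c • foldOp 0 L (rowV l) := by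
  have hL := level_ne_zero hl
  have hg := good_foldOp_zero hl hN (Or.inl rfl)
  have h0 := form_foldOp_self hl hN 0 (Or.inl rfl)
  rw [sigma0_eq_pointOf hl hN]
  exact ⟨pointOf_mem hN hL hg h0, _, div_ne_zero hL (hg.ne_zero (Nat.zero_le N)),
    rowV_pointOf hN hL hg h0⟩

theorem rowV_sigma1 (hl : l ∈ crystalB N L) (hN : 4 ≤ N) :
    sigma1 l ∈ crystalB N L ∧ ∃ c : ℂ, c ≠ 0 ∧ rowV (sigma1 l) = c • foldOp 1 L (rowV l) := by
  have hL := level_ne_zero hl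
  have hg := good_foldOp_zero hl hN (Or.inr rfl)
  have h0 := form_foldOp_self hl hN 1 (Or.inr (Or.inl rfl))
  rw [sigma1_eq_pointOf hl hN]
  exact ⟨pointOf_mem hN hL hg h0, _, div_ne_zero hL (hg.ne_zero (Nat.zero_le N)),
    rowV_pointOf hN hL hg h0⟩

theorem fixedVariety_four (hN : 4 ≤ N) (hev : Even N) (L : ℂ) :
    fixedVariety 4 N L = foldVar {3} N L := by
  ext l
  refine and_congr_right fun hl => ?_
  obtain ⟨h0, c, hc, hc'⟩ := rowV_sigma0 hl hN
  obtain ⟨h1, d, hd, hd'⟩ := rowV_sigma1 h0 hN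
  simp only [SigmaDefinedAt, sigma, Set.mem_singleton_iff, forall_eq]
  rw [← sigma2DefinedAt_sigma1_sigma0_iff hl hN, sigma2_eq_iff h1 hl hN hev, hd', hc', foldOp_smul,
    foldOp_smul, foldOp_smul, foldOp_two_one_zero hN (level_ne_zero hl), smul_smul]
  constructor
  · rintro ⟨a, ha⟩
    refine ⟨(d * c)⁻¹ * a, ?_⟩
    rw [mul_smul, ← ha, inv_smul_smul₀ (mul_ne_zero hd hc)]
  · rintro ⟨a, ha⟩
    exact ⟨d * c * a, by rw [ha, smul_smul]⟩

/-! ### The refactorization map on the fixed-point varieties -/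

variable {S : Set (Fin 4)}

theorem foldVar_subset : foldVar S N L ⊆ crystalB N L := fun _ h => h.1

theorem dag_mem_foldVar (hN : 4 ≤ N) (hl : l ∈ foldVar S N L) : dag l ∈ foldVar S N L :=
  ⟨dag_mem hl.1 hN, fun s hs => by
    obtain ⟨c, hc⟩ := hl.2 s hs
    exact ⟨c, foldOp_dag hl.1 hN hc⟩⟩

theorem foldOp_vecMul_of_mem (hN : 4 ≤ N) (hL : L ≠ 0) (hm : m ∈ foldVar S N K) {s : Fin 4}
    (hs : s ∈ S) (x : Fin (2 * N) → ℂ) :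
    foldOp s L (x ᵥ* evalM K m L⁻¹) = foldOp s L x ᵥ* evalM K m L⁻¹ := by
  obtain ⟨c, hc⟩ := hm.2 s hs
  exact foldOp_vecMul hm.1 hN hL hc (foldOp_dag hm.1 hN hc) x

/-- The operator of level L passes through the matrix of m to v(l), where it acts as a scalar. -/
theorem pointOf_outVec_mem_foldVar (hN : 4 ≤ N) (hl : l ∈ foldVar S N L) (hm : m ∈ foldVar S N K)
    (hg : Good (outVec L K l m)) : pointOf L (outVec L K l m) ∈ foldVar S N L := by
  have hL := level_ne_zero hl.1
  have h0 := form_outVec hl.1 hm.1 hN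
  refine ⟨pointOf_mem hN hL hg h0, fun s hs => ?_⟩
  obtain ⟨c, hc⟩ := hl.2 s hs
  refine ⟨c, ?_⟩
  rw [rowV_pointOf hN hL hg h0, foldOp_smul, outVec, foldOp_vecMul_of_mem hN hL hm hs, hc,
    smul_vecMul, smul_comm]

theorem rmap_mem_prodSet_foldVar (hN : 4 ≤ N) {p : Idx N ⊕ Idx N → ℂ}
    (hp : p ∈ prodSet (foldVar S N L) (foldVar S N K)) (hg : p ∈ goodSet N L K) :
    rmap L K p ∈ prodSet (foldVar S N K) (foldVar S N L) :=
  ⟨dag_mem_foldVar hN (pointOf_outVec_mem_foldVar hN (dag_mem_foldVar hN hp.2)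
    (dag_mem_foldVar hN hp.1) hg.2.2), pointOf_outVec_mem_foldVar hN hp.1 hp.2 hg.2.1⟩

theorem continuous_foldOp (hN : 4 ≤ N) (s : Fin 4) (L : ℂ) :
    Continuous (foldOp (N := N) s L) :=
  continuous_pi fun j => by
    simp only [foldOp_apply hN]
    fun_prop

theorem continuousOn_rowV : ContinuousOn (rowV (N := N)) (crystalB N L) :=
  (isRegularOn_rowV (isRegularOn_id _) fun _ h => h).continuousOn

theorem continuousOn_dag : ContinuousOn (dag (N := N)) (crystalB N L) :=
  (isRegularOn_dag (isRegularOn_id _) fun _ h => h).continuousOn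

theorem mem_foldVar_of_mem_closure (hN : 4 ≤ N) (hl : l ∈ crystalB N L)
    (h : l ∈ closure (foldVar S N L)) : l ∈ foldVar S N L := by
  refine ⟨hl, fun s hs => ?_⟩
  have hL := level_ne_zero hl
  -- Since v starts with L, the eigenvalue is the first entry of the image divided by L. Being an
  -- eigenvector becomes an equation between continuous functions of l, hence a closed condition.
  suffices L • foldOp s L (rowV l) = foldOp s L (rowV l) (firstIdx hN) • rowV l from
    ⟨L⁻¹ * foldOp s L (rowV l) (firstIdx hN), by rw [mul_smul, ← this, inv_smul_smul₀ hL]⟩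
  have hc : ContinuousWithinAt (rowV (N := N)) (foldVar S N L) l :=
    (continuousOn_rowV l hl).mono foldVar_subset
  have hT : ContinuousWithinAt (fun l => foldOp s L (rowV l)) (foldVar S N L) l :=
    (continuous_foldOp hN s L).continuousAt.comp_continuousWithinAt hc
  have h1 : ContinuousWithinAt (fun l => L • foldOp s L (rowV l)) (foldVar S N L) l :=
    hT.const_smul L
  have h2 : ContinuousWithinAt (fun l => foldOp s L (rowV l) (firstIdx hN) • rowV l)
      (foldVar S N L) l :=
    ((continuous_apply (firstIdx hN)).continuousAt.comp_continuousWithinAt hT).smul hc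
  have := mem_closure_iff_nhdsWithin_neBot.1 h
  refine tendsto_nhds_unique_of_eventuallyEq h1 h2 ?_
  filter_upwards [self_mem_nhdsWithin] with l' hl'
  obtain ⟨c, hc⟩ := hl'.2 s hs
  rw [hc, Pi.smul_apply, rowV_first hl'.1 hN, smul_eq_mul, mul_smul, smul_comm]

/-! ### Density of the good pairs -/

/-- The common eigenspace of some of the folding operators. -/
def foldSpace (S : Set (Fin 4)) (L : ℂ) (c : Fin 4 → ℂ) : Submodule ℂ (Fin (2 * N) → ℂ) where
  carrier := {x | ∀ s ∈ S, foldOp s L x = c s • x}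
  add_mem' := fun hx hy s hs => by rw [foldOp_add, hx s hs, hy s hs, smul_add]
  zero_mem' := fun s _ => by rw [foldOp_zero, smul_zero]
  smul_mem' := fun a x hx s hs => by rw [foldOp_smul, hx s hs, smul_comm]

theorem eq_zero_of_form_eq_zero {x : Fin (2 * N) → ℂ} (h : ∀ y, form x y = 0) : x = 0 := by
  funext i
  have h1 := h (Pi.single i.rev 1)
  rw [form_comm, form_single_left, Fin.rev_rev] at h1
  refine (mul_eq_zero.1 h1).resolve_left fun h0 => ?_
  have := sgn_mul_self N (i.rev : Fin (2 * N))
  rw [h0, mul_zero] at this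
  exact zero_ne_one this

theorem foldOp_comm (hN : 4 ≤ N) (L : ℂ) {s t : Fin 4} (hs : s = 0 ∨ s = 1) (ht : t = 0 ∨ t = 1)
    (x : Fin (2 * N) → ℂ) : foldOp s L (foldOp t L x) = foldOp t L (foldOp s L x) := by
  rcases hs with rfl | rfl <;> rcases ht with rfl | rfl
  exacts [rfl, foldOp_zero_one hN L x, (foldOp_zero_one hN L x).symm, rfl]

-- Symmetrizing y under the operators in S lands in the eigenspace and only multiplies its pairing
-- with x by a nonzero number. Hence x is orthogonal to every vector.
open Classical in
theorem foldSpace_nondegenerate (hN : 4 ≤ N) (hL : L ≠ 0) (hS : ∀ s ∈ S, s = 0 ∨ s = 1)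
    {c : Fin 4 → ℂ} (hc : ∀ s ∈ S, c s = 1) {x : Fin (2 * N) → ℂ} (hx : x ∈ foldSpace S L c)
    (h : ∀ y ∈ foldSpace S L c, form x y = 0) : x = 0 := by
  let P : Fin 4 → (Fin (2 * N) → ℂ) → (Fin (2 * N) → ℂ) := fun s y =>
    y + if s ∈ S then foldOp s L y else y
  have hinv : ∀ s, s = 0 ∨ s = 1 → ∀ y : Fin (2 * N) → ℂ, foldOp s L (foldOp s L y) = y := by
    intro s hs y
    have hsc : foldScale s = 0 := by rcases hs with rfl | rfl <;> rfl
    rw [foldOp_foldOp hN hL, hsc, zpow_zero, one_smul]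
  have hP1 : ∀ s ∈ S, ∀ y, foldOp s L (P s y) = P s y := by
    intro s hs y
    simp only [P, if_pos hs]
    rw [foldOp_add, hinv s (hS s hs), add_comm]
  have hP2 : ∀ s t, s = 0 ∨ s = 1 → t = 0 ∨ t = 1 → ∀ y,
      foldOp t L (P s y) = P s (foldOp t L y) := by
    intro s t hs ht y
    simp only [P]
    split_ifs
    · rw [foldOp_add, foldOp_comm hN L ht hs]
    · rw [foldOp_add]
  have hP3 : ∀ s, s = 0 ∨ s = 1 → ∀ y, form x (P s y) = 2 * form x y := by
    intro s hs y
    simp only [P]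
    rw [form_add_right]
    split_ifs with hsS
    · have hf := form_foldOp hN hL s (fun j hj => sgn_foldPerm_zero hN hs hj) x y
      have hsc : foldScale s = 0 := by rcases hs with rfl | rfl <;> rfl
      rw [hx s hsS, hc s hsS, one_smul, hsc, zpow_zero, one_mul, one_mul] at hf
      rw [hf]
      ring
    · ring
  refine eq_zero_of_form_eq_zero fun y => ?_
  have hmem : P 1 (P 0 y) ∈ foldSpace S L c := by
    intro s hs
    rw [hc s hs, one_smul]
    rcases hS s hs with rfl | rfl
    · rw [hP2 1 0 (Or.inr rfl) (Or.inl rfl), hP1 0 hs]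
    · exact hP1 1 hs _
  have h1 := h _ hmem
  rw [hP3 1 (Or.inr rfl), hP3 0 (Or.inl rfl)] at h1
  simpa using h1

theorem foldOp_single (hN : 4 ≤ N) {s : Fin 4} (hs : s = 0 ∨ s = 1) (L : ℂ) {i : Fin (2 * N)}
    (hi : 1 ≤ (i : ℕ)) (hi' : (i : ℕ) + 2 ≤ N) :
    foldOp s L (Pi.single i 1 : Fin (2 * N) → ℂ) = Pi.single i 1 := by
  have hp : foldPerm N s i = i ∧ foldExp N s i = 0 := by
    rcases hs with rfl | rfl
    · exact ⟨by rw [foldPerm, if_neg (by omega), if_neg (by omega)],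
        by rw [foldExp, if_neg (by omega), if_neg (by omega)]⟩
    · exact ⟨by rw [foldPerm, if_neg (by omega), if_neg (by omega)], rfl⟩
  have he : foldEquiv hN s i = i := Fin.ext hp.1
  funext j
  rw [foldOp_apply hN]
  by_cases h : j = i
  · rw [h, he, hp.2, zpow_zero, one_mul]
  · have h' : foldEquiv hN s j ≠ i := fun h' => h ((foldEquiv hN s).injective (h'.trans he.symm))
    rw [Pi.single_eq_of_ne h', Pi.single_eq_of_ne h, mul_zero]

/-- The unit vectors at the indices 1 and 2 are fixed by both operators and span a totally isotropic
plane; for this N ≥ 4 suffices. -/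
theorem exists_orthogonal_foldSpace (hN : 4 ≤ N) (hL : L ≠ 0) (hS : ∀ s ∈ S, s = 0 ∨ s = 1)
    {c : Fin 4 → ℂ} (hc : ∀ s ∈ S, c s = 1) {a b : Fin (2 * N) → ℂ} (ha : a ∈ foldSpace S L c)
    (hb : b ∈ foldSpace S L c) (haa : form a a = 0) (hbb : form b b = 0) :
    form a b = 0 ∨ ∃ x ∈ foldSpace S L c, form a x = 0 ∧ form b x = 0 ∧ form x x ≠ 0 := by
  have hmem : ∀ i : Fin (2 * N), 1 ≤ (i : ℕ) → (i : ℕ) + 2 ≤ N →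
      (Pi.single i 1 : Fin (2 * N) → ℂ) ∈ foldSpace S L c := fun i h1 h2 s hs => by
    rw [foldOp_single hN (hS s hs) L h1 h2, hc s hs, one_smul]
  have hform : ∀ i j : Fin (2 * N), (i : ℕ) < N → (j : ℕ) < N →
      form (Pi.single i 1 : Fin (2 * N) → ℂ) (Pi.single j 1) = 0 := fun i j hi hj => by
    have : i.rev ≠ j := fun h => by
      have := congrArg Fin.val h
      rw [Fin.val_rev] at this
      omega
    rw [form_single_left, Pi.single_eq_of_ne this, mul_zero]
  have hij : (⟨1, by omega⟩ : Fin (2 * N)) ≠ ⟨2, by omega⟩ := by simp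
  refine exists_orthogonal_of_nondegenerate ha hb haa hbb
    (fun x hx h => foldSpace_nondegenerate hN hL hS hc hx h)
    (hmem ⟨1, by omega⟩ le_rfl (by simp only; omega)) (hmem ⟨2, by omega⟩ (by simp) (by simp only; omega))
    (hform _ _ (by simp only; omega) (by simp only; omega))
    (hform _ _ (by simp only; omega) (by simp only; omega))
    (hform _ _ (by simp only; omega) (by simp only; omega)) fun r s hrs => ?_
  have h1 := congrFun hrs ⟨1, by omega⟩
  have h2 := congrFun hrs ⟨2, by omega⟩
  simp only [Pi.add_apply, Pi.smul_apply, Pi.single_eq_same, Pi.single_eq_of_ne hij,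
    Pi.single_eq_of_ne hij.symm, smul_eq_mul, mul_one, mul_zero, add_zero, zero_add,
    Pi.zero_apply] at h1 h2
  exact ⟨h1, h2⟩

theorem vecMul_evalM_injective (hm : m ∈ crystalB N K) (hN : 4 ≤ N) {z : ℂ} (hz : 1 - K * z ≠ 0)
    {x : Fin (2 * N) → ℂ} (h : x ᵥ* evalM K m z = 0) : x = 0 := by
  refine eq_zero_of_form_eq_zero fun y => ?_
  have h1 := form_vecMul hm hN z x y
  rw [h] at h1
  have h2 : form 0 (y ᵥ* evalM K m z) = 0 := by simp [form]
  rw [h2] at h1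
  exact (mul_eq_zero.1 h1.symm).resolve_left (pow_ne_zero 2 hz)

theorem exists_vecMul_evalM_eq (hm : m ∈ crystalB N K) (hN : 4 ≤ N) {z : ℂ} (hz : 1 - K * z ≠ 0)
    (x : Fin (2 * N) → ℂ) : ∃ y, y ᵥ* evalM K m z = x := by
  refine ⟨((1 - K * z) ^ 2)⁻¹ • (x ᵥ* (signMat N * ((evalM K m z)ᵀ * signMat N))), ?_⟩
  rw [smul_vecMul, vecMul_vecMul, Matrix.mul_assoc, evalM_transpose_mul_signMat_mul hm hN,
    Matrix.mul_smul, signMat_mul_self, vecMul_smul, vecMul_one,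
    inv_smul_smul₀ (pow_ne_zero 2 hz)]

/-- The matrix M_K(m, 1/L) is invertible because L ≠ K, so some b is mapped to v(l), which is good.
A curve of isotropic vectors in the eigenspace from v(l) to b then gives nearby fixed points with
good image. -/
theorem mem_closure_good_outVec (hN : 4 ≤ N) (hLK : L ≠ K)
    (hS : (∀ s ∈ S, s = 0 ∨ s = 1) ∨ ∃ s ∈ S, (s = 2 ∨ s = 3) ∧ Even N)
    (hl : l ∈ foldVar S N L) (hm : m ∈ foldVar S N K) :
    l ∈ closure {l | l ∈ foldVar S N L ∧ Good (outVec L K l m)} := by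
  have hL := level_ne_zero hl.1
  have hz : 1 - K * L⁻¹ ≠ 0 := fun h => hLK (by
    field_simp at h
    linear_combination h)
  have hex : ∀ s, ∃ c : ℂ, s ∈ S → foldOp s L (rowV l) = c • rowV l := fun s => by
    by_cases hs : s ∈ S
    · obtain ⟨c, hc⟩ := hl.2 s hs
      exact ⟨c, fun _ => hc⟩
    · exact ⟨0, fun h => absurd h hs⟩
  choose c hc using hex
  obtain ⟨b, hb⟩ := exists_vecMul_evalM_eq hm.1 hN hz (rowV l)
  have haV : rowV l ∈ foldSpace S L c := fun s hs => hc s hs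
  -- The matrix is injective and commutes with the folding operators, so b has the same eigenvalues
  -- as v(l).
  have hbV : b ∈ foldSpace S L c := fun s hs => by
    refine sub_eq_zero.1 (vecMul_evalM_injective hm.1 hN hz ?_)
    rw [sub_vecMul, ← foldOp_vecMul_of_mem hN hL hm hs, smul_vecMul, hb, hc s hs, sub_self]
  have haa := form_rowV_self hl.1 hN
  have hbb : form b b = 0 := by
    have h1 := form_vecMul hm.1 hN L⁻¹ b b
    rw [hb, haa] at h1
    exact (mul_eq_zero.1 h1.symm).resolve_left (pow_ne_zero 2 hz)
  have hx : form (rowV l) b = 0 ∨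
      ∃ x ∈ foldSpace S L c, form (rowV l) x = 0 ∧ form b x = 0 ∧ form x x ≠ 0 := by
    rcases hS with hS | ⟨s, hs, hs2, hev⟩
    · refine exists_orthogonal_foldSpace hN hL hS (fun s hs => ?_) haV hbV haa hbb
      have h1 := (foldOp_rowV_eq_iff hN s (c s)).1 (hc s hs) 1 (by omega)
      have h2 : foldExp N s 1 = 0 ∧ foldPerm N s 1 = 1 := by
        rcases hS s hs with rfl | rfl
        · exact ⟨by rw [foldExp, if_neg (by omega), if_neg (by omega)],
            by rw [foldPerm, if_neg (by omega), if_neg (by omega)]⟩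
        · exact ⟨rfl, by rw [foldPerm, if_neg (by omega), if_neg (by omega)]⟩
      have hv : rowVec l 1 ≠ 0 := by
        rw [rowVec_of_lt hl.1 hN (by omega)]
        exact div_ne_zero hL (coProd_ne_zero hl.1 _)
      rw [h2.1, h2.2, zpow_zero] at h1
      exact (mul_right_cancel₀ hv h1).symm
    -- With c² = 1/L the operator multiplies the pairing of v(l) and b by 1/L, whereas it multiplies
    -- the form by -1/L; so the pairing vanishes.
    · left
      have h1 := form_foldOp hN hL s (fun j hj => sgn_foldPerm_two hN hev hs2 hj) (rowV l) b
      have h2 := sq_eq_of_foldOp_eq hN hL (rowV_ne_zero hl.1 hN) (hc s hs)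
      have hsc : foldScale s = 1 := by rcases hs2 with rfl | rfl <;> rfl
      rw [haV s hs, hbV s hs, form_smul_left, form_smul_right] at h1
      rw [hsc, zpow_one] at h1 h2
      have h3 : (2 * L⁻¹) * form (rowV l) b = 0 := by
        linear_combination h1 - form (rowV l) b * h2
      exact (mul_eq_zero.1 h3).resolve_left (mul_ne_zero two_ne_zero (inv_ne_zero hL))
  have key := mem_closure_good hN hl.1 haV (evalM K m L⁻¹) hbV hbb
    (by rw [hb]; exact good_rowV hl.1 hN) hx
  refine closure_mono ?_ key
  rintro l' ⟨h1, h2, h3⟩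
  exact ⟨⟨h1, fun s hs => ⟨c s, h2 s hs⟩⟩, h3⟩

/-- The case of equal levels. -/
theorem mem_closure_good_outVec_self (hN : 4 ≤ N) (hl : l ∈ crystalB N L)
    (hm : m ∈ crystalB N L) :
    l ∈ closure {l | l ∈ crystalB N L ∧ Good (outVec L L l m)} := by
  have hL := level_ne_zero hl
  have hmem : ∀ x : Fin (2 * N) → ℂ, x ∈ foldSpace ∅ L 0 := fun x s hs => absurd hs (by simp)
  have hbb : form (Pi.single (firstIdx hN) 1 : Fin (2 * N) → ℂ) (Pi.single (firstIdx hN) 1) = 0 := by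
    have : (firstIdx hN).rev ≠ firstIdx hN := fun h => by
      have := congrArg Fin.val h
      rw [Fin.val_rev] at this
      simp only [firstIdx] at this
      omega
    rw [form_single_left, Pi.single_eq_of_ne this, mul_zero]
  -- The matrix now has rank one, and the first unit vector goes to a nonzero multiple of v(m)
  -- because u(m) has a nonzero first entry.
  have hg : Good ((Pi.single (firstIdx hN) 1 : Fin (2 * N) → ℂ) ᵥ* evalM L m L⁻¹) := by
    have hc : L⁻¹ * colV m (firstIdx hN) ≠ 0 := by
      refine mul_ne_zero (inv_ne_zero hL) ?_
      rw [colV, firstIdx, colVec_zero m hN]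
      exact div_ne_zero (co_ne_zero hm 1) (cobar_ne_zero hm 1)
    have : (Pi.single (firstIdx hN) 1 : Fin (2 * N) → ℂ) ᵥ* evalM L m L⁻¹
        = (L⁻¹ * colV m (firstIdx hN)) • rowV m := by
      rw [single_one_vecMul, evalM_inv_level hL]
      funext j
      simp only [Matrix.row, Matrix.smul_apply, vecMulVec_apply, Pi.smul_apply, smul_eq_mul,
        mul_assoc]
    rw [this, good_smul hc]
    exact good_rowV hm hN
  have key := mem_closure_good hN hl (hmem _) (evalM L m L⁻¹) (hmem _) hbb hg
    (exists_orthogonal_foldSpace hN hL (by simp) (by simp) (hmem _) (hmem _)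
      (form_rowV_self hl hN) hbb)
  refine closure_mono ?_ key
  rintro l' ⟨h1, -, h3⟩
  exact ⟨h1, h3⟩

end FoldVarieties

end FoldedR

namespace FoldedR

open Matrix

/-! ### The rational map -/

section Main

variable {N : ℕ} {L K : ℂ} {S : Set (Fin 4)}

theorem prodSet_foldVar_subset :
    prodSet (foldVar S N L) (foldVar S N K) ⊆ prodSet (crystalB N L) (crystalB N K) :=
  fun _ hp => ⟨hp.1.1, hp.2.1⟩

/-- The two goodness conditions are open, so each may be treated alone: the first by moving l with m
fixed, the second by moving `dag m` with l fixed. -/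
theorem prodSet_subset_closure_goodSet (hN : 4 ≤ N)
    (h : ∀ l ∈ foldVar S N L, ∀ m ∈ foldVar S N K,
      l ∈ closure {l | l ∈ foldVar S N L ∧ Good (outVec L K l m)})
    (h' : ∀ m ∈ foldVar S N K, ∀ l ∈ foldVar S N L,
      m ∈ closure {m | m ∈ foldVar S N K ∧ Good (outVec K L m l)}) :
    prodSet (foldVar S N L) (foldVar S N K)
      ⊆ closure (goodSet N L K ∩ prodSet (foldVar S N L) (foldVar S N K)) := by
  have hX := prodSet_foldVar_subset (N := N) (L := L) (K := K) (S := S)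
  have hU := isZariskiOpenIn_ne_zero (goodPoly_mem_regularFunctions
    (isRegularOn_outVec_left hX))
  have hV := isZariskiOpenIn_ne_zero (goodPoly_mem_regularFunctions
    (isRegularOn_outVec_right hN hX))
  refine (subset_closure_inter hU (fun p hp => ?_) hV.1 fun p hp => ?_).trans
    (closure_mono fun p hp => ⟨⟨hX hp.1.1, hp.1.2, hp.2.2⟩, hp.1.1⟩)
  · have hc : Continuous fun l : Idx N → ℂ => (Sum.elim l (p ∘ Sum.inr) : Idx N ⊕ Idx N → ℂ) :=
      continuous_pi fun k => by
        rcases k with k | k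
        · exact continuous_apply k
        · exact continuous_const
    have := map_mem_closure hc (h _ hp.1 _ hp.2) (t := {q | q ∈ prodSet (foldVar S N L)
      (foldVar S N K) ∧ goodPoly (outVec L K (q ∘ Sum.inl) (q ∘ Sum.inr)) ≠ 0})
      fun l hl => ⟨⟨hl.1, hp.2⟩, hl.2⟩
    rwa [Sum.elim_comp_inl_inr] at this
  · have hd := dag_mem_foldVar hN hp.2
    have hc : ContinuousOn (fun m : Idx N → ℂ =>
        (Sum.elim (p ∘ Sum.inl) (dag m) : Idx N ⊕ Idx N → ℂ)) (crystalB N K) :=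
      continuousOn_pi.2 fun k => by
        rcases k with k | k
        · exact continuousOn_const
        · exact continuousOn_pi.1 continuousOn_dag k
    have hcl := h' _ hd _ (dag_mem_foldVar hN hp.1)
    have := ((hc _ hd.1).mono (fun m hm => hm.1.1)).mem_closure hcl
      (t := {q | q ∈ prodSet (foldVar S N L) (foldVar S N K) ∧
        goodPoly (outVec K L (dag (q ∘ Sum.inr)) (dag (q ∘ Sum.inl))) ≠ 0})
      fun m hm => ⟨⟨hp.1, dag_mem_foldVar hN hm.1⟩, by
        rw [Sum.elim_comp_inl, Sum.elim_comp_inr, dag_dag hm.1.1 hN]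
        exact hm.2⟩
    rwa [dag_dag hp.2.1 hN, Sum.elim_comp_inl_inr] at this

theorem mem_prodSet_of_mem_closure (hN : 4 ≤ N) {p : Idx N ⊕ Idx N → ℂ}
    (hp : p ∈ prodSet (crystalB N L) (crystalB N K))
    (h : p ∈ closure (prodSet (foldVar S N L) (foldVar S N K))) :
    p ∈ prodSet (foldVar S N L) (foldVar S N K) :=
  ⟨mem_foldVar_of_mem_closure hN hp.1
    (map_mem_closure (f := fun p : Idx N ⊕ Idx N → ℂ => p ∘ Sum.inl) (by fun_prop) h
      fun _ hq => hq.1),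
    mem_foldVar_of_mem_closure hN hp.2
    (map_mem_closure (f := fun p : Idx N ⊕ Idx N → ℂ => p ∘ Sum.inr) (by fun_prop) h
      fun _ hq => hq.2)⟩

theorem isZariskiDenseIn_goodSet (hN : 4 ≤ N) (hLK : L ≠ K)
    (hS : (∀ s ∈ S, s = 0 ∨ s = 1) ∨ ∃ s ∈ S, (s = 2 ∨ s = 3) ∧ Even N) :
    prodSet (foldVar S N L) (foldVar S N K)
      ⊆ closure (goodSet N L K ∩ prodSet (foldVar S N L) (foldVar S N K)) :=
  prodSet_subset_closure_goodSet hN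
    (fun _ hl _ hm => mem_closure_good_outVec hN hLK hS hl hm)
    fun _ hm _ hl => mem_closure_good_outVec hN hLK.symm hS hm hl

/-- On good pairs the maps for (L, K) and (K, L) are mutually inverse, and both preserve the folded
varieties. -/
theorem isBirationalOn_rmap (hN : 4 ≤ N) (hL : L ≠ 0) (hK : K ≠ 0) (hLK : L ≠ K)
    (hS : (∀ s ∈ S, s = 0 ∨ s = 1) ∨ ∃ s ∈ S, (s = 2 ∨ s = 3) ∧ Even N)
    {D : Set (Idx N ⊕ Idx N → ℂ)} {f : (Idx N ⊕ Idx N → ℂ) → (Idx N ⊕ Idx N → ℂ)}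
    (hD : goodSet N L K ∩ prodSet (foldVar S N L) (foldVar S N K) ⊆ D)
    (hf : Set.EqOn f (rmap L K) (goodSet N L K)) :
    IsBirationalOn (prodSet (foldVar S N L) (foldVar S N K))
      (prodSet (foldVar S N K) (foldVar S N L)) D f := by
  refine ⟨goodSet N L K ∩ prodSet (foldVar S N L) (foldVar S N K),
    goodSet N K L ∩ prodSet (foldVar S N K) (foldVar S N L), rmap K L, hD,
    (isZariskiOpenIn_goodSet hN).restrict prodSet_foldVar_subset,
    isZariskiDenseIn_of_subset_closure (isZariskiDenseIn_goodSet hN hLK hS),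
    (isZariskiOpenIn_goodSet hN).restrict prodSet_foldVar_subset,
    isZariskiDenseIn_of_subset_closure (isZariskiDenseIn_goodSet hN hLK.symm hS),
    ((isRegularOn_rmap hN hK).congr hf).mono Set.inter_subset_left,
    (isRegularOn_rmap hN hL).mono Set.inter_subset_left, fun p hp => ?_, fun q hq => ?_,
    fun p hp => ?_, fun q hq => ?_⟩
  · rw [hf hp.1]
    exact ⟨rmap_mem_goodSet hN hL hK hLK hp.1, rmap_mem_prodSet_foldVar hN hp.2 hp.1⟩
  · exact ⟨rmap_mem_goodSet hN hK hL hLK.symm hq.1, rmap_mem_prodSet_foldVar hN hq.2 hq.1⟩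
  · rw [hf hp.1, rmap_rmap hN hL hK hLK hp.1]
  · rw [hf (rmap_mem_goodSet hN hK hL hLK.symm hq.1), rmap_rmap hN hK hL hLK.symm hq.1]

/-- A rational map with the properties of the theorem, for the fixed-point varieties described by
folding operators. -/
def IsFoldedRMap (R : RationalMap (prodSet (crystalB N L) (crystalB N K))
    (prodSet (crystalB N K) (crystalB N L))) : Prop :=
  IsDefinedByMEquation R ∧
    ∀ S : Set (Fin 4), ((∀ s ∈ S, s = 0 ∨ s = 1) ∨ ∃ s ∈ S, (s = 2 ∨ s = 3) ∧ Even N) →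
      R.RestrictsBirationally (prodSet (foldVar S N L) (foldVar S N K))
        (prodSet (foldVar S N K) (foldVar S N L))

theorem exists_isFoldedRMap_of_ne (hN : 4 ≤ N) (hL : L ≠ 0) (hK : K ≠ 0) (hLK : L ≠ K) :
    ∃ R : RationalMap (prodSet (crystalB N L) (crystalB N K))
      (prodSet (crystalB N K) (crystalB N L)), IsFoldedRMap R := by
  have hopen := isZariskiOpenIn_goodSet (N := N) (L := L) (K := K) hN
  have hdense : IsZariskiDenseIn (prodSet (crystalB N L) (crystalB N K)) (goodSet N L K) := by
    have := isZariskiDenseIn_of_subset_closure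
      (isZariskiDenseIn_goodSet (S := ∅) hN hLK (Or.inl (by simp)))
    rw [foldVar_empty, foldVar_empty] at this
    exact this.mono Set.inter_subset_left
  obtain ⟨R, hsub, heq⟩ := exists_rationalMap_extending hopen hdense (isRegularOn_rmap hN hK)
    fun p hp => rmap_mem hN hL hK hp
  refine ⟨R, ⟨fun p hp => ?_, goodSet N L K, hsub, hopen, hdense, fun p hp q hq h => ?_⟩,
    fun S hS => ⟨?_, ?_, isBirationalOn_rmap hN hL hK hLK hS
      (fun p hp => ⟨hsub hp.1, hp.2⟩) heq⟩⟩
  · have hdom := R.isOpen.1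
    have h1 := isRegularOn_comp_inl R.dom
    have h2 := isRegularOn_comp_inr R.dom
    have h3 : IsRegularOn R.dom fun p => R.toFun p ∘ Sum.inl :=
      isRegularOn_iff.2 fun k => isRegularOn_iff.1 R.isRegular (Sum.inl k)
    have h4 : IsRegularOn R.dom fun p => R.toFun p ∘ Sum.inr :=
      isRegularOn_iff.2 fun k => isRegularOn_iff.1 R.isRegular (Sum.inr k)
    -- The M-equation extends from the good pairs to the whole domain, its entries being regular
    -- functions there.
    refine mEquation_iff.2 fun z => Matrix.ext fun i j => sub_eq_zero.1 ?_
    refine eq_zero_of_isZariskiDenseIn hdense hopen.1 R.isOpen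
      (f := fun p => (evalM L (p ∘ Sum.inl) z * evalM K (p ∘ Sum.inr) z) i j
        - (evalM K (R.toFun p ∘ Sum.inl) z * evalM L (R.toFun p ∘ Sum.inr) z) i j)
      (regularFunctions_sub (regularFunctions_sum Finset.univ fun k _ => regularFunctions_mul
          (evalM_mem_regularFunctions h1 (fun _ hp => (hdom hp).1) z i k)
          (evalM_mem_regularFunctions h2 (fun _ hp => (hdom hp).2) z k j))
        (regularFunctions_sum Finset.univ fun k _ => regularFunctions_mul
          (evalM_mem_regularFunctions h3 (fun _ hp => (R.mapsTo hp).1) z i k)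
          (evalM_mem_regularFunctions h4 (fun _ hp => (R.mapsTo hp).2) z k j)))
      (fun q hq _ => ?_) p hp
    have := mEquation_iff.1 (mEquation_rmap hN hL hK hLK hq) z
    rw [← heq hq] at this
    simp only [this, sub_self]
  · rw [heq hp]
    exact eq_rmap hN hp hq h
  · exact (isZariskiDenseIn_of_subset_closure (isZariskiDenseIn_goodSet hN hLK hS)).mono
      fun p hp => ⟨hsub hp.1, hp.2⟩
  -- A point of the domain in the folded variety is a limit of good folded pairs, whose images are
  -- folded; being folded is a closed condition within the crystal.
  · intro p hp
    refine mem_prodSet_of_mem_closure hN (R.mapsTo hp.1) ?_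
    have hc := (R.isRegular.continuousOn p hp.1).mono
      (s := goodSet N L K ∩ prodSet (foldVar S N L) (foldVar S N K)) fun q hq => hsub hq.1
    refine hc.mem_closure (isZariskiDenseIn_goodSet hN hLK hS hp.2) fun q hq => ?_
    rw [heq hq.1]
    exact rmap_mem_prodSet_foldVar hN hq.2 hq.1

/-- For equal levels (l, m) itself solves the equation, so the identity is the map; on good pairs
`eq_rmap` shows that it is the only solution. -/
theorem exists_isFoldedRMap_self (hN : 4 ≤ N) :
    ∃ R : RationalMap (prodSet (crystalB N L) (crystalB N L))
      (prodSet (crystalB N L) (crystalB N L)), IsFoldedRMap R := by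
  have hopen := isZariskiOpenIn_goodSet (N := N) (L := L) (K := L) hN
  have hdense : IsZariskiDenseIn (prodSet (crystalB N L) (crystalB N L)) (goodSet N L L) := by
    have h : ∀ l ∈ foldVar ∅ N L, ∀ m ∈ foldVar ∅ N L,
        l ∈ closure {l | l ∈ foldVar ∅ N L ∧ Good (outVec L L l m)} := by
      rw [foldVar_empty]
      exact fun l hl m hm => mem_closure_good_outVec_self hN hl hm
    have := isZariskiDenseIn_of_subset_closure (prodSet_subset_closure_goodSet hN h h)
    rw [foldVar_empty] at this
    exact this.mono Set.inter_subset_left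
  obtain ⟨R, hsub, heq⟩ := exists_rationalMap_extending
    (isZariskiOpenIn_self (prodSet (crystalB N L) (crystalB N L))) (isZariskiDenseIn_self _)
    (isRegularOn_id _) (Set.mapsTo_id _)
  have hdom : R.dom = prodSet (crystalB N L) (crystalB N L) := R.isOpen.1.antisymm hsub
  refine ⟨R, ⟨fun p hp => ?_, goodSet N L L, hopen.1.trans hsub, hopen, hdense,
    fun p hp q hq h => ?_⟩, fun S _ => ?_⟩
  · rw [heq (hdom ▸ hp)]
    rfl
  · rw [heq (hopen.1 hp), eq_rmap hN hp hq h]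
    exact (eq_rmap hN hp hp.1 rfl).symm
  · have hX := prodSet_foldVar_subset (N := N) (L := L) (K := L) (S := S)
    have hI : R.dom ∩ prodSet (foldVar S N L) (foldVar S N L)
        = prodSet (foldVar S N L) (foldVar S N L) := by
      rw [hdom]
      exact Set.inter_eq_right.2 hX
    have hid : Set.EqOn R.toFun id (prodSet (foldVar S N L) (foldVar S N L)) :=
      fun p hp => heq (hX hp)
    have hm : Set.MapsTo R.toFun (prodSet (foldVar S N L) (foldVar S N L))
        (prodSet (foldVar S N L) (foldVar S N L)) := fun p hp => by
      rw [hid hp]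
      exact hp
    rw [RationalMap.RestrictsBirationally, hI]
    exact ⟨isZariskiDenseIn_self _, hm, _, _, id, subset_rfl, isZariskiOpenIn_self _,
      isZariskiDenseIn_self _, isZariskiOpenIn_self _, isZariskiDenseIn_self _,
      (isRegularOn_id _).congr hid, isRegularOn_id _, hm, Set.mapsTo_id _,
      fun p hp => hid hp, fun p hp => hid hp⟩

theorem exists_isFoldedRMap (hN : 4 ≤ N) (hL : L ≠ 0) (hK : K ≠ 0) :
    ∃ R : RationalMap (prodSet (crystalB N L) (crystalB N K))
      (prodSet (crystalB N K) (crystalB N L)), IsFoldedRMap R := by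
  rcases eq_or_ne L K with rfl | h
  · exact exists_isFoldedRMap_self hN
  · exact exists_isFoldedRMap_of_ne hN hL hK h

/-- On the dense intersection of the uniqueness locus of R with the domain of R', the value of R' is
a solution and hence the value of R. -/
theorem IsDefinedByMEquation.unique {R R' : RationalMap (prodSet (crystalB N L) (crystalB N K))
    (prodSet (crystalB N K) (crystalB N L))} (hR : IsDefinedByMEquation R)
    (hR' : IsDefinedByMEquation R') :
    R'.dom = R.dom ∧ Set.EqOn R'.toFun R.toFun R.dom := by
  obtain ⟨-, U, hU, hUo, hUd, huniq⟩ := hR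
  refine RationalMap.eq_of_eqOn_dense R R' (hUd.inter_of_isOpen hUo.1 R'.isOpen R'.isDense)
    (fun p hp => hUo.1 hp.2) fun p hp => ?_
  exact huniq p hp.2 _ (R'.mapsTo hp.1) (hR'.1 p hp.1)

end Main

end FoldedR
end

/-! ### Assembly of the main theorem -/

open FoldedR in
theorem mainTheorem7 (N : ℕ) (hN : 4 ≤ N) (L K : ℂ) (hL : L ≠ 0) (hK : K ≠ 0) :
    ∃ R : RationalMap (prodSet (crystalB N L) (crystalB N K))
        (prodSet (crystalB N K) (crystalB N L)),
      IsDefinedByMEquation R ∧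
      (∀ R' : RationalMap (prodSet (crystalB N L) (crystalB N K))
          (prodSet (crystalB N K) (crystalB N L)),
        IsDefinedByMEquation R' → R'.dom = R.dom ∧ Set.EqOn R'.toFun R.toFun R.dom) ∧
      R.IsBirational ∧
      (∀ (i : Fin 5) (n : ℕ), foldRank i n = N →
        R.RestrictsBirationally (prodSet (fixedVariety i N L) (fixedVariety i N K))
          (prodSet (fixedVariety i N K) (fixedVariety i N L))) ∧
      (∀ n : ℕ, foldRank 4 n = N →
        R.RestrictsBirationally (prodSet (commonFixedVariety N L) (commonFixedVariety N K))
          (prodSet (commonFixedVariety N K) (commonFixedVariety N L))) := by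
  obtain ⟨R, hR, hres⟩ := exists_isFoldedRMap hN hL hK
  refine ⟨R, hR, fun R' hR' => hR.unique hR', ?_, fun i n hn => ?_, fun n hn => ?_⟩
  -- With no folding operators the folded variety is the whole crystal.
  · have h := (hres ∅ (Or.inl (by simp))).2.2
    rw [foldVar_empty, foldVar_empty, Set.inter_eq_left.2 R.isOpen.1] at h
    exact h
  · fin_cases i
    · have h := hres {0} (Or.inl (by simp))
      rwa [← fixedVariety_zero hN, ← fixedVariety_zero hN] at h
    · have h := hres {1} (Or.inl (by simp))
      rwa [← fixedVariety_one hN, ← fixedVariety_one hN] at h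
    · have hev : Even N := ⟨n, by have h : 2 * n = N := hn; omega⟩
      have h := hres {2} (Or.inr ⟨2, by simp, Or.inl rfl, hev⟩)
      rwa [← fixedVariety_two hN hev, ← fixedVariety_two hN hev] at h
    · have h := hres {0, 1} (Or.inl (by simp))
      rwa [← fixedVariety_three hN, ← fixedVariety_three hN] at h
    · have hev : Even N := ⟨n + 1, by have h : 2 * n + 2 = N := hn; omega⟩
      have h := hres {3} (Or.inr ⟨3, by simp, Or.inr rfl, hev⟩)
      rwa [← fixedVariety_four hN hev, ← fixedVariety_four hN hev] at h
  · have hev : Even N := ⟨n + 1, by have h : 2 * n + 2 = N := hn; omega⟩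
    have h := hres {0, 1, 2} (Or.inr ⟨2, by simp, Or.inl rfl, hev⟩)
    rwa [← commonFixedVariety_eq hN hev, ← commonFixedVariety_eq hN hev] at h
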